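/- **Setting.** Let $\phi=\mathbf 1_{[0,1]}$, let $r>0$, and let $\psi,\tilde\phi,\tilde\psi:\mathbb R\to\mathbb R$ be compactly supported functions such that $\tilde\phi,\tilde\psi$ belong to the Hölder space $C^{r+1}$, $\psi$ is piecewise constant and orthogonal to all polynomials of degree at most $r$. For $k\in\mathbb Z$ put $\psi_{-1k}(x)=\phi(x-k)$, $\tilde\psi_{-1k}(x)=\tilde\phi(x-k)$ and, for $j\ge 0$, $\psi_{jk}(x)=2^{j/2}\psi(2^jx-k)$, $\tilde\psi_{jk}(x)=2^{j/2}\tilde\psi(2^jx-k)$. Assume that these functions form a biorthogonal wavelet basis of $\mathbb L_2(\mathbb R)$, that is, $\int\psi_{jk}\tilde\psi_{j'k'}=\mathbf 1_{j=j',k=k'}$ for all $j,j'\ge -1$, $k,k'\in\mathbb Z$, and the only $g\in\mathbb L_2(\mathbb R)$ with $\int\psi_{jk}g=0$ for all $j\ge-1$, $k\in\mathbb Z$ is $g=0$. Write $\beta_{jk}=\int \psi_{jk}f$. For $1\le p,q\le\infty$, $\alpha\in\mathbb R$ and $R>0$, $\mathcal B^\alpha_{p,q}(R)$ is the set of $f\in\mathbb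 L_2(\mathbb R)$ (with no restriction on the support) such that $$\|(\beta_{-1k})_k\|_{\ell_p}+\Big\|\Big(2^{j(\alpha+\frac12-\frac1p)}\|(\beta_{jk})_k\|_{\ell_p}\Big)_{j\ge0}\Big\|_{\ell_q}\le R .$$ For $R'>0$, $\mathbb L_2(R')$ is the set of probability densities $f$ with $\|f\|_2\le R'$, and $\mathcal L_{2,\infty}(R')$ is the set of those which moreover satisfy $\|f\|_\infty\le R'$. **Estimator.** Let $n\ge2$ and let $X_1,\dots,X_n$ be i.i.d. with density $f$. For constants $c\ge1$ and $\gamma>0$ set $j_0=\lfloor\log_2(\lfloor n^c(\ln n)^{-c}\rfloor)\rfloor$ and $$\hat\beta_{jk}=\frac1n\sum_{i=1}^n\psi_{jk}(X_i),\qquad \hat\sigma^2_{jk}=\frac1{n(n-1)}\sum_{i=2}^n\sum_{l=1}^{i-1}(\psi_{jk}(X_i)-\psi_{jk}(X_l))^2,$$ $$\tilde\sigma_{jk}^2=\hat\sigma^2_{jk}+2\|\psi_{jk}\|_\infty\sqrt{2\gamma\hat\sigma_{jk}^2\frac{\ln n}n}+8\gamma\|\psi_{jk}\|_\infty^2\frac{\ln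 n}n,\qquad \eta_{jk}=\sqrt{2\gamma\tilde\sigma_{jk}^2\frac{\ln n}n}+\frac{2\|\psi_{jk}\|_\infty\gamma\ln n}{3n},$$ $$\tilde f_{n,\gamma}=\sum_{-1\le j\le j_0}\sum_{k\in\mathbb Z}\hat\beta_{jk}\mathbf 1_{|\hat\beta_{jk}|\ge\eta_{jk}}\tilde\psi_{jk}.$$ **Theorem.** Let $R,R'>0$, $1\le p,q\le\infty$ and $\max(0,\frac1p-\frac12)<\alpha<r+1$. Let $c\ge1$ be such that $$\alpha\Big(1-\frac1{c(1+2\alpha)}\Big)\ge\frac1p-\frac12$$ and let $\gamma>c$. Then there is a constant $C$, depending only on $R'$, $\gamma$, $c$, on the parameters $\alpha,p,q,R$ of the Besov ball and on the biorthogonal wavelet basis, such that for every integer $n\ge2$: - if $p\le2$, $$\sup_{f\in\mathcal B^\alpha_{p,q}(R)\cap\mathcal L_{2,\infty}(R')}\mathbb E\big[\|\tilde f_{n,\gamma}-f\|_2^2\big]\le C\Big(\frac{\ln n}n\Big)^{\frac{2\alpha}{2\alpha+1}};$$ - if $p>2$, $$\sup_{f\in\mathcal B^\alpha_{p,q}(R)\cap\mathbb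 L_2(R')}\mathbb E\big[\|\tilde f_{n,\gamma}-f\|_2^2\big]\le C\Big(\frac{\ln n}n\Big)^{\frac{\alpha}{\alpha+1-\frac1p}}.$$ -/

import Mathlib

open MeasureTheory
open scoped ENNReal

noncomputable section

namespace WaveletDensity

/-! ### Biorthogonal wavelet bases built on the box function -/

/-- The decomposition father wavelet `φ = 1_{[0,1]}`. -/
def box : ℝ → ℝ := Set.indicator (Set.Icc 0 1) (fun _ => 1)

/-- The family generated by a father wavelet `φ` and a mother wavelet `ψ`, indexed by
`j ≥ -1` and `k ∈ ℤ`: `φ (x - k)` at level `j = -1`, and `2^{j/2} ψ (2^j x - k)` at the levels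
`j ≥ 0`. (The levels `j < -1` are never used.) -/
def wavelet (φ ψ : ℝ → ℝ) (j k : ℤ) (x : ℝ) : ℝ :=
  if j = -1 then φ (x - k) else (2 : ℝ) ^ ((j : ℝ) / 2) * ψ ((2 : ℝ) ^ j * x - k)

/-- `g` is piecewise constant: off finitely many break points it is constant on every
interval. -/
def PiecewiseConstant (g : ℝ → ℝ) : Prop :=
  ∃ S : Finset ℝ, ∀ x y : ℝ, x ≤ y → Disjoint (Set.Icc x y) (S : Set ℝ) → g x = g y

/-- Hölder regularity of order `s > 0` (for compactly supported functions): writing `s = m + δ`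
with `m` an integer and `0 < δ ≤ 1`, the function is `m` times continuously differentiable and
its `m`-th derivative is Hölder continuous with exponent `δ`. -/
def HolderRegular (s : ℝ) (g : ℝ → ℝ) : Prop :=
  ∃ (m : ℕ) (δ : ℝ), 0 < δ ∧ δ ≤ 1 ∧ s = m + δ ∧ ContDiff ℝ m g ∧
    ∃ L : ℝ, ∀ x y : ℝ, |iteratedDeriv m g x - iteratedDeriv m g y| ≤ L * |x - y| ^ δ

/-- `(1_{[0,1]}, ψ, φt, ψt)` generates a biorthogonal wavelet basis of `L²(ℝ)` with smoothness
parameter `r`: piecewise constant decomposition wavelets `ψ`, smooth reconstruction wavelets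
`φt`, `ψt`. -/
structure IsBiorthogonalWaveletBasis (r : ℝ) (ψ φt ψt : ℝ → ℝ) : Prop where
  compact_φt : HasCompactSupport φt
  compact_ψt : HasCompactSupport ψt
  smooth_φt : HolderRegular (r + 1) φt
  smooth_ψt : HolderRegular (r + 1) ψt
  compact_ψ : HasCompactSupport ψ
  piecewise_ψ : PiecewiseConstant ψ
  /-- `ψ` is orthogonal to the polynomials of degree at most `r`. -/
  moments_ψ : ∀ P : Polynomial ℝ, (P.natDegree : ℝ) ≤ r → ∫ x, P.eval x * ψ x = 0
  /-- The two families are biorthogonal to each other. -/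
  biorthogonal : ∀ j j' : ℤ, -1 ≤ j → -1 ≤ j' → ∀ k k' : ℤ,
    ∫ x, wavelet box ψ j k x * wavelet φt ψt j' k' x = if j = j' ∧ k = k' then 1 else 0
  /-- The family is complete in `L²(ℝ)` (a basis, not only a biorthogonal system): a square
  integrable function all of whose coefficients vanish is zero. -/
  complete : ∀ g : ℝ → ℝ, MemLp g 2 volume →
    (∀ j : ℤ, -1 ≤ j → ∀ k : ℤ, ∫ x, wavelet box ψ j k x * g x = 0) → g =ᵐ[volume] 0

/-- The coefficient `β_{jk} = ∫ ψ_{jk} f` of `f`. -/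
def coeff (ψ f : ℝ → ℝ) (j k : ℤ) : ℝ := ∫ x, wavelet box ψ j k x * f x

/-! ### Besov balls and density classes -/

/-- The `ℓ_p` norm, `0 < p ≤ ∞`, of a family of elements of `[0, ∞]`. -/
def ellNorm {ι : Type*} (p : ℝ≥0∞) (a : ι → ℝ≥0∞) : ℝ≥0∞ :=
  if p = ∞ then ⨆ i, a i else (∑' i, a i ^ p.toReal) ^ (1 / p.toReal)

/-- The Besov norm of `f` (possibly infinite), read on its wavelet coefficients. The real number
`1/p` is `(p⁻¹).toReal`, which is `0` for `p = ∞`. -/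
def besovNorm (ψ : ℝ → ℝ) (α : ℝ) (p q : ℝ≥0∞) (f : ℝ → ℝ) : ℝ≥0∞ :=
  ellNorm p (fun k : ℤ => ‖coeff ψ f (-1) k‖ₑ) +
    ellNorm q (fun j : ℕ =>
      ENNReal.ofReal ((2 : ℝ) ^ ((j : ℝ) * (α + 1 / 2 - (p⁻¹).toReal))) *
        ellNorm p (fun k : ℤ => ‖coeff ψ f (j : ℤ) k‖ₑ))

/-- The Besov ball of radius `R`; there is no restriction on supports. -/
def besovBall (ψ : ℝ → ℝ) (α : ℝ) (p q : ℝ≥0∞) (R : ℝ) : Set (ℝ → ℝ) :=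
  {f | MemLp f 2 volume ∧ besovNorm ψ α p q f ≤ ENNReal.ofReal R}

/-- `f` is a probability density on the real line. -/
def IsDensity (f : ℝ → ℝ) : Prop :=
  0 ≤ᵐ[volume] f ∧ Integrable f volume ∧ ∫ x, f x = 1

/-- Densities with `‖f‖_2 ≤ R`. -/
def densityL2 (R : ℝ) : Set (ℝ → ℝ) :=
  {f | IsDensity f ∧ eLpNorm f 2 volume ≤ ENNReal.ofReal R}

/-- Densities with `‖f‖_2 ≤ R` and `‖f‖_∞ ≤ R`. -/
def densityL2Linf (R : ℝ) : Set (ℝ → ℝ) :=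
  {f | IsDensity f ∧ eLpNorm f 2 volume ≤ ENNReal.ofReal R ∧
    eLpNorm f ∞ volume ≤ ENNReal.ofReal R}

/-! ### The thresholding estimator -/

/-- The sup norm of a bounded function. -/
def supNorm (g : ℝ → ℝ) : ℝ := ⨆ x, |g x|

/-- The empirical coefficient `(1/n) ∑ ψ_{jk}(X_i)`. -/
def empCoeff (ψ : ℝ → ℝ) {n : ℕ} (X : Fin n → ℝ) (j k : ℤ) : ℝ :=
  (1 / (n : ℝ)) * ∑ i, wavelet box ψ j k (X i)

/-- The unbiased estimator of the variance of `ψ_{jk}(X_1)`. -/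
def empVar (ψ : ℝ → ℝ) {n : ℕ} (X : Fin n → ℝ) (j k : ℤ) : ℝ :=
  (1 / ((n : ℝ) * ((n : ℝ) - 1))) *
    ∑ i, ∑ l ∈ Finset.Iio i, (wavelet box ψ j k (X i) - wavelet box ψ j k (X l)) ^ 2

/-- The slightly overestimated variance. -/
def overVar (ψ : ℝ → ℝ) (γ : ℝ) {n : ℕ} (X : Fin n → ℝ) (j k : ℤ) : ℝ :=
  empVar ψ X j k
    + 2 * supNorm (wavelet box ψ j k) *
        Real.sqrt (2 * γ * empVar ψ X j k * (Real.log n / n))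
    + 8 * γ * supNorm (wavelet box ψ j k) ^ 2 * (Real.log n / n)

/-- The data-driven threshold `η_{jk,γ}`. -/
def threshold (ψ : ℝ → ℝ) (γ : ℝ) {n : ℕ} (X : Fin n → ℝ) (j k : ℤ) : ℝ :=
  Real.sqrt (2 * γ * overVar ψ γ X j k * (Real.log n / n))
    + 2 * supNorm (wavelet box ψ j k) * γ * Real.log n / (3 * n)

/-- The thresholded empirical coefficient. -/
def threshCoeff (ψ : ℝ → ℝ) (γ : ℝ) {n : ℕ} (X : Fin n → ℝ) (j k : ℤ) : ℝ :=
  if threshold ψ γ X j k ≤ |empCoeff ψ X j k| then empCoeff ψ X j k else 0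

/-- The finest resolution level `j₀ = ⌊log₂ ⌊n^c (ln n)^{c'}⌋⌋`. -/
def maxLevel (c c' : ℝ) (n : ℕ) : ℤ :=
  ⌊Real.logb 2 (⌊(n : ℝ) ^ c * Real.log n ^ c'⌋ : ℝ)⌋

/-- The thresholding estimator computed from the sample `X`, evaluated at `x`. At each `x`
only finitely many terms of the sum over `k` are nonzero. -/
def estimator (ψ φt ψt : ℝ → ℝ) (c c' γ : ℝ) {n : ℕ} (X : Fin n → ℝ) (x : ℝ) : ℝ :=
  ∑ j ∈ Finset.Icc (-1) (maxLevel c c' n), ∑' k : ℤ,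
    threshCoeff ψ γ X j k * wavelet φt ψt j k x

/-- The quadratic risk `E ‖f̂ - f‖_2²` (in `[0, ∞]`) of an estimator `est` computed from
`n` independent observations of density `f`. -/
def risk {n : ℕ} (est : (Fin n → ℝ) → ℝ → ℝ) (f : ℝ → ℝ) : ℝ≥0∞ :=
  ∫⁻ X, (∫⁻ x, ENNReal.ofReal ((est X x - f x) ^ 2))
    ∂(Measure.pi fun _ : Fin n => (volume : Measure ℝ).withDensity fun x => ENNReal.ofReal (f x))

end WaveletDensity

end

open WaveletDensity

/-!
Write `L = log n / n`, and call `2^j` the scale of the level `j`.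

*Reduction to coefficients.* The reconstruction mother wavelet has mean zero, because it is
orthogonal to the integer translates of the box function, which add up to `1`; it is also Lipschitz
with compact support. Hence the entries of the Gram matrix of the reconstruction wavelets decay
geometrically with the distance of the levels, its absolute row sums are bounded, and the Schur test
gives `‖∑ b_{jk} ψ̃_{jk}‖² ≤ K ∑ b_{jk}²`. By completeness every square integrable `h` is the sum of
its wavelet series, so `‖h‖² ≤ K ∑ (∫ ψ_{jk} h)²` (`exists_lintegral_sq_le_coeff`). Applied to the
error of the estimator, this bounds the risk by the sum of the risks of the thresholded coefficients
over the levels in use, plus the energy of `f` at the finer levels (`exists_risk_le`).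

*One coefficient.* Let `w` be bounded by `b` and vanish outside `I`, and let `β = ∫ w dμ`. The risk
of the thresholded sample mean of `w` is at most a constant times
`min (β²) (L ∫ w² dμ + b² L²) + b² μ(I) L n^{-c}` (`exists_coeff_risk_le`). Indeed, by Bernstein's
inequality for the sample mean and a sub-Gaussian lower tail bound for the empirical variance, the
data-driven threshold dominates the error outside an event of probability `O(n^{-c})`; this is where
`γ > c` is needed (`exists_measure_bad_le`). On this event the error is controlled by its large
deviations if `n μ(I)` is at least of the order of `log n`. Otherwise the estimator is zero unless
`4 γ log n` observations fall in `I`, and an exponential moment of their number makes this rare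
enough; the factor `μ(I)` survives in the bound, so that the remainders can be summed over the
infinitely many translates.

*One level.* The supports of the wavelets of one level overlap boundedly, so the cells satisfy
`∑_k μ(I_{jk}) ≤ const`. The remainders of a level therefore sum to `O(2^j L n^{-c})`, and the main
terms to `O(2^j L)`, without any condition on the density (`tsum_min_le_scale`); the latter uses
that `β² ≤ const · 2^j μ(I)²` in the cells with `μ(I) ≤ L`. The Besov condition gives bounds which
decrease with the scale:
* for `p > 2`, the interpolation of `ℓ²` between the `ℓᵖ` norm and the `ℓ¹` norm, which is `O(2^{j/2})`
  for a density, bounds the energy of a level by a power of its scale with exponent `-α / (1 - 1/p)`;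
* for `p ≤ 2` and a bounded density, the main terms are at most a constant times
  `min (β²) L ≤ L^{1 - p/2} |β|^p`, whose sum over `k` is `O(L^{1 - p/2} 2^{-j (p (α + 1/2) - 1)})`.

*Sum over the levels.* In each case a level contributes the minimum of an increasing and a decreasing
power of the scale, so the sum over the levels is of the order of its largest term, found at the scale
`L^{-τ}` where the two are equal (`rpow_mul_levelWeight`, `exists_tsum_levelWeight_le`); this gives
the two rates. The levels finer than the cutoff `L^{-c}` add their energy, which is of no larger
order: for `p > 2` because `c ≥ 1`, and for `p ≤ 2` exactly by the condition relating `α`, `c` and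
`p`.
-/

noncomputable section

namespace WaveletDensity

/-! ### Exponential inequalities for sums of independent bounded variables -/

lemma two_mul_three_pow_le_factorial (k : ℕ) : 2 * 3 ^ k ≤ (k + 2).factorial := by
  induction k with
  | zero => simp
  | succ k ih =>
    rw [show k + 1 + 2 = (k + 2) + 1 by ring, Nat.factorial_succ, pow_succ]
    nlinarith

lemma exp_le_of_nonpos {z : ℝ} (hz : z ≤ 0) : Real.exp z ≤ 1 + z + z ^ 2 / 2 := by
  have h := Real.quadratic_le_exp_of_nonneg (x := -z) (by linarith)
  have h1 : Real.exp z * Real.exp (-z) = 1 := by rw [← Real.exp_add]; simp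
  have h2 := Real.exp_pos z
  have h3 : Real.exp z * (1 + -z + (-z) ^ 2 / 2) ≤ 1 := by
    calc _ ≤ Real.exp z * Real.exp (-z) := mul_le_mul_of_nonneg_left h h2.le
      _ = 1 := h1
  have h4 : 0 < 1 + -z + (-z) ^ 2 / 2 := by nlinarith [sq_nonneg z]
  have h5 : 1 ≤ (1 + z + z ^ 2 / 2) * (1 + -z + (-z) ^ 2 / 2) := by
    have : (1 + z + z ^ 2 / 2) * (1 + -z + (-z) ^ 2 / 2) = 1 + (z ^ 2) ^ 2 / 4 := by ring
    rw [this]; nlinarith [sq_nonneg (z ^ 2)]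
  exact le_of_mul_le_mul_right (h3.trans h5) h4

lemma exp_le_of_nonneg {z : ℝ} (hz : 0 ≤ z) (hz3 : z < 3) :
    Real.exp z ≤ 1 + z + z ^ 2 / (2 * (1 - z / 3)) := by
  have h1 : HasSum (fun k : ℕ => z ^ k / (k.factorial : ℝ)) (Real.exp z) := by
    rw [Real.exp_eq_exp_ℝ]
    exact NormedSpace.expSeries_div_hasSum_exp z
  have h2 : HasSum (fun k : ℕ => z ^ 2 / 2 * (z / 3) ^ k) (z ^ 2 / 2 * (1 - z / 3)⁻¹) :=
    (hasSum_geometric_of_lt_one (by positivity) (by linarith)).mul_left _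
  have h3 := (hasSum_nat_add_iff' 2).2 h1
  have h4 := hasSum_le (fun k => ?_) h3 h2
  · simp [Finset.sum_range_succ] at h4
    have : z ^ 2 / (2 * (1 - z / 3)) = z ^ 2 / 2 * (1 - z / 3)⁻¹ := by
      rw [div_mul_eq_div_div]; rfl
    rw [this]; linarith
  · have h5 : ((2 * 3 ^ k : ℕ) : ℝ) ≤ ((k + 2).factorial : ℝ) := by
      exact_mod_cast two_mul_three_pow_le_factorial k
    have h6 : z ^ 2 / 2 * (z / 3) ^ k = z ^ (k + 2) / ((2 * 3 ^ k : ℕ) : ℝ) := by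
      push_cast; rw [div_pow]; field_simp; ring
    rw [h6]
    gcongr

lemma exp_le_of_abs_le {z u : ℝ} (hz : |z| ≤ u) (hu : u < 3) :
    Real.exp z ≤ 1 + z + z ^ 2 / (2 * (1 - u / 3)) := by
  have hz' := abs_le.1 hz
  rcases le_total z 0 with h | h
  · refine (exp_le_of_nonpos h).trans ?_
    have h0 : 0 ≤ u := (abs_nonneg z).trans hz
    gcongr
    · nlinarith
    · nlinarith
  · refine (exp_le_of_nonneg h (by linarith)).trans ?_
    gcongr
    · nlinarith
    · linarith

section Chernoff

variable {Ω : Type*} [MeasurableSpace Ω] {μ : Measure Ω} [IsProbabilityMeasure μ] {n : ℕ}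

lemma integrable_of_abs_le {Ω : Type*} [MeasurableSpace Ω] {μ : Measure Ω} [IsFiniteMeasure μ]
    {g : Ω → ℝ} (hg : Measurable g) {B : ℝ}
    (hB : ∀ x, |g x| ≤ B) : Integrable g μ :=
  Integrable.of_bound hg.aestronglyMeasurable B (Filter.Eventually.of_forall hB)

lemma integral_one_add_mul_add_mul_sq {g : Ω → ℝ} (hg : Integrable g μ)
    (hg2 : Integrable (fun x => g x ^ 2) μ) (a d : ℝ) :
    ∫ x, (1 + a * g x + d * g x ^ 2) ∂μ = 1 + a * ∫ x, g x ∂μ + d * ∫ x, g x ^ 2 ∂μ := by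
  have h1 : Integrable (fun x => 1 + a * g x) μ := (integrable_const _).add (hg.const_mul _)
  rw [integral_add h1 (hg2.const_mul _), integral_add (integrable_const _) (hg.const_mul _),
    integral_const_mul, integral_const_mul]
  simp

lemma integral_exp_sum (g : Ω → ℝ) (t : ℝ) :
    ∫ X : Fin n → Ω, Real.exp (t * ∑ i, g (X i)) ∂(Measure.pi fun _ => μ) =
      (∫ x, Real.exp (t * g x) ∂μ) ^ n := by
  have := integral_fintype_prod_eq_pow (𝕜 := ℝ) (μ := μ) (ι := Fin n)
    (fun x => Real.exp (t * g x))
  rw [Fintype.card_fin] at this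
  rw [← this]
  congr 1; ext X
  rw [Finset.mul_sum, Real.exp_sum]

/-- The Chernoff bound for a sum of independent copies of a bounded variable. -/
lemma chernoff_sum {g : Ω → ℝ} (hg : Measurable g) {B : ℝ} (hB : ∀ x, |g x| ≤ B)
    {l : ℝ} (hl : 0 ≤ l) (t : ℝ) :
    (Measure.pi fun _ : Fin n => μ).real {X | t ≤ ∑ i, g (X i)} ≤
      Real.exp (-l * t) * (∫ x, Real.exp (l * g x) ∂μ) ^ n := by
  have h := ProbabilityTheory.measure_ge_le_exp_mul_mgf (μ := Measure.pi fun _ : Fin n => μ)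
    (X := fun X : Fin n → Ω => ∑ i, g (X i)) t hl ?_
  · rwa [ProbabilityTheory.mgf, integral_exp_sum] at h
  · refine integrable_of_abs_le (B := Real.exp (l * (n * B))) (by fun_prop) fun X => ?_
    rw [abs_of_pos (Real.exp_pos _)]
    gcongr
    calc ∑ i, g (X i) ≤ ∑ _i : Fin n, B := Finset.sum_le_sum fun i _ => (abs_le.1 (hB _)).2
      _ = n * B := by simp

/-- Bernstein's inequality. When the variance vanishes the sum vanishes almost surely. -/
theorem bernstein {g : Ω → ℝ} (hg : Measurable g) {B : ℝ} (hB : ∀ x, |g x| ≤ B)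
    (hmean : ∫ x, g x ∂μ = 0) {x : ℝ} (hx : 0 ≤ x) :
    (Measure.pi fun _ : Fin n => μ).real
      {X | √(2 * (n * ∫ x, g x ^ 2 ∂μ) * x) + B * x / 3 < ∑ i, g (X i)} ≤ Real.exp (-x) := by
  set V := ∫ x, g x ^ 2 ∂μ with hV
  have hV0 : 0 ≤ V := integral_nonneg fun x => sq_nonneg _
  obtain ⟨ω⟩ := μ.nonempty_of_neZero
  have hB0 : 0 ≤ B := (abs_nonneg _).trans (hB ω)
  have hint2 : Integrable (fun x => g x ^ 2) μ :=
    integrable_of_abs_le (B := B ^ 2) (by fun_prop) fun x => by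
      rw [abs_pow]; gcongr; exact hB x
  rcases eq_or_lt_of_le (show 0 ≤ n * V by positivity) with h0 | hpos
  · have hz : ∀ᵐ X ∂(Measure.pi fun _ : Fin n => μ), ∑ i, g (X i) = 0 := by
      rcases mul_eq_zero.1 h0.symm with hn | hv
      · have hn' : n = 0 := by exact_mod_cast hn
        subst hn'; simp
      · have h1 : ∀ᵐ x ∂μ, g x = 0 := by
          have := (integral_eq_zero_iff_of_nonneg (fun x => sq_nonneg (g x)) hint2).1 hv
          filter_upwards [this] with x hx
          simpa using hx
        have h2 : ∀ i : Fin n, ∀ᵐ X ∂(Measure.pi fun _ : Fin n => μ), g (X i) = 0 := fun i =>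
          (measurePreserving_eval (fun _ : Fin n => μ) i).quasiMeasurePreserving.ae h1
        filter_upwards [ae_all_iff.2 h2] with X hX
        simp [hX]
    have : (Measure.pi fun _ : Fin n => μ)
        {X | √(2 * (n * V) * x) + B * x / 3 < ∑ i, g (X i)} = 0 := by
      refine measure_mono_null ?_ (ae_iff.1 hz)
      intro X hX
      have : 0 ≤ √(2 * (n * V) * x) + B * x / 3 := by positivity
      exact (this.trans_lt hX).ne'
    rw [measureReal_def, this]
    simpa using (Real.exp_pos _).le
  · set v := n * V
    -- the value of the dual variable which optimizes the exponent
    set D := √v + B / 3 * √(2 * x) with hD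
    have hsv : 0 < √v := Real.sqrt_pos.2 hpos
    have hDpos : 0 < D := by positivity
    set l := √(2 * x) / D with hl
    have hl0 : 0 ≤ l := by positivity
    have h1l : 1 - l * B / 3 = √v / D := by
      rw [hl]; field_simp; rw [hD]; ring
    have hlB : l * B < 3 := by
      have : 0 < 1 - l * B / 3 := by rw [h1l]; positivity
      linarith
    have hmgf : ∫ y, Real.exp (l * g y) ∂μ ≤ Real.exp (l ^ 2 * V / (2 * (1 - l * B / 3))) := by
      have hi1 : Integrable (fun y => Real.exp (l * g y)) μ := by
        refine integrable_of_abs_le (B := Real.exp (l * B)) (by fun_prop) fun y => ?_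
        rw [abs_of_pos (Real.exp_pos _)]
        gcongr
        exact (abs_le.1 (hB y)).2
      have hi2 : Integrable g μ := integrable_of_abs_le hg hB
      calc ∫ y, Real.exp (l * g y) ∂μ
          ≤ ∫ y, (1 + l * g y + l ^ 2 / (2 * (1 - l * B / 3)) * g y ^ 2) ∂μ := by
            refine integral_mono hi1 (((integrable_const _).add (hi2.const_mul _)).add
              (hint2.const_mul _)) fun y => ?_
            have := exp_le_of_abs_le (z := l * g y) (u := l * B)
              (by rw [abs_mul, abs_of_nonneg hl0]; gcongr; exact hB y) hlB
            refine this.trans (le_of_eq ?_)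
            ring
        _ = 1 + l ^ 2 * V / (2 * (1 - l * B / 3)) := by
            rw [integral_one_add_mul_add_mul_sq hi2 hint2, hmean]
            ring
        _ ≤ _ := by linarith [Real.add_one_le_exp (l ^ 2 * V / (2 * (1 - l * B / 3)))]
    have hc := chernoff_sum (μ := μ) (n := n) hg hB hl0 (√(2 * v * x) + B * x / 3)
    refine (measureReal_mono (fun X hX => ?_) (measure_ne_top _ _)).trans (hc.trans ?_)
    · simp only [Set.mem_ofPred_eq] at hX ⊢
      exact hX.le
    calc Real.exp (-l * (√(2 * v * x) + B * x / 3)) * (∫ y, Real.exp (l * g y) ∂μ) ^ n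
        ≤ Real.exp (-l * (√(2 * v * x) + B * x / 3)) *
            Real.exp (l ^ 2 * V / (2 * (1 - l * B / 3))) ^ n := by
          gcongr
      _ = Real.exp (-x) := by
          rw [← Real.exp_nat_mul, ← Real.exp_add]
          congr 1
          have e1 : √(2 * v * x) = √(2 * x) * √v := by
            rw [← Real.sqrt_mul (by positivity)]; ring_nf
          have e2 : √(2 * x) ^ 2 = 2 * x := Real.sq_sqrt (by positivity)
          have e3 : √v ^ 2 = n * V := Real.sq_sqrt hpos.le
          rw [h1l, e1, hl]
          have : (n : ℝ) * ((√(2 * x) / D) ^ 2 * V / (2 * (√v / D))) = x * √v / D := by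
            rw [div_pow, e2]
            have : (n : ℝ) * (2 * x / D ^ 2 * V / (2 * (√v / D))) = (n * V) * x / (D * √v) := by
              field_simp
            rw [this, ← e3]; field_simp
          rw [this]
          have : √(2 * x) / D * (√(2 * x) * √v + B * x / 3) =
              (2 * x * √v + √(2 * x) * B * x / 3) / D := by
            linear_combination (√v / D) * e2
          rw [neg_mul, this, ← neg_div, ← add_div, div_eq_iff hDpos.ne', hD]
          ring

/-- Lower deviations of a sum of nonnegative variables are sub-Gaussian, with the second moment
as variance factor. -/
theorem lower_tail_sum {g : Ω → ℝ} (hg : Measurable g) {B : ℝ} (hB : ∀ x, g x ≤ B)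
    (h0 : ∀ x, 0 ≤ g x) {V : ℝ} (hV : ∫ x, g x ^ 2 ∂μ ≤ V) {x : ℝ} (hx : 0 ≤ x) :
    (Measure.pi fun _ : Fin n => μ).real
      {X | ∑ i, g (X i) < n * ∫ x, g x ∂μ - √(2 * (n * V) * x)} ≤ Real.exp (-x) := by
  have hB' : ∀ x, |g x| ≤ B := fun x => by rw [abs_of_nonneg (h0 x)]; exact hB x
  have hint2 : Integrable (fun x => g x ^ 2) μ :=
    integrable_of_abs_le (B := B ^ 2) (by fun_prop) fun x => by
      rw [abs_pow]; gcongr; exact hB' x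
  have hi2 : Integrable g μ := integrable_of_abs_le hg hB'
  have hV0 : 0 ≤ V := (integral_nonneg fun x => sq_nonneg _).trans hV
  rcases eq_or_lt_of_le (show 0 ≤ n * V by positivity) with h00 | hpos
  · have hm : (n : ℝ) * ∫ x, g x ∂μ = 0 := by
      rcases mul_eq_zero.1 h00.symm with hn | hv
      · rw [hn, zero_mul]
      · have h1 : g =ᵐ[μ] 0 := by
          have h2 : ∫ x, g x ^ 2 ∂μ = 0 :=
            le_antisymm (hV.trans hv.le) (integral_nonneg fun x => sq_nonneg _)
          have := (integral_eq_zero_iff_of_nonneg (fun x => sq_nonneg (g x)) hint2).1 h2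
          filter_upwards [this] with x hx
          simpa using hx
        rw [integral_congr_ae h1]; simp
    have : {X : Fin n → Ω | ∑ i, g (X i) < n * ∫ x, g x ∂μ - √(2 * (n * V) * x)} = ∅ := by
      ext X
      simp only [Set.mem_ofPred_eq, Set.mem_empty_iff_false, iff_false, not_lt, hm, zero_sub]
      exact (neg_nonpos.2 (Real.sqrt_nonneg _)).trans (Finset.sum_nonneg fun i _ => h0 _)
    rw [this]; simpa using (Real.exp_pos _).le
  · set m := ∫ x, g x ∂μ with hm
    -- the minimizer of `-l √(2 n V x) + n V l² / 2`
    set l := √(2 * x) / √(n * V) with hl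
    have hl0 : 0 ≤ l := by positivity
    have hmgf : ∫ y, Real.exp (l * (-g y)) ∂μ ≤ Real.exp (-(l * m) + l ^ 2 * V / 2) := by
      have hi1 : Integrable (fun y => Real.exp (l * (-g y))) μ := by
        refine integrable_of_abs_le (B := 1) (by fun_prop) fun y => ?_
        rw [abs_of_pos (Real.exp_pos _)]
        refine Real.exp_le_one_iff.2 ?_
        nlinarith [h0 y]
      calc ∫ y, Real.exp (l * (-g y)) ∂μ
          ≤ ∫ y, (1 + (-l) * g y + l ^ 2 / 2 * g y ^ 2) ∂μ := by
            refine integral_mono hi1 (((integrable_const _).add (hi2.const_mul _)).add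
              (hint2.const_mul _)) fun y => ?_
            have := exp_le_of_nonpos (z := l * -g y) (by nlinarith [h0 y])
            refine this.trans (le_of_eq ?_)
            ring
        _ = 1 + (-(l * m) + l ^ 2 * (∫ y, g y ^ 2 ∂μ) / 2) := by
            rw [integral_one_add_mul_add_mul_sq hi2 hint2]
            ring
        _ ≤ 1 + (-(l * m) + l ^ 2 * V / 2) := by gcongr
        _ ≤ _ := by linarith [Real.add_one_le_exp (-(l * m) + l ^ 2 * V / 2)]
    have hc := chernoff_sum (μ := μ) (n := n) (g := fun x => - g x) hg.neg (B := B)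
      (fun x => by simpa using hB' x) hl0 (-(n * m) + √(2 * (n * V) * x))
    refine (measureReal_mono (fun X hX => ?_) (measure_ne_top _ _)).trans (hc.trans ?_)
    · simp only [Set.mem_ofPred_eq, Finset.sum_neg_distrib] at hX ⊢
      linarith
    calc Real.exp (-l * (-(n * m) + √(2 * (n * V) * x))) *
            (∫ x, Real.exp (l * -g x) ∂μ) ^ n
        ≤ Real.exp (-l * (-(n * m) + √(2 * (n * V) * x))) *
            Real.exp (-(l * m) + l ^ 2 * V / 2) ^ n := by
          gcongr
      _ = Real.exp (-x) := by
          rw [← Real.exp_nat_mul, ← Real.exp_add]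
          congr 1
          have hn : (n : ℝ) ≠ 0 := fun h => by simp [h] at hpos
          have hV' : V ≠ 0 := fun h => by simp [h] at hpos
          have e1 : √(2 * (n * V) * x) = √(2 * x) * √(n * V) := by
            rw [← Real.sqrt_mul (by positivity)]; ring_nf
          have e2 : √(2 * x) ^ 2 = 2 * x := Real.sq_sqrt (by positivity)
          have e3 : √(n * V) ^ 2 = n * V := Real.sq_sqrt hpos.le
          have hsv : 0 < √(n * V) := Real.sqrt_pos.2 hpos
          have e4 : l * √(2 * (n * V) * x) = 2 * x := by
            rw [e1, hl]
            calc _ = √(2 * x) ^ 2 := by field_simp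
              _ = _ := e2
          have e5 : l ^ 2 * (n * V) = 2 * x := by
            rw [hl, div_pow, e2, e3]; field_simp
          linear_combination -e4 + e5 / 2

/-- The moments of the number `N` of observations in a set of small probability: `N` vanishes
unless some observation falls in the set, whence the factor `μ I`. -/
lemma integral_count_sq_mul_exp_le {I : Set Ω} (hI : MeasurableSet I) :
    ∫ X : Fin n → Ω, (∑ i, I.indicator (1 : Ω → ℝ) (X i)) ^ 2 *
        Real.exp (∑ i, I.indicator (1 : Ω → ℝ) (X i)) ∂(Measure.pi fun _ => μ) ≤
      2 * (n * μ.real I * Real.exp 2) * Real.exp (n * μ.real I * Real.exp 2) := by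
  set g : Ω → ℝ := I.indicator 1 with hgdef
  have hg : Measurable g := measurable_one.indicator hI
  have hg0 : ∀ x, 0 ≤ g x := fun x => Set.indicator_nonneg (fun _ _ => zero_le_one) x
  have hg1 : ∀ x, g x ≤ 1 := fun x => Set.indicator_le_self' (fun _ _ => zero_le_one) x
  have hS0 : ∀ X : Fin n → Ω, 0 ≤ ∑ i, g (X i) := fun X => Finset.sum_nonneg fun i _ => hg0 _
  have hS1 : ∀ X : Fin n → Ω, ∑ i, g (X i) ≤ n := fun X => by
    calc ∑ i, g (X i) ≤ ∑ _i : Fin n, (1 : ℝ) := Finset.sum_le_sum fun i _ => hg1 _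
      _ = n := by simp
  have hF0 : 0 ≤ μ.real I := measureReal_nonneg
  have hmgf : ∫ x, Real.exp (2 * g x) ∂μ ≤ Real.exp (μ.real I * Real.exp 2) := by
    have : ∀ x, Real.exp (2 * g x) = 1 + (Real.exp 2 - 1) * g x := by
      intro x
      by_cases hx : x ∈ I <;> simp [hgdef, hx]
    simp_rw [this]
    rw [integral_add (integrable_const _)
      ((integrable_of_abs_le hg (B := 1) fun x => by
        rw [abs_of_nonneg (hg0 x)]; exact hg1 x).const_mul _), integral_const_mul, hgdef,
      integral_indicator_one hI]
    simp only [integral_const, probReal_univ, smul_eq_mul, mul_one]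
    have := Real.add_one_le_exp (μ.real I * Real.exp 2)
    nlinarith
  have hN : ∀ N : ℝ, 0 ≤ N → N ^ 2 * Real.exp N ≤ 2 * (Real.exp (2 * N) - 1) := by
    intro N hN
    have h1 := Real.quadratic_le_exp_of_nonneg hN
    have h2 : Real.exp (-N) ≤ 1 := Real.exp_le_one_iff.2 (by linarith)
    have h3 : Real.exp N * Real.exp (-N) = 1 := by rw [← Real.exp_add]; simp
    have h4 : Real.exp (2 * N) = Real.exp N * Real.exp N := by rw [← Real.exp_add]; ring_nf
    rw [h4]
    have h5 := Real.exp_pos N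
    nlinarith
  have hi1 : Integrable (fun X : Fin n → Ω => Real.exp (2 * ∑ i, g (X i)))
      (Measure.pi fun _ => μ) := by
    refine integrable_of_abs_le (B := Real.exp (2 * n)) (by fun_prop) fun X => ?_
    rw [abs_of_pos (Real.exp_pos _)]
    gcongr
    exact hS1 X
  have hi2 : Integrable (fun X : Fin n → Ω => (∑ i, g (X i)) ^ 2 * Real.exp (∑ i, g (X i)))
      (Measure.pi fun _ => μ) := by
    refine integrable_of_abs_le (B := (n : ℝ) ^ 2 * Real.exp n) (by fun_prop) fun X => ?_
    have := hS0 X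
    rw [abs_of_nonneg (by positivity)]
    gcongr <;> exact hS1 X
  calc _ ≤ ∫ X : Fin n → Ω, 2 * (Real.exp (2 * ∑ i, g (X i)) - 1) ∂(Measure.pi fun _ => μ) :=
        integral_mono hi2 ((hi1.sub (integrable_const _)).const_mul _) fun X => hN _ (hS0 X)
    _ = 2 * ((∫ x, Real.exp (2 * g x) ∂μ) ^ n - 1) := by
        rw [integral_const_mul, integral_sub hi1 (integrable_const _), integral_exp_sum]
        simp
    _ ≤ 2 * (Real.exp (μ.real I * Real.exp 2) ^ n - 1) := by
        gcongr
    _ ≤ _ := by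
        rw [← Real.exp_nat_mul]
        set y := (n : ℝ) * μ.real I * Real.exp 2 with hy
        rw [show (n : ℝ) * (μ.real I * Real.exp 2) = y by rw [hy]; ring]
        have h1 := Real.add_one_le_exp (-y)
        have h3 : Real.exp y * Real.exp (-y) = 1 := by rw [← Real.exp_add]; simp
        have := Real.exp_pos y
        nlinarith

end Chernoff

/-! ### Thresholding one empirical mean -/

section Sample

variable {n : ℕ}

/-- The mean of a sample `y`. -/
def sampleMean (y : Fin n → ℝ) : ℝ := (1 / (n : ℝ)) * ∑ i, y i

/-- The unbiased variance estimator of a sample `y`, as a sum over pairs. -/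
def sampleVar (y : Fin n → ℝ) : ℝ :=
  (1 / ((n : ℝ) * ((n : ℝ) - 1))) * ∑ i, ∑ l ∈ Finset.Iio i, (y i - y l) ^ 2

/-- The overestimated variance of a sample with values bounded by `b`. -/
def sampleOverVar (γ b : ℝ) (y : Fin n → ℝ) : ℝ :=
  sampleVar y + 2 * b * √(2 * γ * sampleVar y * (Real.log n / n))
    + 8 * γ * b ^ 2 * (Real.log n / n)

/-- The threshold computed from a sample with values bounded by `b`. -/
def sampleThreshold (γ b : ℝ) (y : Fin n → ℝ) : ℝ :=
  √(2 * γ * sampleOverVar γ b y * (Real.log n / n)) + 2 * b * γ * Real.log n / (3 * n)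

/-- The sample mean, replaced by zero when it is below the threshold. -/
def sampleThresholded (γ b : ℝ) (y : Fin n → ℝ) : ℝ :=
  if sampleThreshold γ b y ≤ |sampleMean y| then sampleMean y else 0

lemma sum_pairs_sq_sub (y : Fin n → ℝ) :
    ∑ i, ∑ l ∈ Finset.Iio i, (y i - y l) ^ 2 = n * ∑ i, y i ^ 2 - (∑ i, y i) ^ 2 := by
  have hfull : ∑ i, ∑ l, (y i - y l) ^ 2 = 2 * (n * ∑ i, y i ^ 2 - (∑ i, y i) ^ 2) := by
    have : ∀ i l, (y i - y l) ^ 2 = y i ^ 2 + y l ^ 2 - 2 * (y i * y l) := fun i l => by ring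
    simp_rw [this, Finset.sum_sub_distrib, Finset.sum_add_distrib, ← Finset.mul_sum,
      ← Finset.sum_mul]
    simp only [Finset.sum_const, Finset.card_univ, Fintype.card_fin, nsmul_eq_mul,
      ← Finset.mul_sum]
    ring
  have hsplit : ∀ i, ∑ l, (y i - y l) ^ 2 =
      ∑ l ∈ Finset.Iio i, (y i - y l) ^ 2 + ∑ l ∈ Finset.Ioi i, (y i - y l) ^ 2 := by
    intro i
    have h1 : (Finset.univ : Finset (Fin n)) = insert i (Finset.Iio i ∪ Finset.Ioi i) := by
      ext l; simp; omega
    rw [h1, Finset.sum_insert (by simp), Finset.sum_union]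
    · simp
    · rw [Finset.disjoint_left]
      intro l hl hl'
      simp only [Finset.mem_Iio, Finset.mem_Ioi] at hl hl'
      exact lt_asymm hl hl'
  have hswap : ∑ i, ∑ l ∈ Finset.Ioi i, (y i - y l) ^ 2 =
      ∑ i, ∑ l ∈ Finset.Iio i, (y i - y l) ^ 2 := by
    rw [Finset.sum_comm' (t' := Finset.univ) (s' := fun l => Finset.Iio l) (by simp)]
    refine Finset.sum_congr rfl fun i _ => Finset.sum_congr rfl fun l _ => by ring
  simp_rw [hsplit, Finset.sum_add_distrib, hswap] at hfull
  linarith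

lemma sampleVar_nonneg (y : Fin n → ℝ) : 0 ≤ sampleVar y := by
  unfold sampleVar
  refine mul_nonneg ?_ (Finset.sum_nonneg fun i _ => Finset.sum_nonneg fun l _ => sq_nonneg _)
  rcases Nat.eq_zero_or_pos n with h | h
  · simp [h]
  · have : (1 : ℝ) ≤ n := by exact_mod_cast h
    have : (0 : ℝ) ≤ n - 1 := by linarith
    positivity

lemma sampleVar_eq (y : Fin n → ℝ) (a : ℝ) :
    sampleVar y = (n * ∑ i, (y i - a) ^ 2 - (∑ i, (y i - a)) ^ 2) / (n * (n - 1)) := by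
  have h : ∀ i l, (y i - y l) ^ 2 = ((y i - a) - (y l - a)) ^ 2 := fun i l => by ring
  rw [sampleVar]
  simp_rw [h]
  rw [sum_pairs_sq_sub (fun i => y i - a)]
  ring

lemma le_sampleVar (hn : 2 ≤ n) (y : Fin n → ℝ) (a : ℝ) :
    (∑ i, (y i - a) ^ 2) / n - (sampleMean y - a) ^ 2 ≤ sampleVar y := by
  have hn' : (2 : ℝ) ≤ n := by exact_mod_cast hn
  have hmean : sampleMean y - a = (∑ i, (y i - a)) / n := by
    rw [sampleMean, Finset.sum_sub_distrib]; simp; field_simp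
  have hcs : (∑ i, (y i - a)) ^ 2 ≤ n * ∑ i, (y i - a) ^ 2 := by
    simpa using sq_sum_le_card_mul_sum_sq (s := Finset.univ) (f := fun i => y i - a)
  rw [sampleVar_eq y a, hmean]
  calc (∑ i, (y i - a) ^ 2) / n - ((∑ i, (y i - a)) / n) ^ 2
      = (n * ∑ i, (y i - a) ^ 2 - (∑ i, (y i - a)) ^ 2) / (n * n) := by field_simp
    _ ≤ _ := by
      apply div_le_div_of_nonneg_left (by linarith) (by nlinarith)
      nlinarith

lemma sampleVar_le (hn : 2 ≤ n) (y : Fin n → ℝ) :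
    sampleVar y ≤ 2 / n * ∑ i, y i ^ 2 := by
  have hn' : (2 : ℝ) ≤ n := by exact_mod_cast hn
  have h0 : 0 ≤ ∑ i, y i ^ 2 := Finset.sum_nonneg fun i _ => sq_nonneg _
  rw [sampleVar_eq y 0]
  simp only [sub_zero]
  have hpos : (0 : ℝ) < n * (n - 1) := by nlinarith
  rw [div_le_iff₀ hpos]
  have : 2 / (n : ℝ) * (∑ i, y i ^ 2) * (n * (n - 1)) = 2 * (n - 1) * ∑ i, y i ^ 2 := by
    field_simp
  rw [this]
  nlinarith [sq_nonneg (∑ i, y i)]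

lemma log_div_pos (hn : 2 ≤ n) : 0 < Real.log n / n := by
  have hn' : (2 : ℝ) ≤ n := by exact_mod_cast hn
  have := Real.log_pos (by linarith : (1 : ℝ) < n)
  positivity

lemma log_div_le_one (hn : 2 ≤ n) : Real.log n / n ≤ 1 := by
  have hn' : (2 : ℝ) ≤ n := by exact_mod_cast hn
  rw [div_le_one (by linarith)]
  have := Real.log_le_sub_one_of_pos (by linarith : (0 : ℝ) < n)
  linarith

lemma inv_le_two_mul_log_div (hn : 2 ≤ n) : (n : ℝ)⁻¹ ≤ 2 * (Real.log n / n) := by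
  have hn' : (2 : ℝ) ≤ n := by exact_mod_cast hn
  have h1 : Real.log 2 ≤ Real.log n := Real.log_le_log (by norm_num) hn'
  have h2 := Real.log_two_gt_d9
  rw [← mul_div_assoc, inv_eq_one_div]
  gcongr
  linarith

lemma sampleOverVar_le {γ b : ℝ} (hγ : 0 ≤ γ) (hn : 2 ≤ n) (y : Fin n → ℝ) :
    sampleOverVar γ b y ≤ 2 * sampleVar y + 10 * γ * b ^ 2 * (Real.log n / n) := by
  have hL := (log_div_pos hn).le
  have hv := sampleVar_nonneg y
  have hs : √(2 * γ * sampleVar y * (Real.log n / n)) =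
      √(sampleVar y) * √(2 * γ * (Real.log n / n)) := by
    rw [← Real.sqrt_mul hv]; ring_nf
  have h1 : √(sampleVar y) ^ 2 = sampleVar y := Real.sq_sqrt hv
  have h2 : √(2 * γ * (Real.log n / n)) ^ 2 = 2 * γ * (Real.log n / n) :=
    Real.sq_sqrt (by positivity)
  rw [sampleOverVar, hs]
  nlinarith [sq_nonneg (√(sampleVar y) - b * √(2 * γ * (Real.log n / n)))]

lemma sampleOverVar_ge {γ b : ℝ} (hb : 0 ≤ b) (y : Fin n → ℝ) :
    8 * γ * b ^ 2 * (Real.log n / n) ≤ sampleOverVar γ b y := by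
  have hv := sampleVar_nonneg y
  rw [sampleOverVar]
  have : 0 ≤ 2 * b * √(2 * γ * sampleVar y * (Real.log n / n)) := by positivity
  linarith

lemma sampleThreshold_nonneg {γ b : ℝ} (hγ : 0 ≤ γ) (hb : 0 ≤ b) (y : Fin n → ℝ) :
    0 ≤ sampleThreshold γ b y := by
  have : 0 ≤ Real.log n := Real.log_natCast_nonneg n
  rw [sampleThreshold]; positivity

lemma sampleThreshold_sq_le {γ b : ℝ} (hγ : 0 ≤ γ) (hb : 0 ≤ b) (hn : 2 ≤ n) (y : Fin n → ℝ) :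
    sampleThreshold γ b y ^ 2 ≤
      8 * γ * (Real.log n / n) * sampleVar y + 41 * γ ^ 2 * (b ^ 2 * (Real.log n / n) ^ 2) := by
  have hL := (log_div_pos hn).le
  have hv := sampleVar_nonneg y
  have ho := sampleOverVar_le (b := b) hγ hn y
  have ho0 : 0 ≤ sampleOverVar γ b y := (by positivity : 0 ≤ 8 * γ * b ^ 2 * (Real.log n / n)).trans
    (sampleOverVar_ge hb y)
  have e : 2 * b * γ * Real.log n / (3 * n) = 2 / 3 * b * γ * (Real.log n / n) := by ring
  set L := Real.log n / n
  have h2 : √(2 * γ * sampleOverVar γ b y * L) ^ 2 = 2 * γ * sampleOverVar γ b y * L :=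
    Real.sq_sqrt (by positivity)
  rw [sampleThreshold, e]
  have h3 : (√(2 * γ * sampleOverVar γ b y * L) + 2 / 3 * b * γ * L) ^ 2 ≤
      2 * (2 * γ * sampleOverVar γ b y * L) + 2 * (2 / 3 * b * γ * L) ^ 2 := by
    refine add_sq_le.trans (le_of_eq ?_)
    rw [h2]; ring
  refine h3.trans ?_
  have h4 : 2 * (2 * γ * sampleOverVar γ b y * L) ≤
      2 * (2 * γ * (2 * sampleVar y + 10 * γ * b ^ 2 * L) * L) := by gcongr
  have : 0 ≤ (b * γ * L) ^ 2 := sq_nonneg _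
  nlinarith

lemma le_sampleThreshold {γ b : ℝ} (hγ : 0 ≤ γ) (hb : 0 ≤ b) (hn : 2 ≤ n) (y : Fin n → ℝ) :
    4 * γ * b * (Real.log n / n) ≤ sampleThreshold γ b y := by
  have hL := (log_div_pos hn).le
  have h1 : 0 ≤ 2 * b * γ * Real.log n / (3 * n) := by
    have : 0 ≤ Real.log n := Real.log_natCast_nonneg n
    positivity
  have h2 : 4 * γ * b * (Real.log n / n) ≤ √(2 * γ * sampleOverVar γ b y * (Real.log n / n)) := by
    apply Real.le_sqrt_of_sq_le
    calc _ = 2 * γ * (8 * γ * b ^ 2 * (Real.log n / n)) * (Real.log n / n) := by ring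
      _ ≤ _ := by gcongr; exact sampleOverVar_ge hb y
  rw [sampleThreshold]; linarith

lemma abs_sampleMean_sub_le (hn : 2 ≤ n) {y : Fin n → ℝ} {b a : ℝ} (hy : ∀ i, |y i| ≤ b)
    (ha : |a| ≤ b) : |sampleMean y - a| ≤ 2 * b := by
  have hn' : (2 : ℝ) ≤ n := by exact_mod_cast hn
  have h1 : |∑ i, y i| ≤ n * b := by
    calc |∑ i, y i| ≤ ∑ i, |y i| := Finset.abs_sum_le_sum_abs _ _
      _ ≤ ∑ _i : Fin n, b := Finset.sum_le_sum fun i _ => hy i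
      _ = n * b := by simp
  have h2 : |sampleMean y| ≤ b := by
    rw [sampleMean, abs_mul, abs_of_pos (by positivity)]
    calc 1 / (n : ℝ) * |∑ i, y i| ≤ 1 / n * (n * b) := by gcongr
      _ = b := by field_simp
  calc |sampleMean y - a| ≤ |sampleMean y| + |a| := abs_sub _ _
    _ ≤ 2 * b := by linarith

/-- The error of hard thresholding at `η` an estimator `u` of `a`: it is comparable to
`min (a², η²)` when `|u - a| ≤ κ η`, and to the error of `u` otherwise. -/
lemma hard_threshold_sq_le {κ : ℝ} (hκ : 0 < κ) (hκ1 : κ < 1) {u a η : ℝ} (hη : 0 ≤ η) :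
    ((if η ≤ |u| then u else 0) - a) ^ 2 ≤ 4 / (1 - κ) ^ 2 * min (a ^ 2) (η ^ 2) +
      (1 + 1 / κ) ^ 2 * (if κ * η < |u - a| then (u - a) ^ 2 else 0) := by
  have hκ' : 0 < 1 - κ := by linarith
  have hC1 : 4 ≤ 4 / (1 - κ) ^ 2 := by
    rw [le_div_iff₀ (by positivity)]; nlinarith
  split_ifs with h1 h2 h2
  · have : 0 ≤ 4 / (1 - κ) ^ 2 * min (a ^ 2) (η ^ 2) := by positivity
    have h3 : 1 ≤ (1 + 1 / κ) ^ 2 := by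
      have : 0 < 1 / κ := by positivity
      nlinarith
    nlinarith [sq_nonneg (u - a)]
  · rw [mul_zero, add_zero]
    have h2 := not_lt.1 h2
    have h3 : (1 - κ) * η ≤ |a| := by
      have := abs_sub_abs_le_abs_sub u a
      linarith
    have h4 : (u - a) ^ 2 ≤ η ^ 2 := by
      rw [← sq_abs (u - a)]
      have : |u - a| ≤ η := h2.trans (by nlinarith)
      gcongr
    have h5 : η ^ 2 ≤ a ^ 2 / (1 - κ) ^ 2 := by
      rw [le_div_iff₀ (by positivity), ← sq_abs a, ← mul_pow, mul_comm]
      gcongr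
    rw [mul_min_of_nonneg _ _ (by positivity), le_min_iff]
    constructor
    · refine (h4.trans h5).trans ?_
      rw [div_mul_eq_mul_div]
      gcongr
      nlinarith [sq_nonneg a]
    · nlinarith [sq_nonneg η]
  · have h3 : |a| ≤ (1 + 1 / κ) * |u - a| := by
      have h4 := abs_sub_abs_le_abs_sub a u
      rw [abs_sub_comm] at h4
      have h5 : η ≤ 1 / κ * |u - a| := by
        rw [one_div, ← div_eq_inv_mul, le_div_iff₀ hκ]; linarith
      linarith
    have : 0 ≤ 4 / (1 - κ) ^ 2 * min (a ^ 2) (η ^ 2) := by positivity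
    have h6 : (0 - a) ^ 2 ≤ ((1 + 1 / κ) * |u - a|) ^ 2 := by
      rw [← sq_abs (0 - a)]; gcongr; simpa using h3
    rw [mul_pow, sq_abs] at h6
    linarith
  · rw [mul_zero, add_zero]
    have h2 := not_lt.1 h2
    have h3 : |a| ≤ 2 * η := by
      have h4 := abs_sub_abs_le_abs_sub a u
      rw [abs_sub_comm] at h4
      nlinarith
    have h6 : a ^ 2 ≤ 4 * η ^ 2 := by
      rw [← sq_abs a]
      calc |a| ^ 2 ≤ (2 * η) ^ 2 := by gcongr
        _ = _ := by ring
    rw [mul_min_of_nonneg _ _ (by positivity), le_min_iff]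
    constructor
    · nlinarith [sq_nonneg a]
    · nlinarith [sq_nonneg η]

lemma sampleThresholded_sub_sq_le {κ γ b : ℝ} (hκ : 0 < κ) (hκ1 : κ < 1) (hγ : 0 ≤ γ)
    (hb : 0 ≤ b) (y : Fin n → ℝ) (a : ℝ) :
    (sampleThresholded γ b y - a) ^ 2 ≤
      4 / (1 - κ) ^ 2 * min (a ^ 2) (sampleThreshold γ b y ^ 2) +
      (1 + 1 / κ) ^ 2 * (if κ * sampleThreshold γ b y < |sampleMean y - a| then
        (sampleMean y - a) ^ 2 else 0) :=
  hard_threshold_sq_le hκ hκ1 (sampleThreshold_nonneg hγ hb y)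

/-- When all the values are bounded by `b` and vanish outside `N` observations, the
thresholded mean can be nonzero only if `N ≥ 4 γ log n`. -/
lemma sampleThresholded_sq_le {γ b : ℝ} (hγ : 0 ≤ γ) (hb : 0 ≤ b) (hn : 2 ≤ n) {y u : Fin n → ℝ}
    (hy : ∀ i, |y i| ≤ b * u i) :
    sampleThresholded γ b y ^ 2 ≤
      b ^ 2 / n ^ 2 * Real.exp (-(4 * γ * Real.log n)) *
        ((∑ i, u i) ^ 2 * Real.exp (∑ i, u i)) := by
  have hn' : (2 : ℝ) ≤ n := by exact_mod_cast hn
  rw [sampleThresholded]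
  split_ifs with h
  · have h1 : |sampleMean y| ≤ b * (∑ i, u i) / n := by
      rw [sampleMean, abs_mul, abs_of_pos (by positivity), one_div, ← div_eq_inv_mul]
      gcongr
      rw [Finset.mul_sum]
      exact (Finset.abs_sum_le_sum_abs _ _).trans (Finset.sum_le_sum fun i _ => hy i)
    rcases hb.eq_or_lt with hb0 | hbpos
    · rw [← hb0] at h1
      have : sampleMean y = 0 := by simpa using h1
      rw [this]; simp [← hb0]
    · have h2 : 4 * γ * Real.log n ≤ ∑ i, u i := by
        have h3 := (le_sampleThreshold hγ hb hn y).trans (h.trans h1)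
        have h4 : b / n * (4 * γ * Real.log n) ≤ b / n * ∑ i, u i := by
          calc _ = 4 * γ * b * (Real.log n / n) := by ring
            _ ≤ _ := h3
            _ = _ := by ring
        exact le_of_mul_le_mul_left h4 (by positivity)
      calc sampleMean y ^ 2 ≤ (b * (∑ i, u i) / n) ^ 2 := by
            rw [← sq_abs (sampleMean y)]; gcongr
        _ = b ^ 2 / n ^ 2 * (∑ i, u i) ^ 2 * 1 := by ring
        _ ≤ b ^ 2 / n ^ 2 * (∑ i, u i) ^ 2 * Real.exp (-(4 * γ * Real.log n) + ∑ i, u i) := by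
            gcongr
            exact Real.one_le_exp (by linarith)
        _ = _ := by rw [Real.exp_add]; ring
  · rw [zero_pow two_ne_zero]; positivity

lemma measurable_sampleMean : Measurable (sampleMean : (Fin n → ℝ) → ℝ) := by
  unfold sampleMean; fun_prop

lemma measurable_sampleVar : Measurable (sampleVar : (Fin n → ℝ) → ℝ) := by
  unfold sampleVar; fun_prop

lemma measurable_sampleThreshold (γ b : ℝ) :
    Measurable (sampleThreshold γ b : (Fin n → ℝ) → ℝ) := by
  have := measurable_sampleVar (n := n)
  unfold sampleThreshold sampleOverVar; fun_prop

lemma measurable_sampleThresholded (γ b : ℝ) :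
    Measurable (sampleThresholded γ b : (Fin n → ℝ) → ℝ) := by
  refine Measurable.ite ?_ measurable_sampleMean measurable_const
  exact measurableSet_le (measurable_sampleThreshold γ b) measurable_sampleMean.norm

end Sample

/-! ### Risk of a thresholded empirical mean -/

/-- The lower-order terms in the comparison of the variance with its estimator are absorbed by any
room `t, ρ > 1` in the constants, once `s`, which is of the order of `√(log n / n)`, is small. -/
lemma exists_small_variance_slack {t ρ : ℝ} (ht : 1 < t) (hρ : 1 < ρ) :
    ∃ s₀ : ℝ, 0 < s₀ ∧ ∀ s, 0 ≤ s → s ≤ s₀ → 0 < 1 - 2 * s ^ 2 ∧ 1 / √(1 - 2 * s ^ 2) ≤ t ∧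
      4 / (1 - 2 * s ^ 2) + 2 * s / √(1 - 2 * s ^ 2) + 2 / 9 * s ^ 2 ≤ 4 * t ^ 2 ∧
      1 / (1 - 2 * s ^ 2) ≤ ρ := by
  have c1 : ContinuousAt (fun s : ℝ => 1 - 2 * s ^ 2) 0 := by fun_prop
  have e1 : ∀ᶠ s : ℝ in nhds 0, 0 < 1 - 2 * s ^ 2 := c1.eventually (lt_mem_nhds (by norm_num))
  have c2 : ContinuousAt (fun s : ℝ => 1 / √(1 - 2 * s ^ 2)) 0 :=
    ContinuousAt.div₀ (by fun_prop) (by fun_prop) (by norm_num)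
  have e2 : ∀ᶠ s : ℝ in nhds 0, 1 / √(1 - 2 * s ^ 2) < t :=
    c2.eventually (gt_mem_nhds (by simpa using ht))
  have c4 : ContinuousAt (fun s : ℝ => 1 / (1 - 2 * s ^ 2)) 0 :=
    ContinuousAt.div₀ (by fun_prop) (by fun_prop) (by norm_num)
  have e4 : ∀ᶠ s : ℝ in nhds 0, 1 / (1 - 2 * s ^ 2) < ρ :=
    c4.eventually (gt_mem_nhds (by simpa using hρ))
  have c3 : ContinuousAt (fun s : ℝ =>
      4 / (1 - 2 * s ^ 2) + 2 * s / √(1 - 2 * s ^ 2) + 2 / 9 * s ^ 2) 0 := by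
    refine ContinuousAt.add (ContinuousAt.add ?_ ?_) (by fun_prop)
    · exact ContinuousAt.div₀ (by fun_prop) (by fun_prop) (by norm_num)
    · exact ContinuousAt.div₀ (by fun_prop) (by fun_prop) (by norm_num)
  have e3 : ∀ᶠ s : ℝ in nhds 0,
      4 / (1 - 2 * s ^ 2) + 2 * s / √(1 - 2 * s ^ 2) + 2 / 9 * s ^ 2 < 4 * t ^ 2 :=
    c3.eventually (gt_mem_nhds (by
      have : (4 : ℝ) < 4 * t ^ 2 := by nlinarith
      simpa using this))
  obtain ⟨ε, hε, h⟩ := Metric.eventually_nhds_iff.1 (e1.and (e2.and (e3.and e4)))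
  refine ⟨ε / 2, by positivity, fun s hs hs' => ?_⟩
  obtain ⟨h1, h2, h3, h4⟩ := h (y := s) (by rw [Real.dist_eq, sub_zero, abs_of_nonneg hs]; linarith)
  exact ⟨h1, h2.le, h3.le, h4.le⟩

/-- Solving a quadratic inequality for the standard deviation `σ`, given the empirical standard
deviation `v`. The right-hand side is, up to the factor `ρ`, the overestimated variance when
`(t s)² = 2 γ log n / n`. -/
lemma variance_le_of_quadratic {t ρ s b σ v : ℝ} (hs : 0 ≤ s) (hb : 0 ≤ b) (hσ : 0 ≤ σ)
    (hv : 0 ≤ v) (ha : 0 < 1 - 2 * s ^ 2) (ht : 1 / √(1 - 2 * s ^ 2) ≤ t)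
    (ht4 : 4 / (1 - 2 * s ^ 2) + 2 * s / √(1 - 2 * s ^ 2) + 2 / 9 * s ^ 2 ≤ 4 * t ^ 2)
    (hρ : 1 / (1 - 2 * s ^ 2) ≤ ρ)
    (h : σ ^ 2 * (1 - 2 * s ^ 2) ≤ v ^ 2 + 2 * b * σ * s + 2 / 9 * b ^ 2 * s ^ 4) :
    σ ^ 2 ≤ ρ * (v ^ 2 + 2 * b * (v * (t * s)) + 4 * b ^ 2 * (t * s) ^ 2) := by
  set a := 1 - 2 * s ^ 2
  have hr : 0 < √a := Real.sqrt_pos.2 ha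
  have hr2 : √a ^ 2 = a := Real.sq_sqrt ha.le
  set s1 := s / √a with hs1
  set τ := √a * σ with hτ
  have hs10 : 0 ≤ s1 := by positivity
  have hτ0 : 0 ≤ τ := by positivity
  have e1 : s1 * τ = s * σ := by rw [hs1, hτ]; field_simp
  have e2 : τ ^ 2 = σ ^ 2 * a := by rw [hτ, mul_pow, hr2]; ring
  have hq : τ ^ 2 ≤ v ^ 2 + 2 * b * (s1 * τ) + 2 / 9 * b ^ 2 * s ^ 4 := by
    rw [e1, e2]; linarith
  have hτle : τ ≤ v + 2 * b * s1 + b * s ^ 2 := by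
    by_contra! hcon
    have h1 : (v + b * s ^ 2) * (v + b * s ^ 2) < τ * (τ - 2 * b * s1) := by
      have h2 : v + b * s ^ 2 < τ - 2 * b * s1 := by linarith
      have h3 : v + b * s ^ 2 < τ := by nlinarith [mul_nonneg hb hs10]
      have h4 : 0 ≤ v + b * s ^ 2 := by positivity
      exact mul_lt_mul'' h3 h2 h4 h4
    have : 0 ≤ v * (b * s ^ 2) := by positivity
    nlinarith [sq_nonneg (b * s ^ 2)]
  have hs1t : s1 ≤ t * s := by
    calc s1 = 1 / √a * s := by rw [hs1]; ring
      _ ≤ t * s := by gcongr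
  have hpoly : 4 * s1 ^ 2 + 2 * s1 * s ^ 2 + 2 / 9 * s ^ 4 ≤ 4 * (t * s) ^ 2 := by
    have : 4 * s1 ^ 2 + 2 * s1 * s ^ 2 + 2 / 9 * s ^ 4 =
        (4 / a + 2 * s / √a + 2 / 9 * s ^ 2) * s ^ 2 := by
      rw [hs1, div_pow, hr2]; ring
    rw [this]
    calc _ ≤ 4 * t ^ 2 * s ^ 2 := by gcongr
      _ = _ := by ring
  have hfin : τ ^ 2 ≤ v ^ 2 + 2 * b * (v * (t * s)) + 4 * b ^ 2 * (t * s) ^ 2 := by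
    have h1 : 2 * b * (s1 * τ) ≤ 2 * b * (s1 * (v + 2 * b * s1 + b * s ^ 2)) := by gcongr
    have h2 : b ^ 2 * (4 * s1 ^ 2 + 2 * s1 * s ^ 2 + 2 / 9 * s ^ 4) ≤ b ^ 2 * (4 * (t * s) ^ 2) := by
      gcongr
    have h3 : 2 * b * (v * s1) ≤ 2 * b * (v * (t * s)) := by gcongr
    nlinarith
  have hσ2 : σ ^ 2 = 1 / a * τ ^ 2 := by rw [e2]; field_simp
  rw [hσ2]
  have : 0 ≤ t * s := hs10.trans hs1t
  have : 0 ≤ ρ := le_trans (by positivity) hρ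
  gcongr

lemma tendsto_log_div_nat : Filter.Tendsto (fun n : ℕ => Real.log n / n) Filter.atTop (nhds 0) := by
  have h := (Real.isLittleO_log_id_atTop.tendsto_div_nhds_zero).comp tendsto_natCast_atTop_atTop
  exact h

section Risk

variable {μ : Measure ℝ} [IsProbabilityMeasure μ] {n : ℕ} {w : ℝ → ℝ} {b : ℝ}

lemma integral_sq_sub_mean_le (hw : Measurable w) (hb : ∀ x, |w x| ≤ b) :
    ∫ x, (w x - ∫ z, w z ∂μ) ^ 2 ∂μ ≤ ∫ x, w x ^ 2 ∂μ := by
  set a := ∫ z, w z ∂μ with ha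
  have hi := integrable_of_abs_le (μ := μ) hw hb
  have hi2 : Integrable (fun x => w x ^ 2) μ :=
    integrable_of_abs_le (B := b ^ 2) (by fun_prop) fun x => by
      rw [abs_pow]; gcongr; exact hb x
  have : ∀ x, (w x - a) ^ 2 = (w x ^ 2 - 2 * a * w x) + a ^ 2 := fun x => by ring
  simp_rw [this]
  have h1 : Integrable (fun x => w x ^ 2 - 2 * a * w x) μ := hi2.sub (hi.const_mul _)
  rw [integral_add h1 (integrable_const _), integral_sub hi2 (hi.const_mul _),
    integral_const_mul, ← ha]
  simp
  nlinarith [sq_nonneg a]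

lemma abs_integral_le (hb : ∀ x, |w x| ≤ b) : |∫ x, w x ∂μ| ≤ b := by
  have := norm_integral_le_of_norm_le_const (μ := μ) (f := w) (C := b)
    (Filter.Eventually.of_forall hb)
  simpa using this

/-- Bernstein's inequality for the sample mean, on both sides. -/
lemma measure_abs_sampleMean_sub_gt_le (hw : Measurable w) (hb : ∀ x, |w x| ≤ b) (hn : 2 ≤ n)
    {x : ℝ} (hx : 0 ≤ x) :
    (Measure.pi fun _ : Fin n => μ).real
      {X | √(2 * (∫ z, (w z - ∫ z, w z ∂μ) ^ 2 ∂μ) * (x / n)) + 2 * b * (x / n) / 3 <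
        |sampleMean (fun i => w (X i)) - ∫ z, w z ∂μ|} ≤ 2 * Real.exp (-x) := by
  have hn' : (2 : ℝ) ≤ n := by exact_mod_cast hn
  set a := ∫ z, w z ∂μ with ha
  have ha' : |a| ≤ b := abs_integral_le hb
  set σ2 := ∫ z, (w z - a) ^ 2 ∂μ with hσ
  have hi := integrable_of_abs_le (μ := μ) hw hb
  have hB : ∀ z, |w z - a| ≤ 2 * b := fun z => by
    calc |w z - a| ≤ |w z| + |a| := abs_sub _ _
      _ ≤ _ := by linarith [hb z]
  have h1 := bernstein (μ := μ) (n := n) (g := fun z => w z - a) (by fun_prop) hB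
    (by rw [integral_sub hi (integrable_const _)]; simp [ha]) hx
  have h2 := bernstein (μ := μ) (n := n) (g := fun z => -(w z - a)) (by fun_prop) (B := 2 * b)
    (fun z => by rw [abs_neg]; exact hB z)
    (by rw [integral_neg, integral_sub hi (integrable_const _)]; simp [ha]) hx
  simp only [neg_sq, Finset.sum_neg_distrib] at h2
  rw [← hσ] at h1 h2
  have hscale : √(2 * (n * σ2) * x) + 2 * b * x / 3 =
      n * (√(2 * σ2 * (x / n)) + 2 * b * (x / n) / 3) := by
    have : 2 * (n * σ2) * x = n ^ 2 * (2 * σ2 * (x / n)) := by field_simp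
    rw [this, Real.sqrt_mul (by positivity), Real.sqrt_sq (by positivity)]
    field_simp
  have hmean : ∀ X : Fin n → ℝ, sampleMean (fun i => w (X i)) - a = (∑ i, (w (X i) - a)) / n := by
    intro X
    rw [sampleMean, Finset.sum_sub_distrib]; simp; field_simp
  refine (measureReal_mono (s₂ := {X : Fin n → ℝ | √(2 * (n * σ2) * x) + 2 * b * x / 3 <
      ∑ i, (w (X i) - a)} ∪ {X : Fin n → ℝ | √(2 * (n * σ2) * x) + 2 * b * x / 3 <
      -∑ i, (w (X i) - a)}) ?_ (measure_ne_top _ _)).trans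
      ((measureReal_union_le _ _).trans (by linarith))
  intro X hX
  simp only [Set.mem_ofPred_eq, Set.mem_union] at hX ⊢
  rw [hmean, abs_div, abs_of_pos (by positivity : (0 : ℝ) < n), lt_div_iff₀ (by positivity),
    mul_comm, ← hscale] at hX
  exact lt_abs.1 hX

/-- The data-driven threshold dominates the error of the sample mean, up to a factor `κ < 1`,
outside an event of probability `O(n^{-c})`, for every `c < γ`. -/
lemma exists_measure_bad_le {c γ : ℝ} (hc : 0 < c) (hcγ : c < γ) :
    ∃ M : ℝ, 0 < M ∧ ∀ {n : ℕ} {μ : Measure ℝ} [IsProbabilityMeasure μ] {w : ℝ → ℝ} {b : ℝ},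
      2 ≤ n → Measurable w → (∀ x, |w x| ≤ b) →
      (Measure.pi fun _ : Fin n => μ).real
        {X | (c + γ) / (2 * γ) * sampleThreshold γ b (fun i => w (X i)) <
          |sampleMean (fun i => w (X i)) - ∫ z, w z ∂μ|} ≤ M * (n : ℝ) ^ (-c) := by
  have hγ : 0 < γ := hc.trans hcγ
  set κ := (c + γ) / (2 * γ) with hκ
  have hκ0 : 0 < κ := by positivity
  have ht : 1 < √(γ / c) := by
    rw [Real.lt_sqrt (by norm_num)]
    rw [lt_div_iff₀ hc]; linarith
  have hρ : 1 < κ ^ 2 * γ / c := by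
    rw [lt_div_iff₀ hc, hκ, div_pow, div_mul_eq_mul_div, lt_div_iff₀ (by positivity)]
    nlinarith [mul_pos hγ (pow_pos (sub_pos.2 hcγ) 2)]
  obtain ⟨s₀, hs₀, hs⟩ := exists_small_variance_slack ht hρ
  -- for the finitely many `n` below `N` the trivial bound by `1` is enough
  have hev : ∀ᶠ n : ℕ in Filter.atTop, √(2 * c * (Real.log n / n)) ≤ s₀ := by
    have h1 : Filter.Tendsto (fun n : ℕ => √(2 * c * (Real.log n / n))) Filter.atTop
        (nhds √(2 * c * 0)) := (tendsto_log_div_nat.const_mul _).sqrt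
    rw [mul_zero, Real.sqrt_zero] at h1
    exact (h1.eventually (gt_mem_nhds hs₀)).mono fun n hn => hn.le
  obtain ⟨N, hN⟩ := Filter.eventually_atTop.1 hev
  refine ⟨3 + (N : ℝ) ^ c, by positivity, ?_⟩
  intro n μ _ w b hn hw hb
  have hn' : (2 : ℝ) ≤ n := by exact_mod_cast hn
  have hnc : 0 < (n : ℝ) ^ (-c) := by positivity
  rcases lt_or_ge n N with hlt | hge
  · refine measureReal_le_one.trans ?_
    have h1 : (n : ℝ) ^ c * (n : ℝ) ^ (-c) = 1 := by
      rw [← Real.rpow_add (by linarith)]; simp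
    have h2 : (n : ℝ) ^ c ≤ (N : ℝ) ^ c := by
      have : (n : ℝ) ≤ N := by exact_mod_cast hlt.le
      gcongr
    nlinarith
  have hL := log_div_pos hn
  have hlog : 0 ≤ Real.log n := Real.log_natCast_nonneg n
  set a := ∫ z, w z ∂μ with ha
  have ha' : |a| ≤ b := abs_integral_le hb
  have hb0 : 0 ≤ b := (abs_nonneg _).trans ha'
  set σ2 := ∫ z, (w z - a) ^ 2 ∂μ with hσ
  have hσ0 : 0 ≤ σ2 := integral_nonneg fun _ => sq_nonneg _
  have hB : ∀ z, |w z - a| ≤ 2 * b := fun z => by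
    calc |w z - a| ≤ |w z| + |a| := abs_sub _ _
      _ ≤ _ := by linarith [hb z]
  have hB2 : ∀ z, (w z - a) ^ 2 ≤ 4 * b ^ 2 := fun z => by
    rw [← sq_abs]
    calc |w z - a| ^ 2 ≤ (2 * b) ^ 2 := by gcongr; exact hB z
      _ = _ := by ring
  have hx : 0 ≤ c * Real.log n := by positivity
  have hexp : Real.exp (-(c * Real.log n)) = (n : ℝ) ^ (-c) := by
    rw [Real.rpow_def_of_pos (by linarith)]; ring_nf
  have h1 := measure_abs_sampleMean_sub_gt_le (μ := μ) hw hb hn hx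
  have h2 := lower_tail_sum (μ := μ) (n := n) (g := fun z => (w z - a) ^ 2) (by fun_prop)
    hB2 (fun z => sq_nonneg _) (V := 4 * b ^ 2 * σ2) (by
      rw [hσ, ← integral_const_mul]
      refine integral_mono ?_ ?_ fun z => ?_
      · refine integrable_of_abs_le (B := (4 * b ^ 2) ^ 2) (by fun_prop) fun z => ?_
        rw [abs_of_nonneg (by positivity)]
        gcongr; exact hB2 z
      · refine Integrable.const_mul
          (integrable_of_abs_le (B := 4 * b ^ 2) (by fun_prop) fun z => ?_) _
        rw [abs_of_nonneg (by positivity)]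
        exact hB2 z
      · simp only
        rw [sq ((w z - a) ^ 2)]
        exact mul_le_mul_of_nonneg_right (hB2 z) (sq_nonneg _)) hx
  -- the exceptional events: a large deviation of the sample mean, and a sum of the `(w (X i) - a)²`
  -- which is too small
  rw [hexp] at h1 h2
  rw [← ha, ← hσ] at h1
  rw [← hσ] at h2
  refine (measureReal_mono ?_ (measure_ne_top _ _)).trans
      ((measureReal_union_le _ _).trans ((add_le_add h1 h2).trans ?_))
  · intro X hX
    by_contra hcon
    simp only [Set.mem_ofPred_eq, Set.mem_union, not_or, not_lt] at hX hcon
    obtain ⟨hc1, hc2⟩ := hcon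
    set y : Fin n → ℝ := fun i => w (X i) with hy
    have hvar := le_sampleVar hn y a
    have hv0 := sampleVar_nonneg y
    set L := Real.log n / n with hLdef
    have ecL : c * Real.log n / n = c * L := by rw [hLdef]; ring
    rw [ecL] at hc1
    set s := √(2 * c * L) with hsdef
    have hs2 : s ^ 2 = 2 * c * L := Real.sq_sqrt (by positivity)
    set σ := √σ2 with hσdef
    have hσ2 : σ ^ 2 = σ2 := Real.sq_sqrt hσ0
    have e1 : √(2 * σ2 * (c * L)) = σ * s := by
      rw [hσdef, hsdef, ← Real.sqrt_mul hσ0]; ring_nf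
    have e2 : √(2 * (n * (4 * b ^ 2 * σ2)) * (c * Real.log n)) = n * (2 * b * σ * s) := by
      have : 2 * (n * (4 * b ^ 2 * σ2)) * (c * Real.log n) =
          (n * (2 * b)) ^ 2 * (σ2 * (2 * c * L)) := by
        rw [hLdef]; field_simp; ring
      rw [this, Real.sqrt_mul (by positivity), Real.sqrt_sq (by positivity),
        Real.sqrt_mul hσ0]
      ring
    have hσs : 0 ≤ σ * s := by positivity
    have e3 : 2 * b * (c * L) / 3 = b * s ^ 2 / 3 := by rw [hs2]; ring
    rw [e1, e3] at hc1
    rw [e2] at hc2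
    have hc2' : σ2 - 2 * b * σ * s ≤ (∑ i, (y i - a) ^ 2) / n := by
      rw [le_div_iff₀ (by positivity)]
      calc _ = n * σ2 - n * (2 * b * σ * s) := by ring
        _ ≤ _ := hc2
    have hc1' : (sampleMean y - a) ^ 2 ≤ 2 * σ2 * s ^ 2 + 2 / 9 * b ^ 2 * s ^ 4 := by
      rw [← sq_abs, ← hσ2]
      calc |sampleMean y - a| ^ 2 ≤ (σ * s + b * s ^ 2 / 3) ^ 2 := by gcongr
        _ ≤ 2 * ((σ * s) ^ 2 + (b * s ^ 2 / 3) ^ 2) := add_sq_le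
        _ = _ := by ring
    obtain ⟨g1, g2, g3, g4⟩ := hs s (Real.sqrt_nonneg _) (hN n hge)
    have key := variance_le_of_quadratic (Real.sqrt_nonneg _) hb0 (Real.sqrt_nonneg σ2)
      (Real.sqrt_nonneg (sampleVar y)) g1 g2 g3 g4 (by
        rw [Real.sq_sqrt hσ0, Real.sq_sqrt hv0]
        linarith)
    have hts : √(γ / c) * s = √(2 * γ * L) := by
      rw [hsdef, ← Real.sqrt_mul (by positivity)]
      congr 1; field_simp
    have hts2 : √(2 * γ * L) ^ 2 = 2 * γ * L := Real.sq_sqrt (by positivity)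
    have hvs : √(sampleVar y) * √(2 * γ * L) = √(2 * γ * sampleVar y * L) := by
      rw [← Real.sqrt_mul hv0]; ring_nf
    rw [hts, hts2, hvs, Real.sq_sqrt hσ0, Real.sq_sqrt hv0] at key
    have key' : c * σ2 ≤ κ ^ 2 * γ * sampleOverVar γ b y := by
      have : σ2 ≤ κ ^ 2 * γ / c * sampleOverVar γ b y := by
        refine key.trans (le_of_eq ?_)
        rw [sampleOverVar]; ring
      calc c * σ2 ≤ c * (κ ^ 2 * γ / c * sampleOverVar γ b y) := by gcongr
        _ = _ := by field_simp
    have hfin : σ * s + b * s ^ 2 / 3 ≤ κ * sampleThreshold γ b y := by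
      rw [sampleThreshold, mul_add]
      refine add_le_add ?_ ?_
      · rw [← e1]
        apply Real.sqrt_le_iff.2 ⟨by positivity, ?_⟩
        rw [mul_pow, Real.sq_sqrt]
        · calc 2 * σ2 * (c * L) = 2 * (c * σ2) * L := by ring
            _ ≤ 2 * (κ ^ 2 * γ * sampleOverVar γ b y) * L := by gcongr
            _ = _ := by ring
        · have : 0 ≤ sampleOverVar γ b y :=
            (by positivity : 0 ≤ 8 * γ * b ^ 2 * L).trans (sampleOverVar_ge hb0 y)
          positivity
      · have hκγ : c ≤ κ * γ := by
          have : κ * γ = (c + γ) / 2 := by rw [hκ]; field_simp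
          rw [this]; linarith
        calc b * s ^ 2 / 3 = c * (2 * b * Real.log n / (3 * n)) := by
              rw [hs2, hLdef]; field_simp
          _ ≤ κ * γ * (2 * b * Real.log n / (3 * n)) := by gcongr
          _ = _ := by ring
    exact absurd (hc1.trans hfin) (not_le.2 hX)
  · have : 0 ≤ (N : ℝ) ^ c := by positivity
    nlinarith

end Risk

section Risk

variable {μ : Measure ℝ} [IsProbabilityMeasure μ] {n : ℕ} {w : ℝ → ℝ} {b : ℝ} {I : Set ℝ}

lemma integral_sum_eval {g : ℝ → ℝ} (hg : Integrable g μ) :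
    ∫ X : Fin n → ℝ, ∑ i, g (X i) ∂(Measure.pi fun _ => μ) = n * ∫ x, g x ∂μ := by
  have h : ∀ i : Fin n, MeasurePreserving (fun X : Fin n → ℝ => X i)
      (Measure.pi fun _ : Fin n => μ) μ := fun i => measurePreserving_eval (fun _ => μ) i
  have hint : ∀ i ∈ Finset.univ, Integrable (fun X : Fin n → ℝ => g (X i))
      (Measure.pi fun _ : Fin n => μ) := fun i _ => (h i).integrable_comp_of_integrable hg
  rw [integral_finsetSum _ hint]
  have : ∀ i : Fin n, ∫ X : Fin n → ℝ, g (X i) ∂(Measure.pi fun _ => μ) = ∫ x, g x ∂μ := by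
    intro i
    have := integral_map (μ := Measure.pi fun _ : Fin n => μ) (φ := fun X : Fin n → ℝ => X i)
      (h i).measurable.aemeasurable (f := g) (by rw [(h i).map_eq]; exact hg.aestronglyMeasurable)
    rw [← this, (h i).map_eq]
  simp [this]

lemma abs_le_mul_indicator (hb : ∀ x, |w x| ≤ b) (hI : ∀ x ∉ I, w x = 0) (x : ℝ) :
    |w x| ≤ b * I.indicator 1 x := by
  by_cases hx : x ∈ I
  · simpa [hx] using hb x
  · simp [hx, hI x hx]

lemma abs_integral_le_mul_measure (hw : Measurable w) (hb : ∀ x, |w x| ≤ b)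
    (hIm : MeasurableSet I) (hI : ∀ x ∉ I, w x = 0) : |∫ x, w x ∂μ| ≤ b * μ.real I := by
  have hi := integrable_of_abs_le (μ := μ) hw hb
  calc |∫ x, w x ∂μ| ≤ ∫ x, |w x| ∂μ := abs_integral_le_integral_abs
    _ ≤ ∫ x, b * I.indicator 1 x ∂μ :=
      integral_mono hi.abs (((integrable_const (1 : ℝ)).indicator hIm).const_mul b)
        (abs_le_mul_indicator hb hI)
    _ = b * μ.real I := by rw [integral_const_mul, integral_indicator_one hIm]

lemma integral_sq_le_mul_measure (hw : Measurable w) (hb : ∀ x, |w x| ≤ b)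
    (hIm : MeasurableSet I) (hI : ∀ x ∉ I, w x = 0) : ∫ x, w x ^ 2 ∂μ ≤ b ^ 2 * μ.real I := by
  have h := abs_integral_le_mul_measure (μ := μ) (w := fun x => w x ^ 2) (b := b ^ 2) (by fun_prop)
    (fun x => by rw [abs_pow]; gcongr; exact hb x) hIm (fun x hx => by simp [hI x hx])
  exact (le_abs_self _).trans h

lemma integral_sampleThreshold_sq_le {γ : ℝ} (hγ : 0 ≤ γ) (hw : Measurable w)
    (hb : ∀ x, |w x| ≤ b) (hn : 2 ≤ n) :
    ∫ X : Fin n → ℝ, sampleThreshold γ b (fun i => w (X i)) ^ 2 ∂(Measure.pi fun _ => μ) ≤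
      (16 * γ + 41 * γ ^ 2) *
        (Real.log n / n * ∫ x, w x ^ 2 ∂μ + b ^ 2 * (Real.log n / n) ^ 2) := by
  have hn' : (2 : ℝ) ≤ n := by exact_mod_cast hn
  have hb0 : 0 ≤ b := (abs_nonneg _).trans (hb 0)
  have hL := (log_div_pos hn).le
  set L := Real.log n / n
  have hi2 : Integrable (fun x => w x ^ 2) μ :=
    integrable_of_abs_le (B := b ^ 2) (by fun_prop) fun x => by
      rw [abs_pow]; gcongr; exact hb x
  have hw2 : 0 ≤ ∫ x, w x ^ 2 ∂μ := integral_nonneg fun _ => sq_nonneg _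
  have hI : Integrable (fun X : Fin n → ℝ => ∑ i, w (X i) ^ 2) (Measure.pi fun _ => μ) :=
    integrable_finsetSum _ fun i _ =>
      (measurePreserving_eval (fun _ : Fin n => μ) i).integrable_comp_of_integrable hi2
  have hpt : ∀ X : Fin n → ℝ, sampleThreshold γ b (fun i => w (X i)) ^ 2 ≤
      8 * γ * L * (2 / n) * ∑ i, w (X i) ^ 2 + 41 * γ ^ 2 * (b ^ 2 * L ^ 2) := by
    intro X
    refine (sampleThreshold_sq_le hγ hb0 hn _).trans ?_
    have := sampleVar_le hn (fun i => w (X i))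
    calc _ ≤ 8 * γ * L * (2 / n * ∑ i, w (X i) ^ 2) + 41 * γ ^ 2 * (b ^ 2 * L ^ 2) := by gcongr
      _ = _ := by ring
  have hrhs : Integrable (fun X : Fin n → ℝ => 8 * γ * L * (2 / n) * ∑ i, w (X i) ^ 2 +
      41 * γ ^ 2 * (b ^ 2 * L ^ 2)) (Measure.pi fun _ => μ) :=
    (hI.const_mul _).add (integrable_const _)
  calc _ ≤ ∫ X : Fin n → ℝ, (8 * γ * L * (2 / n) * ∑ i, w (X i) ^ 2 +
        41 * γ ^ 2 * (b ^ 2 * L ^ 2)) ∂(Measure.pi fun _ => μ) :=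
        integral_mono_of_nonneg (Filter.Eventually.of_forall fun _ => sq_nonneg _) hrhs
          (Filter.Eventually.of_forall hpt)
    _ = 16 * γ * (L * ∫ x, w x ^ 2 ∂μ) + 41 * γ ^ 2 * (b ^ 2 * L ^ 2) := by
        rw [integral_add (hI.const_mul _) (integrable_const _), integral_const_mul,
          integral_sum_eval hi2]
        simp
        field_simp
        ring
    _ ≤ _ := by
        have : 0 ≤ L * ∫ x, w x ^ 2 ∂μ := by positivity
        have : 0 ≤ b ^ 2 * L ^ 2 := by positivity
        nlinarith [sq_nonneg γ]

/-- The error of the sample mean on an event of small probability. -/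
lemma integral_ite_sq_le {A : Set (Fin n → ℝ)} {u : (Fin n → ℝ) → ℝ}
    {P : Measure (Fin n → ℝ)} [IsProbabilityMeasure P] (hu : Measurable u) (hA : MeasurableSet A)
    {B T : ℝ} (hB : ∀ X, |u X| ≤ B) [DecidablePred (· ∈ A)] :
    ∫ X, (if X ∈ A then u X ^ 2 else 0) ∂P ≤
      T ^ 2 * P.real A + B ^ 2 * P.real {X | T < |u X|} := by
  have hB2 : ∀ X, u X ^ 2 ≤ B ^ 2 := fun X => by
    rw [← sq_abs (u X)]; gcongr; exact hB X
  have hm : MeasurableSet {X | T < |u X|} := measurableSet_lt measurable_const hu.norm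
  have hi1 : Integrable (A.indicator (1 : (Fin n → ℝ) → ℝ)) P :=
    (integrable_const (1 : ℝ)).indicator hA
  have hi2 : Integrable ({X | T < |u X|}.indicator (1 : (Fin n → ℝ) → ℝ)) P :=
    (integrable_const (1 : ℝ)).indicator hm
  calc _ ≤ ∫ X, (T ^ 2 * A.indicator 1 X + B ^ 2 * {X | T < |u X|}.indicator 1 X) ∂P := by
        refine integral_mono_of_nonneg (Filter.Eventually.of_forall fun X => ?_)
          ((hi1.const_mul _).add (hi2.const_mul _)) (Filter.Eventually.of_forall fun X => ?_)
        · simp only [Pi.zero_apply]; split_ifs <;> positivity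
        · by_cases hX : X ∈ A
          · by_cases hT : T < |u X|
            · simp [hX, hT]
              nlinarith [hB2 X, sq_nonneg T]
            · simp [hX, hT]
              rw [← sq_abs (u X)]
              gcongr
              exact not_lt.1 hT
          · simp only [hX, if_false]
            have : 0 ≤ ({X | T < |u X|}.indicator (1 : (Fin n → ℝ) → ℝ)) X :=
              Set.indicator_nonneg (fun _ _ => zero_le_one) X
            simp [hX]
            positivity
    _ = _ := by
        rw [integral_add (hi1.const_mul _) (hi2.const_mul _), integral_const_mul,
          integral_const_mul, integral_indicator_one hA, integral_indicator_one hm]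

/-- The risk when the expected number of observations in the support of `w` is so small that the
estimator is zero with overwhelming probability. -/
lemma integral_sampleThresholded_sq_le_of_small {γ c : ℝ} (hc : 1 ≤ c) (hcγ : c < γ)
    (hb : ∀ x, |w x| ≤ b) (hIm : MeasurableSet I) (hI : ∀ x ∉ I, w x = 0)
    (hn : 2 ≤ n) (hsmall : n * μ.real I * Real.exp 2 ≤ Real.log n) :
    ∫ X : Fin n → ℝ, sampleThresholded γ b (fun i => w (X i)) ^ 2 ∂(Measure.pi fun _ => μ) ≤
      4 * Real.exp 2 * (b ^ 2 * μ.real I * (Real.log n / n) * (n : ℝ) ^ (-c)) := by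
  have hn' : (2 : ℝ) ≤ n := by exact_mod_cast hn
  have hb0 : 0 ≤ b := (abs_nonneg _).trans (hb 0)
  have hγ : 0 ≤ γ := by linarith
  have hF0 : 0 ≤ μ.real I := measureReal_nonneg
  have hlog := Real.log_natCast_nonneg n
  set g : ℝ → ℝ := I.indicator 1 with hgdef
  have hg : Measurable g := measurable_one.indicator hIm
  have hg0 : ∀ x, 0 ≤ g x := fun x => Set.indicator_nonneg (fun _ _ => zero_le_one) x
  have hg1 : ∀ x, g x ≤ 1 := fun x => Set.indicator_le_self' (fun _ _ => zero_le_one) x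
  have hS0 : ∀ X : Fin n → ℝ, 0 ≤ ∑ i, g (X i) := fun X => Finset.sum_nonneg fun i _ => hg0 _
  have hS1 : ∀ X : Fin n → ℝ, ∑ i, g (X i) ≤ n := fun X => by
    calc ∑ i, g (X i) ≤ ∑ _i : Fin n, (1 : ℝ) := Finset.sum_le_sum fun i _ => hg1 _
      _ = n := by simp
  have hi : Integrable (fun X : Fin n → ℝ => (∑ i, g (X i)) ^ 2 * Real.exp (∑ i, g (X i)))
      (Measure.pi fun _ => μ) := by
    refine integrable_of_abs_le (B := (n : ℝ) ^ 2 * Real.exp n) (by fun_prop) fun X => ?_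
    have := hS0 X
    rw [abs_of_nonneg (by positivity)]
    gcongr <;> exact hS1 X
  have hexp : ∀ s : ℝ, Real.exp (-(s * Real.log n)) = (n : ℝ) ^ (-s) := fun s => by
    rw [Real.rpow_def_of_pos (by linarith)]; ring_nf
  calc _ ≤ ∫ X : Fin n → ℝ, b ^ 2 / n ^ 2 * Real.exp (-(4 * γ * Real.log n)) *
          ((∑ i, g (X i)) ^ 2 * Real.exp (∑ i, g (X i))) ∂(Measure.pi fun _ => μ) :=
        integral_mono_of_nonneg (Filter.Eventually.of_forall fun _ => sq_nonneg _)
          (hi.const_mul _) (Filter.Eventually.of_forall fun X =>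
            sampleThresholded_sq_le hγ hb0 hn fun i => abs_le_mul_indicator hb hI _)
    _ ≤ b ^ 2 / n ^ 2 * Real.exp (-(4 * γ * Real.log n)) *
          (2 * (n * μ.real I * Real.exp 2) * Real.exp (n * μ.real I * Real.exp 2)) := by
        rw [integral_const_mul]
        gcongr
        exact integral_count_sq_mul_exp_le hIm
    _ ≤ b ^ 2 / n ^ 2 * (n : ℝ) ^ (-(1 + c)) *
          (2 * (n * μ.real I * Real.exp 2) * Real.exp (Real.log n)) := by
        rw [hexp]
        gcongr
        · linarith
        · linarith
    _ = 2 * Real.exp 2 * (b ^ 2 * μ.real I * (n : ℝ)⁻¹ * (n : ℝ) ^ (-c)) := by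
        rw [Real.exp_log (by linarith), neg_add, Real.rpow_add (by linarith), Real.rpow_neg_one]
        field_simp
    _ ≤ 2 * Real.exp 2 * (b ^ 2 * μ.real I * (2 * (Real.log n / n)) * (n : ℝ) ^ (-c)) := by
        gcongr
        exact inv_le_two_mul_log_div hn
    _ = _ := by ring

/-- The error of the sample mean on the event where the threshold is too small, when the support
of `w` is expected to contain at least of the order of `log n` observations. -/
lemma exists_integral_bad_le {γ c : ℝ} (hc : 1 ≤ c) (hcγ : c < γ) :
    ∃ C : ℝ, 0 < C ∧ ∀ {n : ℕ} {μ : Measure ℝ} [IsProbabilityMeasure μ] {w : ℝ → ℝ} {b : ℝ}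
      {I : Set ℝ}, 2 ≤ n → Measurable w → (∀ x, |w x| ≤ b) → MeasurableSet I →
      (∀ x ∉ I, w x = 0) → Real.log n < n * μ.real I * Real.exp 2 →
      ∫ X : Fin n → ℝ, (if (c + γ) / (2 * γ) * sampleThreshold γ b (fun i => w (X i)) <
          |sampleMean (fun i => w (X i)) - ∫ z, w z ∂μ| then
          (sampleMean (fun i => w (X i)) - ∫ z, w z ∂μ) ^ 2 else 0) ∂(Measure.pi fun _ => μ) ≤
        C * (b ^ 2 * μ.real I * (Real.log n / n) * (n : ℝ) ^ (-c)) := by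
  obtain ⟨M, hM, hbad⟩ := exists_measure_bad_le (by linarith : 0 < c) hcγ
  set D := 4 * (c + 2) + (c + 2) ^ 2 * Real.exp 2
  have hD : 0 < D := by have := Real.exp_pos 2; positivity
  -- the error of the sample mean is cut at the level `T` which it exceeds with probability at most
  -- `2 n^{-(c+2)}`: below it the square is at most `T²`, and beyond it the trivial bound is enough
  refine ⟨D * M + 32 * Real.exp 2, by positivity, ?_⟩
  intro n μ _ w b I hn hw hb hIm hI hbig
  have hn' : (2 : ℝ) ≤ n := by exact_mod_cast hn
  have hb0 : 0 ≤ b := (abs_nonneg _).trans (hb 0)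
  have hF0 : 0 ≤ μ.real I := measureReal_nonneg
  have hL := log_div_pos hn
  have hx : 0 ≤ (c + 2) * Real.log n := mul_nonneg (by linarith) (Real.log_natCast_nonneg n)
  have hdev := measure_abs_sampleMean_sub_gt_le (μ := μ) hw hb hn hx
  have hvar := (integral_sq_sub_mean_le (μ := μ) hw hb).trans
    (integral_sq_le_mul_measure (μ := μ) hw hb hIm hI)
  have hσ0 : 0 ≤ ∫ z, (w z - ∫ z, w z ∂μ) ^ 2 ∂μ := integral_nonneg fun _ => sq_nonneg _
  have habs : |∫ z, w z ∂μ| ≤ b := abs_integral_le hb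
  have hbadn := hbad (μ := μ) hn hw hb
  set a := ∫ z, w z ∂μ
  set σ2 := ∫ z, (w z - a) ^ 2 ∂μ
  set P := Measure.pi fun _ : Fin n => μ
  set F := μ.real I
  set T := √(2 * σ2 * ((c + 2) * Real.log n / n)) + 2 * b * ((c + 2) * Real.log n / n) / 3 with hT
  have hmean : Measurable fun X : Fin n → ℝ => sampleMean (fun i => w (X i)) - a :=
    (measurable_sampleMean.comp (g := sampleMean) (f := fun (X : Fin n → ℝ) i => w (X i))
      (by fun_prop)).sub_const a
  have hthr : Measurable fun X : Fin n → ℝ => sampleThreshold γ b (fun i => w (X i)) :=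
    (measurable_sampleThreshold γ b).comp (f := fun (X : Fin n → ℝ) i => w (X i)) (by fun_prop)
  have hA : MeasurableSet {X : Fin n → ℝ | (c + γ) / (2 * γ) *
      sampleThreshold γ b (fun i => w (X i)) < |sampleMean (fun i => w (X i)) - a|} :=
    measurableSet_lt (hthr.const_mul _) hmean.norm
  have hkey := integral_ite_sq_le (P := P) (T := T) hmean hA
    (fun X => abs_sampleMean_sub_le hn (fun i => hb (X i)) habs)
  simp only [Set.mem_ofPred_eq] at hkey
  refine hkey.trans ?_
  have hLF : Real.log n / n ≤ F * Real.exp 2 := by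
    rw [div_le_iff₀ (by linarith)]; linarith
  have hnc : 0 < (n : ℝ) ^ (-c) := by positivity
  have hT2 : T ^ 2 ≤ D * (b ^ 2 * F * (Real.log n / n)) := by
    have e : (c + 2) * Real.log n / n = (c + 2) * (Real.log n / n) := by ring
    rw [hT, e]
    set L := Real.log n / n
    calc _ ≤ 2 * (√(2 * σ2 * ((c + 2) * L)) ^ 2 + (2 * b * ((c + 2) * L) / 3) ^ 2) := add_sq_le
      _ = 4 * (c + 2) * (σ2 * L) + 8 / 9 * (c + 2) ^ 2 * (b ^ 2 * (L * L)) := by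
        rw [Real.sq_sqrt (mul_nonneg (by positivity) (mul_nonneg (by linarith) hL.le))]; ring
      _ ≤ 4 * (c + 2) * (b ^ 2 * F * L) + 1 * (c + 2) ^ 2 * (b ^ 2 * (F * Real.exp 2 * L)) := by
        gcongr
        norm_num
      _ = _ := by ring
  have hexp : Real.exp (-((c + 2) * Real.log n)) = (n : ℝ) ^ (-c) * ((n : ℝ)⁻¹ * (n : ℝ)⁻¹) := by
    have : Real.exp (-((c + 2) * Real.log n)) = (n : ℝ) ^ (-c + -1 + -1) := by
      rw [Real.rpow_def_of_pos (by linarith)]; ring_nf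
    rw [this, Real.rpow_add (by linarith), Real.rpow_add (by linarith), Real.rpow_neg_one]
    ring
  have hinv := inv_le_two_mul_log_div hn
  have hninv : (n : ℝ)⁻¹ * (n : ℝ)⁻¹ ≤ 4 * (Real.log n / n * (F * Real.exp 2)) := by
    calc (n : ℝ)⁻¹ * (n : ℝ)⁻¹ ≤ (2 * (Real.log n / n)) * (2 * (Real.log n / n)) := by gcongr
      _ ≤ (2 * (Real.log n / n)) * (2 * (F * Real.exp 2)) := by gcongr
      _ = _ := by ring
  rw [hexp] at hdev
  calc _ ≤ D * (b ^ 2 * F * (Real.log n / n)) * (M * (n : ℝ) ^ (-c)) + (2 * b) ^ 2 *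
          (2 * ((n : ℝ) ^ (-c) * (4 * (Real.log n / n * (F * Real.exp 2))))) := by
        gcongr
        exact hdev.trans (by gcongr)
    _ = _ := by ring

set_option maxHeartbeats 1000000 in
/-- The risk of the thresholded sample mean as an estimator of `∫ w dμ`: up to a remainder which
is summable over the wavelets, it is at most the minimum of the risk of the zero estimator and of
the squared deterministic counterpart of the threshold. -/
theorem exists_coeff_risk_le {γ c : ℝ} (hc : 1 ≤ c) (hcγ : c < γ) :
    ∃ C : ℝ, 0 < C ∧ ∀ {n : ℕ} {μ : Measure ℝ} [IsProbabilityMeasure μ] {w : ℝ → ℝ} {b : ℝ}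
      {I : Set ℝ}, 2 ≤ n → Measurable w → (∀ x, |w x| ≤ b) → MeasurableSet I →
      (∀ x ∉ I, w x = 0) →
      ∫ X : Fin n → ℝ, (sampleThresholded γ b (fun i => w (X i)) - ∫ z, w z ∂μ) ^ 2
          ∂(Measure.pi fun _ => μ) ≤
        C * (min ((∫ z, w z ∂μ) ^ 2)
            (Real.log n / n * ∫ z, w z ^ 2 ∂μ + b ^ 2 * (Real.log n / n) ^ 2) +
          b ^ 2 * μ.real I * (Real.log n / n) * (n : ℝ) ^ (-c)) := by
  obtain ⟨C₁, hC₁, hbad⟩ := exists_integral_bad_le hc hcγ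
  have hγ : 0 < γ := by linarith
  set κ := (c + γ) / (2 * γ) with hκ
  have hκ0 : 0 < κ := by positivity
  have hκ1 : κ < 1 := by rw [hκ, div_lt_one (by positivity)]; linarith
  have hκ' : 0 < 1 - κ := by linarith
  set C₂ := 4 / (1 - κ) ^ 2 * (1 + (16 * γ + 41 * γ ^ 2)) with hC₂
  have hC₂0 : 0 < C₂ := by positivity
  refine ⟨2 + 8 * Real.exp 2 + (1 + 1 / κ) ^ 2 * C₁ + C₂, by positivity, ?_⟩
  intro n μ _ w b I hn hw hb hIm hI
  have hn' : (2 : ℝ) ≤ n := by exact_mod_cast hn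
  have hb0 : 0 ≤ b := (abs_nonneg _).trans (hb 0)
  have hF0 : 0 ≤ μ.real I := measureReal_nonneg
  have hL := log_div_pos hn
  have hw2 : 0 ≤ ∫ z, w z ^ 2 ∂μ := integral_nonneg fun _ => sq_nonneg _
  have habs : |∫ z, w z ∂μ| ≤ b := abs_integral_le hb
  have hbadn := fun h => hbad (μ := μ) hn hw hb hIm hI h
  have ha := abs_integral_le_mul_measure (μ := μ) hw hb hIm hI
  have hthr2 := integral_sampleThreshold_sq_le (μ := μ) hγ.le hw hb hn
  have hJ0 : 0 ≤ b ^ 2 * μ.real I * (Real.log n / n) * (n : ℝ) ^ (-c) := by positivity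
  have hmeas : Measurable fun (X : Fin n → ℝ) i => w (X i) := by fun_prop
  have hm1 : Measurable fun X : Fin n → ℝ => sampleThresholded γ b (fun i => w (X i)) :=
    (measurable_sampleThresholded γ b).comp hmeas
  set a := ∫ z, w z ∂μ
  set V := Real.log n / n * ∫ z, w z ^ 2 ∂μ + b ^ 2 * (Real.log n / n) ^ 2 with hV
  set J := b ^ 2 * μ.real I * (Real.log n / n) * (n : ℝ) ^ (-c) with hJ
  have hV0 : 0 ≤ V := by positivity
  have hmin0 : 0 ≤ min (a ^ 2) V := le_min (sq_nonneg _) hV0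
  rcases le_or_gt (n * μ.real I * Real.exp 2) (Real.log n) with hsmall | hbig
  -- few expected observations in `I`: the zero estimator is good, and `a² ≤ V` automatically
  · have h1 := integral_sampleThresholded_sq_le_of_small (μ := μ) hc hcγ hb hIm hI hn hsmall
    have hFL : μ.real I ≤ Real.log n / n := by
      rw [le_div_iff₀ (by linarith)]
      have : 1 ≤ Real.exp 2 := Real.one_le_exp (by norm_num)
      have : 0 ≤ n * μ.real I := by positivity
      nlinarith
    have ha2 : a ^ 2 ≤ min (a ^ 2) V := by
      refine le_min le_rfl ?_
      have : a ^ 2 ≤ b ^ 2 * (Real.log n / n) ^ 2 := by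
        rw [← sq_abs, ← mul_pow]
        gcongr
        exact ha.trans (by gcongr)
      have h3 : 0 ≤ Real.log n / n * ∫ z, w z ^ 2 ∂μ := by positivity
      linarith
    have hi : Integrable (fun X : Fin n → ℝ => sampleThresholded γ b (fun i => w (X i)) ^ 2)
        (Measure.pi fun _ => μ) := by
      refine integrable_of_abs_le (B := (2 * b) ^ 2) (by fun_prop) fun X => ?_
      rw [abs_pow]
      gcongr
      rw [sampleThresholded]
      split_ifs
      · simpa using abs_sampleMean_sub_le (a := 0) hn (fun i => hb (X i)) (by simpa using hb0)
      · simpa using hb0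
    calc _ ≤ ∫ X : Fin n → ℝ, (2 * sampleThresholded γ b (fun i => w (X i)) ^ 2 + 2 * a ^ 2)
            ∂(Measure.pi fun _ => μ) := by
          refine integral_mono_of_nonneg (Filter.Eventually.of_forall fun _ => sq_nonneg _)
            ((hi.const_mul _).add (integrable_const _)) (Filter.Eventually.of_forall fun X => ?_)
          simp only
          nlinarith [sq_nonneg (sampleThresholded γ b (fun i => w (X i)) + a)]
      _ ≤ 2 * (4 * Real.exp 2 * J) + 2 * a ^ 2 := by
          rw [integral_add (hi.const_mul _) (integrable_const _), integral_const_mul]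
          simp only [integral_const, probReal_univ, smul_eq_mul, one_mul]
          gcongr
      _ ≤ _ := by
          have h4 : 0 ≤ (1 + 1 / κ) ^ 2 * C₁ + C₂ := by positivity
          have h5 : 0 ≤ ((1 + 1 / κ) ^ 2 * C₁ + C₂) * (min (a ^ 2) V + J) := by positivity
          have h6 := Real.exp_pos 2
          nlinarith [mul_nonneg h6.le hmin0]
  · have hA : Measurable fun X : Fin n → ℝ => sampleMean (fun i => w (X i)) - a :=
      (measurable_sampleMean.comp hmeas).sub_const a
    have hthr : Measurable fun X : Fin n → ℝ => sampleThreshold γ b (fun i => w (X i)) :=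
      (measurable_sampleThreshold γ b).comp hmeas
    have hi1 : Integrable (fun X : Fin n → ℝ =>
        min (a ^ 2) (sampleThreshold γ b (fun i => w (X i)) ^ 2)) (Measure.pi fun _ => μ) := by
      refine integrable_of_abs_le (B := a ^ 2) (by fun_prop) fun X => ?_
      rw [abs_of_nonneg (by positivity)]
      exact min_le_left _ _
    have hi2 : Integrable (fun X : Fin n → ℝ =>
        if κ * sampleThreshold γ b (fun i => w (X i)) < |sampleMean (fun i => w (X i)) - a| then
        (sampleMean (fun i => w (X i)) - a) ^ 2 else 0) (Measure.pi fun _ => μ) := by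
      refine integrable_of_abs_le (B := (2 * b) ^ 2)
        (Measurable.ite (measurableSet_lt (hthr.const_mul _) hA.norm) (by fun_prop)
          measurable_const) fun X => ?_
      split_ifs
      · rw [abs_pow]; gcongr; exact abs_sampleMean_sub_le hn (fun i => hb (X i)) habs
      · simp; positivity
    have hi3 : Integrable (fun X : Fin n → ℝ => sampleThreshold γ b (fun i => w (X i)) ^ 2)
        (Measure.pi fun _ => μ) := by
      refine integrable_of_abs_le (B := 8 * γ * (Real.log n / n) * (2 * b ^ 2) +
        41 * γ ^ 2 * (b ^ 2 * (Real.log n / n) ^ 2)) (by fun_prop) fun X => ?_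
      rw [abs_of_nonneg (sq_nonneg _)]
      refine (sampleThreshold_sq_le hγ.le hb0 hn _).trans ?_
      gcongr
      refine (sampleVar_le hn _).trans ?_
      calc 2 / (n : ℝ) * ∑ i, w (X i) ^ 2 ≤ 2 / (n : ℝ) * ∑ _i : Fin n, b ^ 2 := by
            refine mul_le_mul_of_nonneg_left (Finset.sum_le_sum fun i _ => ?_) (by positivity)
            exact sq_le_sq' (abs_le.1 (hb _)).1 (abs_le.1 (hb _)).2
        _ = 2 * b ^ 2 := by simp; field_simp
    have hmin : ∫ X : Fin n → ℝ, min (a ^ 2) (sampleThreshold γ b (fun i => w (X i)) ^ 2)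
        ∂(Measure.pi fun _ => μ) ≤ (1 + (16 * γ + 41 * γ ^ 2)) * min (a ^ 2) V := by
      have hG : 0 ≤ 16 * γ + 41 * γ ^ 2 := by positivity
      rw [mul_min_of_nonneg _ _ (by positivity)]
      refine le_min ?_ ?_
      · calc _ ≤ ∫ X : Fin n → ℝ, a ^ 2 ∂(Measure.pi fun _ => μ) :=
              integral_mono hi1 (integrable_const _) fun X => min_le_left _ _
          _ = a ^ 2 := by simp
          _ ≤ _ := le_mul_of_one_le_left (sq_nonneg a) (by linarith)
      · calc _ ≤ ∫ X : Fin n → ℝ, sampleThreshold γ b (fun i => w (X i)) ^ 2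
                ∂(Measure.pi fun _ => μ) := integral_mono hi1 hi3 fun X => min_le_right _ _
          _ ≤ (16 * γ + 41 * γ ^ 2) * V := hthr2
          _ ≤ _ := mul_le_mul_of_nonneg_right (by linarith) hV0
    calc _ ≤ ∫ X : Fin n → ℝ, (4 / (1 - κ) ^ 2 *
              min (a ^ 2) (sampleThreshold γ b (fun i => w (X i)) ^ 2) + (1 + 1 / κ) ^ 2 *
              (if κ * sampleThreshold γ b (fun i => w (X i)) <
                |sampleMean (fun i => w (X i)) - a| then
                (sampleMean (fun i => w (X i)) - a) ^ 2 else 0)) ∂(Measure.pi fun _ => μ) :=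
          integral_mono_of_nonneg (Filter.Eventually.of_forall fun _ => sq_nonneg _)
            ((hi1.const_mul _).add (hi2.const_mul _)) (Filter.Eventually.of_forall fun X =>
              sampleThresholded_sub_sq_le hκ0 hκ1 hγ.le hb0 _ a)
      _ ≤ 4 / (1 - κ) ^ 2 * ((1 + (16 * γ + 41 * γ ^ 2)) * min (a ^ 2) V) +
            (1 + 1 / κ) ^ 2 * (C₁ * J) := by
          rw [integral_add (hi1.const_mul _) (hi2.const_mul _), integral_const_mul,
            integral_const_mul]
          gcongr
          exact hbadn hbig
      _ = C₂ * min (a ^ 2) V + (1 + 1 / κ) ^ 2 * C₁ * J := by rw [hC₂]; ring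
      _ ≤ _ := by
          have h4 : 0 ≤ (1 + 1 / κ) ^ 2 * C₁ := by positivity
          have h6 := Real.exp_pos 2
          nlinarith [mul_nonneg h4 hmin0, mul_nonneg hC₂0.le hJ0, mul_nonneg h6.le hmin0,
            mul_nonneg h6.le hJ0]

end Risk

/-! ### Levels, supports and bounds of the wavelets -/

/-- The dilation factor of the wavelets at the `a`-th level, the levels being numbered from
zero: `1` for the father wavelets (`a = 0`, that is `j = -1`) and `2^(a-1)` for the mother wavelets
with `j = a - 1 ≥ 0`. Truncated subtraction makes both cases one formula. -/
def scale (a : ℕ) : ℝ := 2 ^ (a - 1)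

/-- The function which generates the `a`-th level: the father wavelet if `a = 0`, the mother wavelet
otherwise. -/
def generator (φ ψ : ℝ → ℝ) (a : ℕ) : ℝ → ℝ := if a = 0 then φ else ψ

lemma scale_pos (a : ℕ) : 0 < scale a := by unfold scale; positivity

lemma one_le_scale (a : ℕ) : 1 ≤ scale a := one_le_pow₀ (by norm_num)

lemma scale_zero : scale 0 = 1 := by simp [scale]

lemma scale_succ (a : ℕ) : scale (a + 1) = 2 ^ a := by simp [scale]

lemma wavelet_eq (φ ψ : ℝ → ℝ) (a : ℕ) (k : ℤ) (x : ℝ) :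
    wavelet φ ψ ((a : ℤ) - 1) k x = √(scale a) * generator φ ψ a (scale a * x - k) := by
  cases a with
  | zero => simp [wavelet, scale, generator]
  | succ a =>
    have h : ¬ (((a + 1 : ℕ) : ℤ) - 1 = -1) := by push_cast; omega
    have h' : ((a + 1 : ℕ) : ℤ) - 1 = (a : ℤ) := by push_cast; ring
    rw [wavelet, if_neg h, h', scale_succ, generator, if_neg (Nat.succ_ne_zero a), zpow_natCast]
    congr 1
    rw [Real.sqrt_eq_rpow, ← Real.rpow_natCast, ← Real.rpow_mul (by norm_num)]
    congr 1
    push_cast; ring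

lemma PiecewiseConstant.measurable {g : ℝ → ℝ} (hg : PiecewiseConstant g) : Measurable g := by
  obtain ⟨S, hS⟩ := hg
  intro U hU
  have h1 : g ⁻¹' U = (g ⁻¹' U ∩ S) ∪ (g ⁻¹' U \ S) := (Set.inter_union_sdiff _ _).symm
  rw [h1]
  refine (S.finite_toSet.subset Set.inter_subset_right).measurableSet.union (IsOpen.measurableSet ?_)
  rw [Metric.isOpen_iff]
  intro x hx
  obtain ⟨ε, hε, hball⟩ := Metric.isOpen_iff.1 S.finite_toSet.isClosed.isOpen_compl x hx.2
  refine ⟨ε, hε, fun y hy => ?_⟩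
  have hsub : ∀ z, |z - x| ≤ |y - x| → z ∉ (S : Set ℝ) := fun z hz => hball (by
    rw [Metric.mem_ball, Real.dist_eq] at hy ⊢; exact hz.trans_lt hy)
  have hxy : g y = g x := by
    rcases le_total x y with h | h
    · refine (hS x y h (Set.disjoint_left.2 fun z hz => hsub z ?_)).symm
      rw [abs_of_nonneg (by linarith [hz.1]), abs_of_nonneg (by linarith)]
      linarith [hz.2]
    · refine hS y x h (Set.disjoint_left.2 fun z hz => hsub z ?_)
      rw [abs_of_nonpos (by linarith [hz.2]), abs_of_nonpos (by linarith)]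
      linarith [hz.1]
  exact ⟨by rw [Set.mem_preimage, hxy]; exact hx.1, hsub y le_rfl⟩

/-- A piecewise constant function takes finitely many values: off the break points, its value at `x`
depends only on the set of break points to the left of `x`. -/
lemma PiecewiseConstant.bounded {g : ℝ → ℝ} (hg : PiecewiseConstant g) :
    ∃ M : ℝ, ∀ x, |g x| ≤ M := by
  obtain ⟨S, hS⟩ := hg
  have h1 : ∀ T : Finset ℝ, ∃ B : ℝ, 0 ≤ B ∧ ∀ x ∉ S, S.filter (· < x) = T → |g x| ≤ B := by
    intro T
    by_cases h : ∃ x ∉ S, S.filter (· < x) = T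
    · obtain ⟨x₀, hx₀, hT⟩ := h
      refine ⟨|g x₀|, abs_nonneg _, fun x hx hxT => le_of_eq ?_⟩
      have key : ∀ u v : ℝ, u ≤ v → u ∉ S → v ∉ S → S.filter (· < u) = S.filter (· < v) →
          g u = g v := by
        intro u v huv hu hv he
        refine hS u v huv (Set.disjoint_left.2 fun z hz hzS => ?_)
        have hzv : z < v := lt_of_le_of_ne hz.2 fun h => hv (h ▸ hzS)
        have : z ∈ S.filter (· < u) := by rw [he]; simpa using ⟨hzS, hzv⟩
        exact absurd (Finset.mem_filter.1 this).2 (not_lt.2 hz.1)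
      rcases le_total x x₀ with h | h
      · rw [key x x₀ h hx hx₀ (hxT.trans hT.symm)]
      · rw [key x₀ x h hx₀ hx (hT.trans hxT.symm)]
    · exact ⟨0, le_rfl, fun x hx hxT => absurd ⟨x, hx, hxT⟩ h⟩
  choose B hB0 hB using h1
  refine ⟨∑ T ∈ S.powerset, B T + ∑ s ∈ S, |g s|, fun x => ?_⟩
  have n1 : 0 ≤ ∑ T ∈ S.powerset, B T := Finset.sum_nonneg fun T _ => hB0 T
  have n2 : 0 ≤ ∑ s ∈ S, |g s| := Finset.sum_nonneg fun s _ => abs_nonneg _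
  by_cases hx : x ∈ S
  · have := Finset.single_le_sum (f := fun s => |g s|) (fun s _ => abs_nonneg _) hx
    linarith
  · have h2 := hB _ x hx rfl
    have := Finset.single_le_sum (f := B) (fun T _ => hB0 T)
      (Finset.mem_powerset.2 (Finset.filter_subset (· < x) S))
    linarith

lemma exists_support_bound {g : ℝ → ℝ} (hg : HasCompactSupport g) :
    ∃ A : ℝ, ∀ x, A < |x| → g x = 0 := by
  obtain ⟨A, hA⟩ := hg.isCompact.isBounded.subset_closedBall 0
  refine ⟨A, fun x hx => ?_⟩
  by_contra h
  have := hA (subset_tsupport g h)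
  rw [Metric.mem_closedBall, Real.dist_eq, sub_zero] at this
  linarith

/-- The function `g` is measurable, vanishes outside `[-A, A]` and is bounded by `M`. -/
structure IsBump (A M : ℝ) (g : ℝ → ℝ) : Prop where
  measurable : Measurable g
  bound : ∀ x, |g x| ≤ M
  support : ∀ x, A < |x| → g x = 0

lemma IsBump.mono {A M A' M' : ℝ} {g : ℝ → ℝ} (h : IsBump A M g) (hA : A ≤ A') (hM : M ≤ M') :
    IsBump A' M' g :=
  ⟨h.measurable, fun x => (h.bound x).trans hM, fun x hx => h.support x (hA.trans_lt hx)⟩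

lemma isBump_box : IsBump 1 1 box := by
  refine ⟨measurable_const.indicator measurableSet_Icc, fun x => ?_, fun x hx => ?_⟩
  · unfold box; by_cases h : x ∈ Set.Icc (0 : ℝ) 1 <;> simp [h]
  · unfold box
    rw [Set.indicator_of_notMem]
    rintro ⟨h0, h1⟩
    rw [abs_of_nonneg h0] at hx
    linarith

lemma HolderRegular.contDiff_one {s : ℝ} {g : ℝ → ℝ} (hs : 1 < s) (hg : HolderRegular s g) :
    ContDiff ℝ 1 g := by
  obtain ⟨m, δ, -, hδ, hsm, hm, -⟩ := hg
  have : 0 < m := by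
    have : (0 : ℝ) < m := by linarith
    exact_mod_cast this
  exact hm.of_le (by exact_mod_cast this)

lemma exists_isBump_of_contDiff {g : ℝ → ℝ} (hc : HasCompactSupport g) (hg : ContDiff ℝ 1 g) :
    ∃ A M Λ : ℝ, 0 ≤ Λ ∧ IsBump A M g ∧ ∀ x y, |g x - g y| ≤ Λ * |x - y| := by
  obtain ⟨A, hA⟩ := exists_support_bound hc
  obtain ⟨M, hM⟩ := hc.exists_bound_of_continuous hg.continuous
  obtain ⟨Λ, hΛ⟩ := hg.lipschitzWith_of_hasCompactSupport hc (by norm_num)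
  exact ⟨A, M, Λ, Λ.2, ⟨hg.continuous.measurable, hM, hA⟩, fun x y => by
    simpa [Real.dist_eq] using hΛ.dist_le_mul x y⟩

section Basis

variable {r : ℝ} {ψ φt ψt : ℝ → ℝ}

/-- Common bounds for the generators of the two families. -/
lemma IsBiorthogonalWaveletBasis.exists_bounds (hΦ : IsBiorthogonalWaveletBasis r ψ φt ψt)
    (hr : 0 < r) : ∃ A M Λ : ℝ, 1 ≤ A ∧ 0 < M ∧ 0 ≤ Λ ∧
      (∀ a, IsBump A M (generator box ψ a)) ∧ (∀ a, IsBump A M (generator φt ψt a)) ∧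
      ∀ a x y, |generator φt ψt a x - generator φt ψt a y| ≤ Λ * |x - y| := by
  obtain ⟨A₁, M₁, Λ₁, hΛ₁, h₁, h₁'⟩ :=
    exists_isBump_of_contDiff hΦ.compact_φt (hΦ.smooth_φt.contDiff_one (by linarith))
  obtain ⟨A₂, M₂, Λ₂, hΛ₂, h₂, h₂'⟩ :=
    exists_isBump_of_contDiff hΦ.compact_ψt (hΦ.smooth_ψt.contDiff_one (by linarith))
  obtain ⟨A₃, hA₃⟩ := exists_support_bound hΦ.compact_ψ
  obtain ⟨M₃, hM₃⟩ := hΦ.piecewise_ψ.bounded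
  have h₃ : IsBump A₃ M₃ ψ := ⟨hΦ.piecewise_ψ.measurable, hM₃, hA₃⟩
  refine ⟨max (max A₁ A₂) (max A₃ 1), max (max M₁ M₂) (max M₃ 1), Λ₁ + Λ₂,
    by simp, by simp, by positivity, fun a => ?_, fun a => ?_, fun a x y => ?_⟩
  · unfold generator
    split_ifs
    · exact isBump_box.mono (by simp) (by simp)
    · exact h₃.mono (by simp) (by simp)
  · unfold generator
    split_ifs
    · exact h₁.mono (by simp) (by simp)
    · exact h₂.mono (by simp) (by simp)
  · have := abs_nonneg (x - y)
    unfold generator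
    split_ifs
    · exact (h₁' x y).trans (by nlinarith)
    · exact (h₂' x y).trans (by nlinarith)

/-- The interval which contains the support of the wavelet with indices `a`, `k`, when the
generators are supported in `[-A, A]`. -/
def cell (A : ℝ) (a : ℕ) (k : ℤ) : Set ℝ := Set.Icc ((k - A) / scale a) ((k + A) / scale a)

lemma mem_cell {A : ℝ} {a : ℕ} {k : ℤ} {x : ℝ} : x ∈ cell A a k ↔ |scale a * x - k| ≤ A := by
  have := scale_pos a
  rw [cell, Set.mem_Icc, div_le_iff₀ this, le_div_iff₀ this, abs_le, mul_comm x]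
  constructor <;> rintro ⟨h1, h2⟩ <;> constructor <;> linarith

lemma measurableSet_cell (A : ℝ) (a : ℕ) (k : ℤ) : MeasurableSet (cell A a k) := measurableSet_Icc

lemma volume_cell (A : ℝ) (a : ℕ) (k : ℤ) :
    volume (cell A a k) = ENNReal.ofReal (2 * A / scale a) := by
  rw [cell, Real.volume_Icc]; congr 1; ring

section Wavelets

variable {φ ψ : ℝ → ℝ} {A M : ℝ}

lemma measurable_wavelet (h : ∀ a, IsBump A M (generator φ ψ a)) (a : ℕ) (k : ℤ) :
    Measurable (wavelet φ ψ ((a : ℤ) - 1) k) := by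
  have := (h a).measurable
  have e : wavelet φ ψ ((a : ℤ) - 1) k =
      fun x => √(scale a) * generator φ ψ a (scale a * x - k) := funext fun x => wavelet_eq _ _ _ _ _
  rw [e]; fun_prop

lemma abs_wavelet_le (h : ∀ a, IsBump A M (generator φ ψ a)) (a : ℕ) (k : ℤ) (x : ℝ) :
    |wavelet φ ψ ((a : ℤ) - 1) k x| ≤ M * √(scale a) := by
  rw [wavelet_eq, abs_mul, abs_of_nonneg (Real.sqrt_nonneg _), mul_comm]
  gcongr
  exact (h a).bound _

lemma wavelet_eq_zero (h : ∀ a, IsBump A M (generator φ ψ a)) (a : ℕ) (k : ℤ) {x : ℝ}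
    (hx : x ∉ cell A a k) : wavelet φ ψ ((a : ℤ) - 1) k x = 0 := by
  rw [wavelet_eq, (h a).support _ (not_le.1 fun hx' => hx (mem_cell.2 hx')), mul_zero]

lemma memLp_wavelet (h : ∀ a, IsBump A M (generator φ ψ a)) (a : ℕ) (k : ℤ) (p : ℝ≥0∞) :
    MemLp (wavelet φ ψ ((a : ℤ) - 1) k) p volume := by
  have e : wavelet φ ψ ((a : ℤ) - 1) k =
      (cell A a k).indicator (wavelet φ ψ ((a : ℤ) - 1) k) := by
    ext x
    by_cases hx : x ∈ cell A a k
    · simp [hx]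
    · simp [hx, wavelet_eq_zero h a k hx]
  rw [e, memLp_indicator_iff_restrict (measurableSet_cell A a k)]
  have : IsFiniteMeasure (volume.restrict (cell A a k)) :=
    ⟨by rw [Measure.restrict_apply_univ, volume_cell]; exact ENNReal.ofReal_lt_top⟩
  exact MemLp.of_bound (measurable_wavelet h a k).aestronglyMeasurable (M * √(scale a))
    (Filter.Eventually.of_forall fun x => abs_wavelet_le h a k x)

end Wavelets

lemma card_le_of_abs_sub_le {T : Finset ℤ} {y B : ℝ} (hB : 0 ≤ B) (h : ∀ l ∈ T, |(l : ℝ) - y| ≤ B) :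
    (T.card : ℝ) ≤ 2 * B + 1 := by
  have hsub : T ⊆ Finset.Icc ⌈y - B⌉ ⌊y + B⌋ := by
    intro l hl
    have := abs_le.1 (h l hl)
    rw [Finset.mem_Icc, Int.ceil_le, Int.le_floor]
    constructor <;> linarith
  have hcard : (T.card : ℝ) ≤ ((⌊y + B⌋ + 1 - ⌈y - B⌉).toNat : ℝ) := by
    have := Finset.card_le_card hsub
    rw [Int.card_Icc] at this
    exact_mod_cast this
  have h1 : ((⌊y + B⌋ + 1 - ⌈y - B⌉).toNat : ℝ) = (((⌊y + B⌋ + 1 - ⌈y - B⌉) ⊔ 0 : ℤ) : ℝ) := by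
    rw [← Int.toNat_eq_max]; rfl
  rw [h1, Int.cast_max] at hcard
  refine hcard.trans (max_le ?_ (by push_cast; linarith))
  push_cast
  linarith [Int.floor_le (y + B), Int.le_ceil (y - B)]

/-! ### The upper Riesz bound for the reconstruction wavelets -/

section Hilbert

variable {ι H : Type*} [NormedAddCommGroup H] [InnerProductSpace ℝ H] {e : ι → H} {K : ℝ}

/-- The Schur test for a Gram matrix with bounded absolute row sums. -/
lemma norm_sum_smul_sq_le
    (hK : ∀ (i : ι) (t : Finset ι), ∑ l ∈ t, |inner ℝ (e i) (e l)| ≤ K) (b : ι → ℝ)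
    (t : Finset ι) : ‖∑ i ∈ t, b i • e i‖ ^ 2 ≤ K * ∑ i ∈ t, b i ^ 2 := by
  have h1 : ‖∑ i ∈ t, b i • e i‖ ^ 2 =
      ∑ i ∈ t, ∑ l ∈ t, b i * b l * inner ℝ (e i) (e l) := by
    rw [← real_inner_self_eq_norm_sq, sum_inner]
    refine Finset.sum_congr rfl fun i _ => ?_
    rw [inner_sum]
    refine Finset.sum_congr rfl fun l _ => ?_
    rw [real_inner_smul_left, real_inner_smul_right]; ring
  have h2 : ∀ i l, b i * b l * inner ℝ (e i) (e l) ≤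
      (b i ^ 2 / 2) * |inner ℝ (e i) (e l)| + (b l ^ 2 / 2) * |inner ℝ (e l) (e i)| := by
    intro i l
    rw [real_inner_comm (e i) (e l)]
    have h3 : b i * b l * inner ℝ (e i) (e l) ≤ |b i * b l| * |inner ℝ (e i) (e l)| := by
      rw [← abs_mul]; exact le_abs_self _
    have h4 : |b i * b l| ≤ b i ^ 2 / 2 + b l ^ 2 / 2 := by
      rw [abs_le]; constructor <;> nlinarith [sq_nonneg (b i - b l), sq_nonneg (b i + b l)]
    calc _ ≤ |b i * b l| * |inner ℝ (e i) (e l)| := h3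
      _ ≤ (b i ^ 2 / 2 + b l ^ 2 / 2) * |inner ℝ (e i) (e l)| := by gcongr
      _ = _ := by ring
  have h5 : ∑ i ∈ t, ∑ l ∈ t, (b i ^ 2 / 2) * |inner ℝ (e i) (e l)| ≤
      K / 2 * ∑ i ∈ t, b i ^ 2 := by
    rw [Finset.mul_sum]
    refine Finset.sum_le_sum fun i _ => ?_
    rw [← Finset.mul_sum]
    calc _ ≤ b i ^ 2 / 2 * K := by gcongr; exact hK i t
      _ = _ := by ring
  have h6 : ∑ i ∈ t, ∑ l ∈ t, (b l ^ 2 / 2) * |inner ℝ (e l) (e i)| =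
      ∑ i ∈ t, ∑ l ∈ t, (b i ^ 2 / 2) * |inner ℝ (e i) (e l)| := Finset.sum_comm
  rw [h1]
  calc _ ≤ ∑ i ∈ t, ∑ l ∈ t, ((b i ^ 2 / 2) * |inner ℝ (e i) (e l)| +
        (b l ^ 2 / 2) * |inner ℝ (e l) (e i)|) :=
        Finset.sum_le_sum fun i _ => Finset.sum_le_sum fun l _ => h2 i l
    _ ≤ _ := by
        simp_rw [Finset.sum_add_distrib]
        rw [h6]
        linarith

lemma exists_hasSum_smul [CompleteSpace H] (hK0 : 0 < K)
    (hK : ∀ (i : ι) (t : Finset ι), ∑ l ∈ t, |inner ℝ (e i) (e l)| ≤ K) {b : ι → ℝ}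
    (hb : Summable fun i => b i ^ 2) :
    ∃ g : H, HasSum (fun i => b i • e i) g ∧ ‖g‖ ^ 2 ≤ K * ∑' i, b i ^ 2 := by
  have hs : Summable fun i => b i • e i := by
    rw [summable_iff_vanishing_norm]
    intro ε hε
    obtain ⟨s, hs⟩ := (summable_iff_vanishing_norm.1 hb) (ε ^ 2 / K) (by positivity)
    refine ⟨s, fun t ht => ?_⟩
    have h1 := norm_sum_smul_sq_le hK b t
    have h2 := hs t ht
    rw [Real.norm_of_nonneg (Finset.sum_nonneg fun i _ => sq_nonneg _), lt_div_iff₀ hK0] at h2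
    exact lt_of_pow_lt_pow_left₀ 2 hε.le (by linarith)
  refine ⟨_, hs.hasSum, ?_⟩
  refine le_of_tendsto (hs.hasSum.norm.pow 2) (Filter.Eventually.of_forall fun t => ?_)
  refine (norm_sum_smul_sq_le hK b t).trans ?_
  gcongr
  exact hb.sum_le_tsum t fun i _ => sq_nonneg _

end Hilbert

/-- The reconstruction mother wavelet has mean zero, being orthogonal to all the integer
translates of the box function, which add up to the constant `1`. -/
lemma IsBiorthogonalWaveletBasis.integral_ψt (hΦ : IsBiorthogonalWaveletBasis r ψ φt ψt)
    (hc : Continuous ψt) : ∫ x, ψt x = 0 := by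
  have h1 : ∀ k : ℤ, ∫ x in (k : ℝ)..((k : ℝ) + 1), ψt x = 0 := by
    intro k
    have h := hΦ.biorthogonal (-1) 0 (by norm_num) (by norm_num) k 0
    rw [if_neg (by simp)] at h
    rw [intervalIntegral.integral_of_le (by linarith), ← integral_Icc_eq_integral_Ioc, ← h,
      ← integral_indicator measurableSet_Icc]
    congr 1
    ext x
    simp only [wavelet, box, if_true, Set.indicator_apply, Set.mem_Icc]
    have : (0 ≤ x - k ∧ x - k ≤ 1) ↔ ((k : ℝ) ≤ x ∧ x ≤ k + 1) := by
      constructor <;> rintro ⟨u, v⟩ <;> constructor <;> linarith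
    simp only [this]
    split_ifs <;> first | contradiction | simp
  obtain ⟨A, hA⟩ := exists_support_bound hΦ.compact_ψt
  obtain ⟨N, hN⟩ := exists_nat_gt A
  have h2 : ∫ x in (-(N : ℝ))..(N : ℝ), ψt x = 0 := by
    have := intervalIntegral.sum_integral_adjacent_intervals (μ := volume) (f := ψt)
      (a := fun i : ℕ => (i : ℝ) - N) (n := 2 * N) fun k _ => hc.intervalIntegrable _ _
    have e1 : ((2 * N : ℕ) : ℝ) - N = N := by push_cast; ring
    simp only [e1, Nat.cast_zero, zero_sub] at this
    rw [← this]
    refine Finset.sum_eq_zero fun i _ => ?_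
    have := h1 ((i : ℤ) - N)
    push_cast at this ⊢
    rw [← this]
    congr 1; ring
  rw [← h2, intervalIntegral.integral_of_le (by have := N.cast_nonneg (α := ℝ); linarith)]
  refine (setIntegral_eq_integral_of_forall_compl_eq_zero fun x hx => hA x ?_).symm
  by_contra! hcon
  have := abs_le.1 hcon
  exact hx ⟨by linarith, by linarith⟩

lemma integral_wavelet_eq_zero (hΦ : IsBiorthogonalWaveletBasis r ψ φt ψt) (hr : 0 < r) {b : ℕ}
    (hb : b ≠ 0) (l : ℤ) : ∫ x, wavelet φt ψt ((b : ℤ) - 1) l x = 0 := by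
  have h := hΦ.integral_ψt (hΦ.smooth_ψt.contDiff_one (by linarith)).continuous
  simp_rw [wavelet_eq, generator, if_neg hb]
  rw [integral_const_mul]
  have h1 := integral_sub_right_eq_self (fun x : ℝ => ψt x) (μ := volume) (l : ℝ)
  have h2 := Measure.integral_comp_mul_left (fun x => ψt (x - l)) (scale b)
  rw [h2, h1, h]
  simp

/-- The entry of the Gram matrix of the reconstruction wavelets at two levels `a ≤ b`. For `b = 0`
both scales are `1`; for `b > 0` the finer wavelet has mean zero, and the coarser one is
Lipschitz. -/
lemma abs_gram_le (hΦ : IsBiorthogonalWaveletBasis r ψ φt ψt) (hr : 0 < r) {A M Λ : ℝ}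
    (hA : 1 ≤ A) (hM : 0 < M) (hΛ : 0 ≤ Λ) (h : ∀ a, IsBump A M (generator φt ψt a))
    (hL : ∀ a x y, |generator φt ψt a x - generator φt ψt a y| ≤ Λ * |x - y|)
    {a b : ℕ} (hab : a ≤ b) (k l : ℤ) :
    |∫ x, wavelet φt ψt ((a : ℤ) - 1) k x * wavelet φt ψt ((b : ℤ) - 1) l x| ≤
      (2 * A * M ^ 2 + 2 * A ^ 2 * Λ * M) * (scale a / scale b * √(scale a / scale b)) := by
  have hSa := scale_pos a
  have hSb := scale_pos b
  have hvol : volume.real (cell A b l) = 2 * A / scale b := by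
    rw [measureReal_def, volume_cell, ENNReal.toReal_ofReal (by positivity)]
  have hfin : volume (cell A b l) < ∞ := by rw [volume_cell]; exact ENNReal.ofReal_lt_top
  -- a bound on the cell of the finer wavelet suffices
  have hset : ∀ (F : ℝ → ℝ) (D : ℝ), (∀ x ∉ cell A b l, F x = 0) →
      (∀ x ∈ cell A b l, |F x| ≤ D) → |∫ x, F x| ≤ D * (2 * A / scale b) := by
    intro F D h0 hD
    rw [← setIntegral_eq_integral_of_forall_compl_eq_zero h0, ← hvol]
    exact norm_setIntegral_le_of_norm_le_const (f := F) hfin hD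
  rcases Nat.eq_zero_or_pos b with rfl | hb
  · obtain rfl : a = 0 := by omega
    have := hset (fun x => wavelet φt ψt (((0 : ℕ) : ℤ) - 1) k x *
      wavelet φt ψt (((0 : ℕ) : ℤ) - 1) l x) (M * M)
      (fun x hx => by rw [wavelet_eq_zero h 0 l hx, mul_zero]) (fun x _ => by
        rw [abs_mul]
        have h1 := abs_wavelet_le h 0 k x
        have h2 := abs_wavelet_le h 0 l x
        rw [scale_zero, Real.sqrt_one, mul_one] at h1 h2
        gcongr)
    refine this.trans ?_
    rw [scale_zero]
    simp only [div_one, Real.sqrt_one, mul_one]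
    have : 0 ≤ 2 * A ^ 2 * Λ * M := by positivity
    nlinarith
  · set x₀ : ℝ := l / scale b with hx₀
    set u := wavelet φt ψt ((a : ℤ) - 1) k with hu
    set v := wavelet φt ψt ((b : ℤ) - 1) l with hv
    have hui : Integrable (fun x => u x * v x) :=
      (memLp_wavelet h a k 2).integrable_mul (memLp_wavelet h b l 2)
    have hvi : Integrable v := memLp_one_iff_integrable.1 (memLp_wavelet h b l 1)
    have heq : ∫ x, u x * v x = ∫ x, (u x - u x₀) * v x := by
      have : ∀ x, (u x - u x₀) * v x = u x * v x - u x₀ * v x := fun x => by ring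
      simp_rw [this]
      rw [integral_sub hui (hvi.const_mul _), integral_const_mul,
        integral_wavelet_eq_zero hΦ hr hb.ne', mul_zero, sub_zero]
    rw [heq]
    have hbd := hset (fun x => (u x - u x₀) * v x)
      (√(scale a) * (Λ * (scale a * (A / scale b))) * (M * √(scale b)))
      (fun x hx => by rw [hv, wavelet_eq_zero h b l hx, mul_zero]) (fun x hx => by
        rw [abs_mul]
        have h1 : |x - x₀| ≤ A / scale b := by
          rw [hx₀, le_div_iff₀ hSb, ← abs_of_pos hSb, ← abs_mul, abs_of_pos hSb]
          have : (x - l / scale b) * scale b = scale b * x - l := by field_simp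
          rw [this]
          exact mem_cell.1 hx
        have h2 : |u x - u x₀| ≤ √(scale a) * (Λ * (scale a * (A / scale b))) := by
          rw [hu, wavelet_eq, wavelet_eq, ← mul_sub, abs_mul, abs_of_nonneg (Real.sqrt_nonneg _)]
          gcongr
          refine (hL a _ _).trans ?_
          gcongr
          have : scale a * x - k - (scale a * x₀ - k) = scale a * (x - x₀) := by ring
          rw [this, abs_mul, abs_of_pos hSa]
          gcongr
        gcongr
        exact abs_wavelet_le h b l x)
    refine hbd.trans ?_
    have e1 : √(scale b) * √(scale b) = scale b := Real.mul_self_sqrt hSb.le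
    have e2 : √(scale a / scale b) = √(scale a) / √(scale b) := Real.sqrt_div hSa.le _
    have hsb : 0 < √(scale b) := Real.sqrt_pos.2 hSb
    have e3 : √(scale b) / scale b = 1 / √(scale b) := by
      rw [div_eq_div_iff hSb.ne' hsb.ne', e1, one_mul]
    calc _ = 2 * A ^ 2 * Λ * M * (scale a / scale b * (√(scale a) * (√(scale b) / scale b))) := by
          ring
      _ = 2 * A ^ 2 * Λ * M * (scale a / scale b * √(scale a / scale b)) := by
          rw [e3, e2]; ring
      _ ≤ _ := by
          gcongr
          have : 0 ≤ 2 * A * M ^ 2 := by positivity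
          linarith

lemma gram_eq_zero {A M : ℝ} (h : ∀ a, IsBump A M (generator φt ψt a)) (a b : ℕ) (k l : ℤ)
    (hkl : A * (1 + scale b / scale a) < |l - scale b / scale a * k|) :
    ∫ x, wavelet φt ψt ((a : ℤ) - 1) k x * wavelet φt ψt ((b : ℤ) - 1) l x = 0 := by
  have hSa := scale_pos a
  have hSb := scale_pos b
  rw [← integral_zero ℝ ℝ]
  congr 1; ext x
  by_cases h1 : x ∈ cell A a k
  · by_cases h2 : x ∈ cell A b l
    · exfalso
      rw [mem_cell] at h1 h2
      have h3 : (l : ℝ) - scale b / scale a * k =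
          scale b / scale a * (scale a * x - k) - (scale b * x - l) := by field_simp; ring
      have h4 : |(l : ℝ) - scale b / scale a * k| ≤ scale b / scale a * A + A := by
        rw [h3]
        refine (abs_sub _ _).trans ?_
        rw [abs_mul, abs_of_pos (by positivity : 0 < scale b / scale a)]
        gcongr
      linarith
    · rw [wavelet_eq_zero h b l h2, mul_zero]
  · rw [wavelet_eq_zero h a k h1, zero_mul]

lemma scale_div_scale_le {a b : ℕ} (hab : a ≤ b) :
    scale a / scale b ≤ 2 * (1 / 2) ^ (b - a) := by
  have h : (b - 1) + 1 ≥ (a - 1) + (b - a) := by omega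
  rw [scale, scale, div_le_iff₀ (by positivity), one_div, inv_pow]
  have h2 : (2 : ℝ) ^ ((a - 1) + (b - a)) ≤ 2 ^ ((b - 1) + 1) :=
    pow_le_pow_right₀ (by norm_num) h
  rw [pow_add, pow_succ] at h2
  have h3 : (0 : ℝ) < 2 ^ (b - a) := by positivity
  calc (2 : ℝ) ^ (a - 1) = 2 ^ (a - 1) * 2 ^ (b - a) / 2 ^ (b - a) := by field_simp
    _ ≤ 2 ^ (b - 1) * 2 / 2 ^ (b - a) := by gcongr
    _ = _ := by field_simp

lemma sqrt_scale_div_scale_le {a b : ℕ} (hab : a ≤ b) :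
    √(scale a / scale b) ≤ 2 * √(1 / 2) ^ (b - a) := by
  have h1 : √(2 * (1 / 2 : ℝ) ^ (b - a)) = √2 * √(1 / 2) ^ (b - a) := by
    have : (1 / 2 : ℝ) ^ (b - a) = (√(1 / 2) ^ (b - a)) ^ 2 := by
      rw [← pow_mul, mul_comm, pow_mul, Real.sq_sqrt (by norm_num)]
    rw [Real.sqrt_mul (by norm_num)]
    nth_rewrite 1 [this]
    rw [Real.sqrt_sq (by positivity)]
  calc _ ≤ √(2 * (1 / 2 : ℝ) ^ (b - a)) := Real.sqrt_le_sqrt (scale_div_scale_le hab)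
    _ = √2 * √(1 / 2) ^ (b - a) := h1
    _ ≤ _ := by
      gcongr
      rw [Real.sqrt_le_left (by norm_num)]; norm_num

/-- The part of a row of the Gram matrix which belongs to one level decays geometrically with the
distance of the levels. -/
lemma sum_abs_gram_level_le (hΦ : IsBiorthogonalWaveletBasis r ψ φt ψt) (hr : 0 < r) {A M Λ : ℝ}
    (hA : 1 ≤ A) (hM : 0 < M) (hΛ : 0 ≤ Λ) (h : ∀ a, IsBump A M (generator φt ψt a))
    (hL : ∀ a x y, |generator φt ψt a x - generator φt ψt a y| ≤ Λ * |x - y|)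
    (a b : ℕ) (k : ℤ) (T : Finset ℤ) :
    ∑ l ∈ T, |∫ x, wavelet φt ψt ((a : ℤ) - 1) k x * wavelet φt ψt ((b : ℤ) - 1) l x| ≤
      10 * A * (2 * A * M ^ 2 + 2 * A ^ 2 * Λ * M) * √(1 / 2) ^ ((b : ℤ) - a).natAbs := by
  have hSa := scale_pos a
  have hSb := scale_pos b
  set C := 2 * A * M ^ 2 + 2 * A ^ 2 * Λ * M with hC
  have hC0 : 0 ≤ C := by positivity
  set ρ := scale b / scale a with hρ
  have hρ0 : 0 < ρ := by positivity
  set T' := T.filter fun l : ℤ => |(l : ℝ) - ρ * k| ≤ A * (1 + ρ)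
  have hcard := card_le_of_abs_sub_le (T := T') (y := ρ * k) (B := A * (1 + ρ)) (by positivity)
    fun l hl => (Finset.mem_filter.1 hl).2
  have hzero : ∀ l ∈ T, l ∉ T' →
      |∫ x, wavelet φt ψt ((a : ℤ) - 1) k x * wavelet φt ψt ((b : ℤ) - 1) l x| = 0 := by
    intro l hl hl'
    rw [gram_eq_zero h a b k l ?_, abs_zero]
    by_contra! hcon
    exact hl' (Finset.mem_filter.2 ⟨hl, hcon⟩)
  rw [← Finset.sum_subset (Finset.filter_subset _ T) hzero]
  have hconst : ∀ D : ℝ, (∀ l, |∫ x, wavelet φt ψt ((a : ℤ) - 1) k x *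
      wavelet φt ψt ((b : ℤ) - 1) l x| ≤ D) →
      ∑ l ∈ T', |∫ x, wavelet φt ψt ((a : ℤ) - 1) k x * wavelet φt ψt ((b : ℤ) - 1) l x| ≤
        (2 * (A * (1 + ρ)) + 1) * D := by
    intro D hD
    have hD0 : 0 ≤ D := (abs_nonneg _).trans (hD 0)
    calc _ ≤ ∑ _l ∈ T', D := Finset.sum_le_sum fun l _ => hD l
      _ = T'.card * D := by simp
      _ ≤ _ := by gcongr
  -- a finer level has about `ρ` times more wavelets which meet a given one, but each entry is of the
  -- order of `ρ^{-3/2}`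
  rcases le_total a b with hab | hab
  · have e : ((b : ℤ) - a).natAbs = b - a := by omega
    have hρ1 : 1 ≤ ρ := by
      rw [hρ, le_div_iff₀ hSa, one_mul]
      exact pow_le_pow_right₀ (by norm_num) (by omega)
    rw [e]
    refine (hconst _ fun l => abs_gram_le hΦ hr hA hM hΛ h hL hab k l).trans ?_
    have e2 : scale a / scale b = ρ⁻¹ := by rw [hρ, inv_div]
    have hs := sqrt_scale_div_scale_le hab
    calc (2 * (A * (1 + ρ)) + 1) * (C * (scale a / scale b * √(scale a / scale b)))
        ≤ (5 * A * ρ) * (C * (scale a / scale b * √(scale a / scale b))) := by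
          gcongr
          nlinarith
      _ = 5 * A * C * √(scale a / scale b) := by rw [e2]; field_simp
      _ ≤ 5 * A * C * (2 * √(1 / 2) ^ (b - a)) := by gcongr
      _ = _ := by ring
  · have e : ((b : ℤ) - a).natAbs = a - b := by omega
    have hρ1 : ρ ≤ 1 := by
      rw [hρ, div_le_one hSa]
      exact pow_le_pow_right₀ (by norm_num) (by omega)
    rw [e]
    refine (hconst (C * (ρ * √ρ)) fun l => ?_).trans ?_
    · have := abs_gram_le hΦ hr hA hM hΛ h hL hab l k
      simp_rw [mul_comm (wavelet φt ψt ((a : ℤ) - 1) k _)]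
      exact this
    have hs := sqrt_scale_div_scale_le hab
    calc (2 * (A * (1 + ρ)) + 1) * (C * (ρ * √ρ))
        ≤ (5 * A) * (C * (1 * √ρ)) := by
          gcongr
          nlinarith
      _ = 5 * A * C * √ρ := by ring
      _ ≤ 5 * A * C * (2 * √(1 / 2) ^ (a - b)) := by gcongr
      _ = _ := by ring

lemma summable_pow_natAbs {s : ℝ} (h0 : 0 ≤ s) (h1 : s < 1) :
    Summable fun d : ℤ => s ^ d.natAbs := by
  refine Summable.of_nat_of_neg ?_ ?_
  · simpa using summable_geometric_of_lt_one h0 h1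
  · simpa using summable_geometric_of_lt_one h0 h1

/-- The absolute row sums of the Gram matrix of the reconstruction wavelets are bounded. -/
lemma exists_sum_abs_gram_le (hΦ : IsBiorthogonalWaveletBasis r ψ φt ψt) (hr : 0 < r) :
    ∃ K : ℝ, 0 < K ∧ ∀ (i : ℕ × ℤ) (t : Finset (ℕ × ℤ)),
      ∑ l ∈ t, |∫ x, wavelet φt ψt ((i.1 : ℤ) - 1) i.2 x *
        wavelet φt ψt ((l.1 : ℤ) - 1) l.2 x| ≤ K := by
  obtain ⟨A, M, Λ, hA, hM, hΛ, -, h, hL⟩ := hΦ.exists_bounds hr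
  have hs1 : √(1 / 2 : ℝ) < 1 := by
    rw [Real.sqrt_lt' (by norm_num)]; norm_num
  have hsum := summable_pow_natAbs (Real.sqrt_nonneg (1 / 2)) hs1
  set C := 10 * A * (2 * A * M ^ 2 + 2 * A ^ 2 * Λ * M) with hC
  have hC0 : 0 ≤ C := by positivity
  have hS0 : 0 ≤ ∑' d : ℤ, √(1 / 2 : ℝ) ^ d.natAbs := tsum_nonneg fun d => by positivity
  refine ⟨C * ∑' d : ℤ, √(1 / 2 : ℝ) ^ d.natAbs + 1, by positivity, ?_⟩
  rintro ⟨a, k⟩ t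
  classical
  have hsub : t ⊆ t.image Prod.fst ×ˢ t.image Prod.snd := Finset.subset_product
  calc _ ≤ ∑ l ∈ t.image Prod.fst ×ˢ t.image Prod.snd,
          |∫ x, wavelet φt ψt ((a : ℤ) - 1) k x * wavelet φt ψt ((l.1 : ℤ) - 1) l.2 x| :=
        Finset.sum_le_sum_of_subset_of_nonneg hsub fun _ _ _ => abs_nonneg _
    _ ≤ ∑ b ∈ t.image Prod.fst, C * √(1 / 2) ^ ((b : ℤ) - a).natAbs := by
        rw [Finset.sum_product]
        exact Finset.sum_le_sum fun b _ => sum_abs_gram_level_le hΦ hr hA hM hΛ h hL a b k _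
    _ = C * ∑ d ∈ (t.image Prod.fst).image (fun b : ℕ => (b : ℤ) - a), √(1 / 2) ^ d.natAbs := by
        rw [← Finset.mul_sum, Finset.sum_image (g := fun b : ℕ => (b : ℤ) - a)]
        intro b _ b' _ hbb
        simpa using hbb
    _ ≤ C * ∑' d : ℤ, √(1 / 2 : ℝ) ^ d.natAbs := by
        gcongr
        exact hsum.sum_le_tsum _ fun d _ => by positivity
    _ ≤ _ := by linarith

lemma inner_toLp {f g : ℝ → ℝ} (hf : MemLp f 2 volume) (hg : MemLp g 2 volume) :
    inner ℝ (hf.toLp f) (hg.toLp g) = ∫ x, f x * g x := by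
  rw [L2.inner_def]
  refine integral_congr_ae ?_
  filter_upwards [hf.coeFn_toLp, hg.coeFn_toLp] with x h1 h2
  rw [h1, h2]
  simp [mul_comm]

lemma ofReal_norm_toLp_sq {f : ℝ → ℝ} (hf : MemLp f 2 volume) :
    ENNReal.ofReal (‖hf.toLp f‖ ^ 2) = ∫⁻ x, ENNReal.ofReal (f x ^ 2) := by
  rw [← real_inner_self_eq_norm_sq, inner_toLp hf hf]
  simp_rw [← sq]
  exact ofReal_integral_eq_lintegral_ofReal hf.integrable_sq
    (Filter.Eventually.of_forall fun x => sq_nonneg _)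

/-- The squared norm of a function is controlled by its coefficients: the series of the
reconstruction wavelets with these coefficients converges, by the upper Riesz bound, and its sum is
the function itself, by completeness. -/
theorem exists_lintegral_sq_le_coeff (hΦ : IsBiorthogonalWaveletBasis r ψ φt ψt) (hr : 0 < r) :
    ∃ K : ℝ, 0 < K ∧ ∀ h : ℝ → ℝ, MemLp h 2 volume →
      ∫⁻ x, ENNReal.ofReal (h x ^ 2) ≤
        ENNReal.ofReal K * ∑' (a : ℕ) (k : ℤ), ENNReal.ofReal (coeff ψ h ((a : ℤ) - 1) k ^ 2) := by
  obtain ⟨K, hK, hgram⟩ := exists_sum_abs_gram_le hΦ hr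
  obtain ⟨A, M, Λ, -, -, -, hdec, hrec, -⟩ := hΦ.exists_bounds hr
  refine ⟨K, hK, fun h hh => ?_⟩
  set b : ℕ × ℤ → ℝ := fun i => coeff ψ h ((i.1 : ℤ) - 1) i.2 with hb
  rw [← ENNReal.tsum_prod (f := fun (a : ℕ) (k : ℤ) =>
    ENNReal.ofReal (coeff ψ h ((a : ℤ) - 1) k ^ 2))]
  by_cases htop : ∑' i : ℕ × ℤ, ENNReal.ofReal (b i ^ 2) = ∞
  · have : ∑' i : ℕ × ℤ, ENNReal.ofReal (coeff ψ h ((i.1 : ℤ) - 1) i.2 ^ 2) = ∞ := htop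
    rw [this, ENNReal.mul_top (by simpa using hK)]
    exact le_top
  have hsum : Summable fun i => b i ^ 2 := by
    have := ENNReal.summable_toReal htop
    refine this.congr fun i => ?_
    rw [ENNReal.toReal_ofReal (sq_nonneg _)]
  have hmem : ∀ i : ℕ × ℤ, MemLp (wavelet φt ψt ((i.1 : ℤ) - 1) i.2) 2 volume :=
    fun i => memLp_wavelet hrec i.1 i.2 2
  have hmem' : ∀ i : ℕ × ℤ, MemLp (wavelet box ψ ((i.1 : ℤ) - 1) i.2) 2 volume :=
    fun i => memLp_wavelet hdec i.1 i.2 2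
  obtain ⟨g, hg, hgn⟩ := exists_hasSum_smul (e := fun i : ℕ × ℤ => (hmem i).toLp _) hK
    (fun i t => by simp_rw [inner_toLp]; exact hgram i t) hsum
  have hgL : MemLp g 2 volume := Lp.memLp g
  have hcoef : ∀ i : ℕ × ℤ, ∫ x, wavelet box ψ ((i.1 : ℤ) - 1) i.2 x * g x = b i := by
    intro i
    have h1 := hg.mapL (innerSL ℝ ((hmem' i).toLp _))
    simp only [innerSL_apply_apply, real_inner_smul_right, inner_toLp] at h1
    have h2 : HasSum (fun l : ℕ × ℤ => b l * ∫ x, wavelet box ψ ((i.1 : ℤ) - 1) i.2 x *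
        wavelet φt ψt ((l.1 : ℤ) - 1) l.2 x) (b i) := by
      have e : ∀ l : ℕ × ℤ, b l * ∫ x, wavelet box ψ ((i.1 : ℤ) - 1) i.2 x *
          wavelet φt ψt ((l.1 : ℤ) - 1) l.2 x = if l = i then b i else 0 := by
        intro l
        rw [hΦ.biorthogonal _ _ (by omega) (by omega)]
        by_cases hl : l = i
        · simp [hl]
        · rw [if_neg, if_neg hl, mul_zero]
          rintro ⟨h1, h2⟩
          exact hl (Prod.ext (by omega) h2.symm)
      simp_rw [e]
      exact hasSum_ite_eq i (b i)
    have h3 := h1.unique h2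
    rw [← h3]
    have := inner_toLp (hmem' i) hgL
    rw [Lp.toLp_coeFn] at this
    exact this.symm
  have hzero : (fun x => h x - g x) =ᵐ[volume] 0 := by
    refine hΦ.complete _ (hh.sub hgL) fun j hj k => ?_
    obtain ⟨a, rfl⟩ : ∃ a : ℕ, j = (a : ℤ) - 1 := ⟨(j + 1).toNat, by omega⟩
    have h1 : Integrable fun x => wavelet box ψ ((a : ℤ) - 1) k x * h x :=
      (hmem' (a, k)).integrable_mul hh
    have h2 : Integrable fun x => wavelet box ψ ((a : ℤ) - 1) k x * g x :=
      (hmem' (a, k)).integrable_mul hgL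
    simp_rw [mul_sub]
    rw [integral_sub h1 h2, hcoef (a, k)]
    exact sub_self _
  have heq : ∫⁻ x, ENNReal.ofReal (h x ^ 2) = ∫⁻ x, ENNReal.ofReal (g x ^ 2) := by
    refine lintegral_congr_ae ?_
    filter_upwards [hzero] with x hx
    have : h x = g x := sub_eq_zero.1 hx
    rw [this]
  rw [heq, ← ofReal_norm_toLp_sq hgL, Lp.toLp_coeFn]
  calc ENNReal.ofReal (‖g‖ ^ 2) ≤ ENNReal.ofReal (K * ∑' i, b i ^ 2) := ENNReal.ofReal_le_ofReal hgn
    _ = _ := by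
      rw [ENNReal.ofReal_mul hK.le, ENNReal.ofReal_tsum_of_nonneg (fun i => sq_nonneg _) hsum]

/-! ### From the coefficients to the risk of the estimator -/

lemma threshCoeff_eq (ψ : ℝ → ℝ) (γ : ℝ) {n : ℕ} (X : Fin n → ℝ) (j k : ℤ) :
    threshCoeff ψ γ X j k =
      sampleThresholded γ (supNorm (wavelet box ψ j k)) (fun i => wavelet box ψ j k (X i)) := rfl

section

variable {A M : ℝ}

lemma abs_wavelet_le_supNorm (h : ∀ a, IsBump A M (generator box ψ a)) (a : ℕ) (k : ℤ) (x : ℝ) :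
    |wavelet box ψ ((a : ℤ) - 1) k x| ≤ supNorm (wavelet box ψ ((a : ℤ) - 1) k) :=
  le_ciSup (f := fun x => |wavelet box ψ ((a : ℤ) - 1) k x|)
    ⟨M * √(scale a), by rintro _ ⟨y, rfl⟩; exact abs_wavelet_le h a k y⟩ x

lemma supNorm_wavelet_le (h : ∀ a, IsBump A M (generator box ψ a)) (a : ℕ) (k : ℤ) :
    supNorm (wavelet box ψ ((a : ℤ) - 1) k) ≤ M * √(scale a) :=
  ciSup_le fun x => abs_wavelet_le h a k x

/-- Only the wavelets which meet the sample have a nonzero empirical coefficient. -/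
lemma finite_setOf_threshCoeff_ne_zero (h : ∀ a, IsBump A M (generator box ψ a)) (γ : ℝ) {n : ℕ}
    (X : Fin n → ℝ) (a : ℕ) : {k : ℤ | threshCoeff ψ γ X ((a : ℤ) - 1) k ≠ 0}.Finite := by
  have hfin : (⋃ i : Fin n, (Set.Icc ⌈scale a * X i - A⌉ ⌊scale a * X i + A⌋ : Set ℤ)).Finite :=
    Set.finite_iUnion fun i => Set.finite_Icc _ _
  refine hfin.subset fun k hk => ?_
  by_contra hcon
  refine hk ?_
  have hz : ∀ i, wavelet box ψ ((a : ℤ) - 1) k (X i) = 0 := by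
    intro i
    refine wavelet_eq_zero h a k fun hx => hcon (Set.mem_iUnion.2 ⟨i, ?_⟩)
    have := abs_le.1 (mem_cell.1 hx)
    rw [Set.mem_Icc, Int.ceil_le, Int.le_floor]
    constructor <;> linarith
  rw [threshCoeff, empCoeff]
  simp [hz]

/-- The estimator is a finite linear combination of reconstruction wavelets. -/
lemma exists_estimator_eq_sum (h : ∀ a, IsBump A M (generator box ψ a)) (φt ψt : ℝ → ℝ)
    (c c' γ : ℝ) {n : ℕ} (X : Fin n → ℝ) :
    ∃ T : Finset ℤ, (∀ a : ℕ, (a : ℤ) - 1 ≤ maxLevel c c' n → ∀ k ∉ T,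
        threshCoeff ψ γ X ((a : ℤ) - 1) k = 0) ∧
      ∀ x, estimator ψ φt ψt c c' γ X x = ∑ j ∈ Finset.Icc (-1) (maxLevel c c' n),
        ∑ k ∈ T, threshCoeff ψ γ X j k * wavelet φt ψt j k x := by
  classical
  set T : Finset ℤ := (Finset.range (maxLevel c c' n + 2).toNat).biUnion fun a =>
    (finite_setOf_threshCoeff_ne_zero h γ X a).toFinset
  have hT : ∀ a : ℕ, (a : ℤ) - 1 ≤ maxLevel c c' n → ∀ k ∉ T,
      threshCoeff ψ γ X ((a : ℤ) - 1) k = 0 := by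
    intro a ha k hk
    by_contra hne
    refine hk (Finset.mem_biUnion.2 ⟨a, Finset.mem_range.2 (by omega), ?_⟩)
    simpa using hne
  refine ⟨T, hT, fun x => ?_⟩
  rw [estimator]
  refine Finset.sum_congr rfl fun j hj => ?_
  rw [Finset.mem_Icc] at hj
  obtain ⟨a, rfl⟩ : ∃ a : ℕ, j = (a : ℤ) - 1 := ⟨(j + 1).toNat, by omega⟩
  exact tsum_eq_sum fun k hk => by rw [hT a hj.2 k hk, zero_mul]

end

lemma memLp_estimator (hΦ : IsBiorthogonalWaveletBasis r ψ φt ψt) (hr : 0 < r) (c c' γ : ℝ) {n : ℕ}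
    (X : Fin n → ℝ) : MemLp (estimator ψ φt ψt c c' γ X) 2 volume := by
  obtain ⟨A, M, Λ, -, -, -, hdec, hrec, -⟩ := hΦ.exists_bounds hr
  obtain ⟨T, -, hT⟩ := exists_estimator_eq_sum hdec φt ψt c c' γ X
  have : estimator ψ φt ψt c c' γ X = fun x => ∑ j ∈ Finset.Icc (-1) (maxLevel c c' n),
      ∑ k ∈ T, threshCoeff ψ γ X j k * wavelet φt ψt j k x := funext hT
  rw [this]
  refine memLp_finsetSum _ fun j hj => memLp_finsetSum _ fun k _ => ?_
  rw [Finset.mem_Icc] at hj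
  obtain ⟨a, rfl⟩ : ∃ a : ℕ, j = (a : ℤ) - 1 := ⟨(j + 1).toNat, by omega⟩
  exact (memLp_wavelet hrec a k 2).const_mul _

lemma coeff_estimator (hΦ : IsBiorthogonalWaveletBasis r ψ φt ψt) (hr : 0 < r) (c c' γ : ℝ) {n : ℕ}
    (X : Fin n → ℝ) (a : ℕ) (k : ℤ) :
    coeff ψ (estimator ψ φt ψt c c' γ X) ((a : ℤ) - 1) k =
      if (a : ℤ) - 1 ≤ maxLevel c c' n then threshCoeff ψ γ X ((a : ℤ) - 1) k else 0 := by
  obtain ⟨A, M, Λ, -, -, -, hdec, hrec, -⟩ := hΦ.exists_bounds hr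
  obtain ⟨T, hT0, hT⟩ := exists_estimator_eq_sum hdec φt ψt c c' γ X
  have hint : ∀ j ∈ Finset.Icc (-1) (maxLevel c c' n), ∀ l ∈ T,
      Integrable fun x => threshCoeff ψ γ X j l *
        (wavelet box ψ ((a : ℤ) - 1) k x * wavelet φt ψt j l x) := by
    intro j hj l _
    rw [Finset.mem_Icc] at hj
    obtain ⟨b, rfl⟩ : ∃ b : ℕ, j = (b : ℤ) - 1 := ⟨(j + 1).toNat, by omega⟩
    exact ((memLp_wavelet hdec a k 2).integrable_mul (memLp_wavelet hrec b l 2)).const_mul _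
  have hexp : ∀ x, wavelet box ψ ((a : ℤ) - 1) k x * estimator ψ φt ψt c c' γ X x =
      ∑ j ∈ Finset.Icc (-1) (maxLevel c c' n), ∑ l ∈ T, threshCoeff ψ γ X j l *
        (wavelet box ψ ((a : ℤ) - 1) k x * wavelet φt ψt j l x) := by
    intro x
    rw [hT, Finset.mul_sum]
    refine Finset.sum_congr rfl fun j _ => ?_
    rw [Finset.mul_sum]
    exact Finset.sum_congr rfl fun l _ => by ring
  rw [coeff]
  simp_rw [hexp]
  rw [integral_finsetSum _ fun j hj => integrable_finsetSum _ fun l hl => hint j hj l hl]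
  have hterm : ∀ j ∈ Finset.Icc (-1) (maxLevel c c' n), ∀ l ∈ T,
      ∫ x, threshCoeff ψ γ X j l * (wavelet box ψ ((a : ℤ) - 1) k x * wavelet φt ψt j l x) =
        if (a : ℤ) - 1 = j then (if k = l then threshCoeff ψ γ X j l else 0) else 0 := by
    intro j hj l _
    rw [Finset.mem_Icc] at hj
    rw [integral_const_mul, hΦ.biorthogonal _ _ (by omega) hj.1]
    by_cases h1 : (a : ℤ) - 1 = j <;> by_cases h2 : k = l <;> simp [h1, h2]
  have hsum : ∀ j ∈ Finset.Icc (-1) (maxLevel c c' n),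
      ∫ x, ∑ l ∈ T, threshCoeff ψ γ X j l *
        (wavelet box ψ ((a : ℤ) - 1) k x * wavelet φt ψt j l x) =
      if (a : ℤ) - 1 = j then threshCoeff ψ γ X j k else 0 := by
    intro j hj
    rw [integral_finsetSum _ fun l hl => hint j hj l hl, Finset.sum_congr rfl (hterm j hj)]
    split_ifs with h1
    · rw [Finset.sum_ite_eq]
      split_ifs with h2
      · rfl
      · rw [Finset.mem_Icc] at hj
        subst h1
        exact (hT0 a hj.2 k h2).symm
    · simp
  rw [Finset.sum_congr rfl hsum, Finset.sum_ite_eq]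
  have : (a : ℤ) - 1 ∈ Finset.Icc (-1) (maxLevel c c' n) ↔ (a : ℤ) - 1 ≤ maxLevel c c' n := by
    rw [Finset.mem_Icc]; omega
  simp only [this]

lemma coeff_sub (hΦ : IsBiorthogonalWaveletBasis r ψ φt ψt) (hr : 0 < r) {g f : ℝ → ℝ}
    (hg : MemLp g 2 volume) (hf : MemLp f 2 volume) (a : ℕ) (k : ℤ) :
    coeff ψ (fun x => g x - f x) ((a : ℤ) - 1) k =
      coeff ψ g ((a : ℤ) - 1) k - coeff ψ f ((a : ℤ) - 1) k := by
  obtain ⟨A, M, Λ, -, -, -, hdec, -, -⟩ := hΦ.exists_bounds hr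
  have h1 : Integrable fun x => wavelet box ψ ((a : ℤ) - 1) k x * g x :=
    (memLp_wavelet hdec a k 2).integrable_mul hg
  have h2 : Integrable fun x => wavelet box ψ ((a : ℤ) - 1) k x * f x :=
    (memLp_wavelet hdec a k 2).integrable_mul hf
  simp_rw [coeff, mul_sub]
  exact integral_sub h1 h2

/-- The law with density `f`. -/
def law (f : ℝ → ℝ) : Measure ℝ := volume.withDensity fun x => ENNReal.ofReal (f x)

lemma IsDensity.isProbabilityMeasure {f : ℝ → ℝ} (hf : IsDensity f) :
    IsProbabilityMeasure (law f) := by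
  obtain ⟨h0, hi, h1⟩ := hf
  refine ⟨?_⟩
  rw [law, withDensity_apply _ MeasurableSet.univ, Measure.restrict_univ,
    ← ofReal_integral_eq_lintegral_ofReal hi h0, h1, ENNReal.ofReal_one]

lemma IsDensity.integral_law {f : ℝ → ℝ} (hf : IsDensity f) (g : ℝ → ℝ) :
    ∫ x, g x ∂(law f) = ∫ x, g x * f x := by
  obtain ⟨h0, hi, -⟩ := hf
  rw [law, integral_withDensity_eq_integral_toReal_smul₀ hi.aemeasurable.ennreal_ofReal
    (Filter.Eventually.of_forall fun x => ENNReal.ofReal_lt_top)]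
  refine integral_congr_ae ?_
  filter_upwards [h0] with x hx
  rw [ENNReal.toReal_ofReal hx, smul_eq_mul, mul_comm]

lemma IsDensity.integral_wavelet {f : ℝ → ℝ} (hf : IsDensity f) (j k : ℤ) :
    ∫ x, wavelet box ψ j k x ∂(law f) = coeff ψ f j k := hf.integral_law _

lemma abs_sampleThresholded_le {n : ℕ} (hn : 2 ≤ n) {y : Fin n → ℝ} {b : ℝ} (γ : ℝ)
    (hy : ∀ i, |y i| ≤ b) : |sampleThresholded γ b y| ≤ 2 * b := by
  have hb : 0 ≤ b := (abs_nonneg _).trans (hy ⟨0, by omega⟩)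
  rw [sampleThresholded]
  split_ifs
  · simpa using abs_sampleMean_sub_le (a := 0) hn hy (by simpa using hb)
  · simpa using hb

/-- The part of the risk due to the coefficients of the level `a`, up to a constant: the first case
is that of the levels used by the estimator. -/
def levelRisk (ψ : ℝ → ℝ) (A c : ℝ) (J : ℤ) (n : ℕ) (f : ℝ → ℝ) (a : ℕ) : ℝ≥0∞ :=
  if (a : ℤ) - 1 ≤ J then
    ∑' k : ℤ, ENNReal.ofReal (min (coeff ψ f ((a : ℤ) - 1) k ^ 2)
      (Real.log n / n * ∫ x, wavelet box ψ ((a : ℤ) - 1) k x ^ 2 ∂(law f) +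
        scale a * (Real.log n / n) ^ 2) +
      scale a * (law f).real (cell A a k) * (Real.log n / n) * (n : ℝ) ^ (-c))
  else ∑' k : ℤ, ENNReal.ofReal (coeff ψ f ((a : ℤ) - 1) k ^ 2)

/-- The error on one coefficient, in terms of the scale and the cell of the wavelet. -/
lemma exists_lintegral_threshCoeff_le {γ c A M : ℝ} (hc : 1 ≤ c) (hcγ : c < γ)
    (hdec : ∀ a, IsBump A M (generator box ψ a)) :
    ∃ C : ℝ, 0 < C ∧ ∀ n : ℕ, 2 ≤ n → ∀ f : ℝ → ℝ, IsDensity f → ∀ (a : ℕ) (k : ℤ),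
      ∫⁻ X : Fin n → ℝ, ENNReal.ofReal ((threshCoeff ψ γ X ((a : ℤ) - 1) k -
          coeff ψ f ((a : ℤ) - 1) k) ^ 2) ∂(Measure.pi fun _ => law f) ≤
        ENNReal.ofReal C *
          ENNReal.ofReal (min (coeff ψ f ((a : ℤ) - 1) k ^ 2)
            (Real.log n / n * ∫ x, wavelet box ψ ((a : ℤ) - 1) k x ^ 2 ∂(law f) +
              scale a * (Real.log n / n) ^ 2) +
            scale a * (law f).real (cell A a k) * (Real.log n / n) * (n : ℝ) ^ (-c)) := by
  obtain ⟨C, hC, hrisk⟩ := exists_coeff_risk_le hc hcγ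
  refine ⟨C * (1 + M ^ 2), by positivity, fun n hn f hf a k => ?_⟩
  have := hf.isProbabilityMeasure
  have hw := measurable_wavelet hdec a k
  have hb := abs_wavelet_le_supNorm hdec a k
  have hb2 : supNorm (wavelet box ψ ((a : ℤ) - 1) k) ^ 2 ≤ M ^ 2 * scale a := by
    have h0 : 0 ≤ supNorm (wavelet box ψ ((a : ℤ) - 1) k) := (abs_nonneg _).trans (hb 0)
    calc _ ≤ (M * √(scale a)) ^ 2 := by gcongr; exact supNorm_wavelet_le hdec a k
      _ = _ := by rw [mul_pow, Real.sq_sqrt (scale_pos a).le]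
  have hL := log_div_pos hn
  have hS := scale_pos a
  have hmain := hrisk (μ := law f) hn hw hb (measurableSet_cell A a k)
    (fun x hx => wavelet_eq_zero hdec a k hx)
  rw [hf.integral_wavelet] at hmain
  set w := wavelet box ψ ((a : ℤ) - 1) k
  set β := coeff ψ f ((a : ℤ) - 1) k
  have hW : 0 ≤ ∫ x, w x ^ 2 ∂(law f) := integral_nonneg fun _ => sq_nonneg _
  have hmeas : Measurable fun X : Fin n → ℝ =>
      (sampleThresholded γ (supNorm w) (fun i => w (X i)) - β) ^ 2 :=
    (((measurable_sampleThresholded γ (supNorm w)).comp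
      (f := fun (X : Fin n → ℝ) i => w (X i)) (by fun_prop)).sub_const β).pow_const 2
  have hint : Integrable (fun X : Fin n → ℝ =>
      (sampleThresholded γ (supNorm w) (fun i => w (X i)) - β) ^ 2)
      (Measure.pi fun _ => law f) := by
    refine integrable_of_abs_le (B := (2 * supNorm w + |β|) ^ 2) hmeas fun X => ?_
    rw [abs_pow]
    gcongr
    exact (abs_sub _ _).trans (add_le_add_left
      (abs_sampleThresholded_le hn γ fun i => hb (X i)) _)
  simp_rw [threshCoeff_eq]
  rw [← ofReal_integral_eq_lintegral_ofReal hint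
    (Filter.Eventually.of_forall fun _ => sq_nonneg _), ← ENNReal.ofReal_mul (by positivity)]
  refine ENNReal.ofReal_le_ofReal (hmain.trans ?_)
  set L := Real.log n / n
  have hF : 0 ≤ (law f).real (cell A a k) := measureReal_nonneg
  have h1 : min (β ^ 2) (L * ∫ x, w x ^ 2 ∂(law f) + supNorm w ^ 2 * L ^ 2) ≤
      (1 + M ^ 2) * min (β ^ 2) (L * ∫ x, w x ^ 2 ∂(law f) + scale a * L ^ 2) := by
    rw [mul_min_of_nonneg _ _ (by positivity)]
    refine min_le_min ?_ ?_
    · exact le_mul_of_one_le_left (sq_nonneg _) (by nlinarith)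
    · have e1 : 0 ≤ L * ∫ x, w x ^ 2 ∂(law f) := by positivity
      have e2 : supNorm w ^ 2 * L ^ 2 ≤ M ^ 2 * scale a * L ^ 2 := by gcongr
      have e3 : 0 ≤ scale a * L ^ 2 := by positivity
      have e4 : 0 ≤ M ^ 2 * (L * ∫ x, w x ^ 2 ∂(law f)) := by positivity
      linarith
  have h2 : supNorm w ^ 2 * (law f).real (cell A a k) * L * (n : ℝ) ^ (-c) ≤
      (1 + M ^ 2) * (scale a * (law f).real (cell A a k) * L * (n : ℝ) ^ (-c)) := by
    calc _ ≤ M ^ 2 * scale a * (law f).real (cell A a k) * L * (n : ℝ) ^ (-c) := by gcongr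
      _ ≤ (1 + M ^ 2) * scale a * (law f).real (cell A a k) * L * (n : ℝ) ^ (-c) := by
          gcongr; linarith
      _ = _ := by ring
  calc _ ≤ C * ((1 + M ^ 2) * min (β ^ 2) (L * ∫ x, w x ^ 2 ∂(law f) + scale a * L ^ 2) +
        (1 + M ^ 2) * (scale a * (law f).real (cell A a k) * L * (n : ℝ) ^ (-c))) := by
        gcongr
    _ = _ := by ring

/-- The risk of the estimator is controlled level by level. -/
theorem exists_risk_le (hΦ : IsBiorthogonalWaveletBasis r ψ φt ψt) (hr : 0 < r) {A M : ℝ}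
    (hdec : ∀ a, IsBump A M (generator box ψ a)) {γ c : ℝ} (hc : 1 ≤ c)
    (hcγ : c < γ) (c' : ℝ) :
    ∃ C : ℝ, 0 < C ∧ ∀ n : ℕ, 2 ≤ n → ∀ f : ℝ → ℝ, IsDensity f → MemLp f 2 volume →
      risk (n := n) (estimator ψ φt ψt c c' γ) f ≤
        ENNReal.ofReal C * ∑' a : ℕ, levelRisk ψ A c (maxLevel c c' n) n f a := by
  obtain ⟨K, hK, hnorm⟩ := exists_lintegral_sq_le_coeff hΦ hr
  obtain ⟨C, hC, hrisk⟩ := exists_lintegral_threshCoeff_le hc hcγ hdec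
  refine ⟨K * (1 + C), by positivity, fun n hn f hf hf2 => ?_⟩
  have := hf.isProbabilityMeasure
  set D := 1 + C
  set err : ℕ → ℤ → (Fin n → ℝ) → ℝ≥0∞ := fun a k X =>
    ENNReal.ofReal (((if (a : ℤ) - 1 ≤ maxLevel c c' n then threshCoeff ψ γ X ((a : ℤ) - 1) k
      else 0) - coeff ψ f ((a : ℤ) - 1) k) ^ 2) with herr
  have herrm : ∀ a k, Measurable (err a k) := by
    intro a k
    have hw := measurable_wavelet hdec a k
    have hm : Measurable fun X : Fin n → ℝ => threshCoeff ψ γ X ((a : ℤ) - 1) k :=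
      (measurable_sampleThresholded γ _).comp
        (f := fun (X : Fin n → ℝ) i => wavelet box ψ ((a : ℤ) - 1) k (X i)) (by fun_prop)
    simp only [herr]
    split_ifs <;> fun_prop
  have hlev : ∀ a, ∑' k : ℤ, ∫⁻ X, err a k X ∂(Measure.pi fun _ : Fin n => law f) ≤
      ENNReal.ofReal D * levelRisk ψ A c (maxLevel c c' n) n f a := by
    intro a
    rw [levelRisk]
    split_ifs with ha
    · rw [← ENNReal.tsum_mul_left]
      refine ENNReal.tsum_le_tsum fun k => ?_
      simp only [herr, if_pos ha]
      refine (hrisk n hn f hf a k).trans ?_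
      gcongr
      exact le_add_of_nonneg_left zero_le_one
    · rw [← ENNReal.tsum_mul_left]
      refine ENNReal.tsum_le_tsum fun k => ?_
      simp only [herr, if_neg ha, zero_sub, neg_sq, lintegral_const, measure_univ, mul_one]
      refine le_mul_of_one_le_left zero_le ?_
      rw [ENNReal.one_le_ofReal]
      exact le_add_of_nonneg_right (by positivity)
  have hpt : ∀ X : Fin n → ℝ, ∫⁻ x, ENNReal.ofReal ((estimator ψ φt ψt c c' γ X x - f x) ^ 2) ≤
      ENNReal.ofReal K * ∑' (a : ℕ) (k : ℤ), err a k X := by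
    intro X
    have hest := memLp_estimator hΦ hr c c' γ X
    refine (hnorm (fun x => estimator ψ φt ψt c c' γ X x - f x) (hest.sub hf2)).trans ?_
    simp_rw [coeff_sub hΦ hr hest hf2, coeff_estimator hΦ hr, herr]
    exact le_rfl
  calc risk (n := n) (estimator ψ φt ψt c c' γ) f
      ≤ ∫⁻ X, ENNReal.ofReal K * ∑' (a : ℕ) (k : ℤ), err a k X
          ∂(Measure.pi fun _ : Fin n => law f) := lintegral_mono hpt
    _ = ENNReal.ofReal K * ∑' (a : ℕ) (k : ℤ),
          ∫⁻ X, err a k X ∂(Measure.pi fun _ : Fin n => law f) := by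
        rw [lintegral_const_mul' _ _ ENNReal.ofReal_ne_top, lintegral_tsum fun a =>
          (Measurable.tsum fun k => herrm a k).aemeasurable]
        congr 1
        exact tsum_congr fun a => lintegral_tsum fun k => (herrm a k).aemeasurable
    _ ≤ ENNReal.ofReal K *
          ∑' a : ℕ, ENNReal.ofReal D * levelRisk ψ A c (maxLevel c c' n) n f a := by
        gcongr with a
        exact hlev a
    _ = _ := by
        rw [ENNReal.tsum_mul_left, ← mul_assoc, ENNReal.ofReal_mul hK.le]

end Basis

/-! ### Summation over the levels -/

/-- The weight of the level `a` in a sum over the levels which is dominated by the levels of scale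
about `T`. -/
def levelWeight (e T : ℝ) (a : ℕ) : ℝ := min (scale a / T) ((scale a / T) ^ (-e))

lemma levelWeight_nonneg {e T : ℝ} (hT : 0 < T) (a : ℕ) : 0 ≤ levelWeight e T a := by
  have := scale_pos a
  exact le_min (by positivity) (by positivity)

lemma exists_tsum_levelWeight_le {e : ℝ} (he : 0 < e) :
    ∃ C : ℝ, 0 < C ∧ ∀ T : ℝ, 1 ≤ T →
      ∑' a : ℕ, ENNReal.ofReal (levelWeight e T a) ≤ ENNReal.ofReal C := by
  set s : ℝ := max (1 / 2) (2 ^ (-e)) with hs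
  have hs0 : 0 < s := lt_of_lt_of_le (by norm_num) (le_max_left _ _)
  have hs1 : s < 1 :=
    max_lt (by norm_num) (Real.rpow_lt_one_of_one_lt_of_neg (by norm_num) (by linarith))
  have hsum := summable_pow_natAbs hs0.le hs1
  have hS0 : 0 ≤ ∑' d : ℤ, s ^ d.natAbs := tsum_nonneg fun d => by positivity
  refine ⟨2 / s * ∑' d : ℤ, s ^ d.natAbs + 1, by positivity, fun T hT => ?_⟩
  obtain ⟨N, hN1, hN2⟩ := exists_nat_pow_near hT (one_lt_two (α := ℝ))
  have hT0 : 0 < T := by linarith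
  have hpt : ∀ a : ℕ, levelWeight e T a ≤ 2 / s * s ^ ((a : ℤ) - (N + 1)).natAbs := by
    intro a
    have hSa := scale_pos a
    rw [levelWeight]
    rcases le_or_gt a (N + 1) with h | h
    · have e1 : ((a : ℤ) - (N + 1)).natAbs = N + 1 - a := by omega
      rw [e1]
      refine (min_le_left _ _).trans ?_
      calc scale a / T ≤ scale a / 2 ^ N := by gcongr
        _ ≤ 2 * (1 / 2) ^ (N + 1 - a) := by
          have := scale_div_scale_le (a := a) (b := N + 1) h
          rwa [scale_succ] at this
        _ ≤ 2 * s ^ (N + 1 - a) := by gcongr; exact le_max_left _ _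
        _ ≤ 2 / s * s ^ (N + 1 - a) := by
          gcongr
          rw [le_div_iff₀ hs0]; linarith
    · have e1 : ((a : ℤ) - (N + 1)).natAbs = (a - 1 - (N + 1)) + 1 := by omega
      rw [e1, pow_succ]
      refine (min_le_right _ _).trans ?_
      have h1 : (2 : ℝ) ^ (a - 1 - (N + 1)) ≤ scale a / T := by
        rw [le_div_iff₀ hT0, scale]
        calc (2 : ℝ) ^ (a - 1 - (N + 1)) * T ≤ 2 ^ (a - 1 - (N + 1)) * 2 ^ (N + 1) := by gcongr
          _ = 2 ^ (a - 1) := by rw [← pow_add]; congr 1; omega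
      calc (scale a / T) ^ (-e) ≤ ((2 : ℝ) ^ (a - 1 - (N + 1))) ^ (-e) :=
            Real.rpow_le_rpow_of_nonpos (by positivity) h1 (by linarith)
        _ = ((2 : ℝ) ^ (-e)) ^ (a - 1 - (N + 1)) := by
            rw [← Real.rpow_natCast, ← Real.rpow_natCast, ← Real.rpow_mul (by norm_num),
              ← Real.rpow_mul (by norm_num), mul_comm]
        _ ≤ s ^ (a - 1 - (N + 1)) := by gcongr; exact le_max_right _ _
        _ = 1 / s * (s ^ (a - 1 - (N + 1)) * s) := by field_simp
        _ ≤ _ := by gcongr; norm_num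
  have hinj : Function.Injective fun a : ℕ => (a : ℤ) - (N + 1) := fun a b h => by
    simpa using h
  have hsum' : Summable fun a : ℕ => 2 / s * s ^ ((a : ℤ) - (N + 1)).natAbs :=
    (hsum.comp_injective hinj).mul_left (2 / s)
  calc ∑' a : ℕ, ENNReal.ofReal (levelWeight e T a)
      ≤ ∑' a : ℕ, ENNReal.ofReal (2 / s * s ^ ((a : ℤ) - (N + 1)).natAbs) :=
        ENNReal.tsum_le_tsum fun a => ENNReal.ofReal_le_ofReal (hpt a)
    _ = ENNReal.ofReal (∑' a : ℕ, 2 / s * s ^ ((a : ℤ) - (N + 1)).natAbs) :=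
        (ENNReal.ofReal_tsum_of_nonneg (fun a => by positivity) hsum').symm
    _ ≤ _ := by
        refine ENNReal.ofReal_le_ofReal ?_
        rw [tsum_mul_left]
        have : ∑' a : ℕ, s ^ ((a : ℤ) - (N + 1)).natAbs ≤ ∑' d : ℤ, s ^ d.natAbs :=
          tsum_comp_le_tsum_of_inj hsum (fun d => by positivity) hinj
        have h2 : 2 / s * ∑' a : ℕ, s ^ ((a : ℤ) - (N + 1)).natAbs ≤
          2 / s * ∑' d : ℤ, s ^ d.natAbs := by gcongr
        linarith

/-- On the levels whose scale is at most `Y`, the scale is `Y` times a weight. -/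
lemma scale_le_mul_levelWeight {Y : ℝ} {a : ℕ} (h : scale a ≤ Y) :
    scale a ≤ Y * levelWeight 1 Y a := by
  have hS := scale_pos a
  have hY : 0 < Y := hS.trans_le h
  rw [levelWeight, mul_min_of_nonneg _ _ hY.le, Real.rpow_neg_one, inv_div]
  refine le_min (le_of_eq (by field_simp)) ?_
  rw [← mul_div_assoc, le_div_iff₀ hS]
  nlinarith

/-- On the levels whose scale is at least `Y / 2`, a negative power of the scale is comparable
to a weight. -/
lemma scale_rpow_le_mul_levelWeight {Y e : ℝ} (he : 0 < e) (hY : 0 < Y) {a : ℕ}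
    (h : Y / 2 ≤ scale a) :
    scale a ^ (-e) ≤ 2 ^ (1 + e) * (Y ^ (-e) * levelWeight e Y a) := by
  have hS := scale_pos a
  set x := scale a / Y with hx
  have hx0 : 0 < x := by positivity
  have hx2 : 1 / 2 ≤ x := by rw [hx, le_div_iff₀ hY]; linarith
  have e1 : scale a ^ (-e) = Y ^ (-e) * x ^ (-e) := by
    rw [← Real.mul_rpow hY.le hx0.le, hx]; congr 1; field_simp
  have h2 : x ^ (-e) ≤ 2 ^ (1 + e) * levelWeight e Y a := by
    rw [levelWeight, mul_min_of_nonneg _ _ (by positivity), ← hx]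
    refine le_min ?_ ?_
    · calc x ^ (-e) ≤ (1 / 2) ^ (-e) := Real.rpow_le_rpow_of_nonpos (by norm_num) hx2 (by linarith)
        _ = 2 ^ (1 + e) * (1 / 2) := by
          rw [one_div, Real.inv_rpow (by norm_num), Real.rpow_neg (by norm_num), inv_inv,
            Real.rpow_add (by norm_num), Real.rpow_one]; ring
        _ ≤ _ := by gcongr
    · exact le_mul_of_one_le_left (by positivity) (Real.one_le_rpow (by norm_num) (by linarith))
  calc _ = Y ^ (-e) * x ^ (-e) := e1
    _ ≤ Y ^ (-e) * (2 ^ (1 + e) * levelWeight e Y a) := by gcongr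
    _ = _ := by ring

/-- The quantity `n^c (log n)^{-c}` which determines the finest level. -/
lemma cutoff_eq {n : ℕ} (hn : 2 ≤ n) (c : ℝ) :
    (n : ℝ) ^ c * Real.log n ^ (-c) = (Real.log n / n) ^ (-c) := by
  have hn' : (2 : ℝ) ≤ n := by exact_mod_cast hn
  have hlog : 0 < Real.log n := Real.log_pos (by linarith)
  rw [Real.div_rpow hlog.le (by linarith), Real.rpow_neg (by linarith : (0 : ℝ) ≤ n), div_inv_eq_mul,
    mul_comm]

lemma one_le_cutoff {n : ℕ} (hn : 2 ≤ n) {c : ℝ} (hc : 0 ≤ c) : 1 ≤ (Real.log n / n) ^ (-c) :=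
  Real.one_le_rpow_of_pos_of_le_one_of_nonpos (log_div_pos hn) (log_div_le_one hn) (by linarith)

lemma one_le_floor_cutoff {n : ℕ} (hn : 2 ≤ n) {c : ℝ} (hc : 0 ≤ c) :
    1 ≤ ⌊(n : ℝ) ^ c * Real.log n ^ (-c)⌋ := by
  rw [Int.le_floor, cutoff_eq hn]
  exact_mod_cast one_le_cutoff hn hc

lemma scale_le_of_le_maxLevel {n : ℕ} (hn : 2 ≤ n) {c : ℝ} (hc : 0 ≤ c) {a : ℕ}
    (ha : (a : ℤ) - 1 ≤ maxLevel c (-c) n) : scale a ≤ (Real.log n / n) ^ (-c) := by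
  cases a with
  | zero => rw [scale_zero]; exact one_le_cutoff hn hc
  | succ a =>
    have h1 := one_le_floor_cutoff hn hc
    have h1' : (1 : ℝ) ≤ (⌊(n : ℝ) ^ c * Real.log n ^ (-c)⌋ : ℝ) := by exact_mod_cast h1
    rw [maxLevel, Int.le_floor, Real.le_logb_iff_rpow_le (by norm_num) (by linarith)] at ha
    have h2 := Int.floor_le ((n : ℝ) ^ c * Real.log n ^ (-c))
    rw [← cutoff_eq hn, scale_succ]
    refine le_trans (le_of_eq ?_) (ha.trans h2)
    rw [← Real.rpow_natCast]; congr 1; push_cast; ring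

lemma le_scale_of_maxLevel_lt {n : ℕ} (hn : 2 ≤ n) {c : ℝ} (hc : 0 ≤ c) {a : ℕ}
    (ha : ¬ (a : ℤ) - 1 ≤ maxLevel c (-c) n) : (Real.log n / n) ^ (-c) / 2 ≤ scale a := by
  have h1 := one_le_floor_cutoff hn hc
  have h1' : (1 : ℝ) ≤ (⌊(n : ℝ) ^ c * Real.log n ^ (-c)⌋ : ℝ) := by exact_mod_cast h1
  have hJ : 0 ≤ maxLevel c (-c) n := by
    rw [maxLevel, Int.le_floor]
    exact_mod_cast Real.logb_nonneg (by norm_num) h1'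
  obtain ⟨a, rfl⟩ : ∃ b, a = b + 1 := ⟨a - 1, by omega⟩
  have h2 := Int.lt_floor_add_one ((n : ℝ) ^ c * Real.log n ^ (-c))
  rw [not_le, maxLevel, Int.floor_lt, Real.logb_lt_iff_lt_rpow (by norm_num) (by linarith)] at ha
  rw [← cutoff_eq hn, scale_succ]
  have h3 : (2 : ℝ) ^ ((((a + 1 : ℕ) : ℤ) - 1 : ℤ) : ℝ) = 2 ^ a := by
    rw [← Real.rpow_natCast]; congr 1; push_cast; ring
  rw [h3] at ha
  linarith

/-- The cells of one level have bounded overlap. -/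
lemma tsum_measure_cell_le {A : ℝ} (hA : 0 ≤ A) (μ : Measure ℝ) [IsProbabilityMeasure μ] (a : ℕ) :
    ∑' k : ℤ, ENNReal.ofReal (μ.real (cell A a k)) ≤ ENNReal.ofReal (2 * A + 1) := by
  classical
  have h1 : ∀ k : ℤ, ENNReal.ofReal (μ.real (cell A a k)) =
      ∫⁻ x, (cell A a k).indicator 1 x ∂μ := fun k => by
    rw [lintegral_indicator_one (measurableSet_cell A a k), measureReal_def,
      ENNReal.ofReal_toReal (measure_ne_top _ _)]
  simp_rw [h1]
  rw [← lintegral_tsum fun k => (measurable_one.indicator (measurableSet_cell A a k)).aemeasurable]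
  calc _ ≤ ∫⁻ _x, ENNReal.ofReal (2 * A + 1) ∂μ := by
        refine lintegral_mono fun x => ?_
        rw [ENNReal.tsum_eq_iSup_sum]
        refine iSup_le fun T => ?_
        have h2 : ∑ k ∈ T, (cell A a k).indicator (1 : ℝ → ℝ≥0∞) x =
            ((T.filter fun k => x ∈ cell A a k).card : ℝ≥0∞) := by
          simp [Set.indicator_apply]
        rw [h2, ← ENNReal.ofReal_natCast]
        refine ENNReal.ofReal_le_ofReal
          (card_le_of_abs_sub_le (y := scale a * x) hA fun l hl => ?_)
        rw [abs_sub_comm]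
        exact mem_cell.1 (Finset.mem_filter.1 hl).2
    _ = _ := by simp

lemma exists_tsum_le_of_le_levelWeight {e e' : ℝ} (he : 0 < e) (he' : 0 < e') :
    ∃ K : ℝ, 0 < K ∧ ∀ (F : ℕ → ℝ≥0∞) (T Y B : ℝ), 1 ≤ T → 1 ≤ Y → 0 ≤ B →
      (∀ a, F a ≤ ENNReal.ofReal
        (B * (levelWeight e T a + levelWeight 1 Y a + levelWeight e' Y a))) →
      ∑' a, F a ≤ ENNReal.ofReal (B * K) := by
  obtain ⟨K₁, h1, hK₁⟩ := exists_tsum_levelWeight_le he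
  obtain ⟨K₂, h2, hK₂⟩ := exists_tsum_levelWeight_le one_pos
  obtain ⟨K₃, h3, hK₃⟩ := exists_tsum_levelWeight_le he'
  refine ⟨K₁ + K₂ + K₃, by positivity, fun F T Y B hT hY hB hF => ?_⟩
  have hT0 : 0 < T := by linarith
  have hY0 : 0 < Y := by linarith
  calc ∑' a, F a ≤ ∑' a, ENNReal.ofReal B * (ENNReal.ofReal (levelWeight e T a) +
        ENNReal.ofReal (levelWeight 1 Y a) + ENNReal.ofReal (levelWeight e' Y a)) := by
        refine ENNReal.tsum_le_tsum fun a => (hF a).trans (le_of_eq ?_)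
        have w1 := levelWeight_nonneg (e := e) hT0 a
        have w2 := levelWeight_nonneg (e := 1) hY0 a
        have w3 := levelWeight_nonneg (e := e') hY0 a
        rw [ENNReal.ofReal_mul hB, ENNReal.ofReal_add (by positivity) w3, ENNReal.ofReal_add w1 w2]
    _ ≤ ENNReal.ofReal B * (ENNReal.ofReal K₁ + ENNReal.ofReal K₂ + ENNReal.ofReal K₃) := by
        rw [ENNReal.tsum_mul_left, ENNReal.tsum_add, ENNReal.tsum_add]
        gcongr
        exacts [hK₁ T hT, hK₂ Y hY, hK₃ Y hY]
    _ = _ := by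
        rw [ENNReal.ofReal_mul hB, ENNReal.ofReal_add (by positivity) h3.le,
          ENNReal.ofReal_add h1.le h2.le]

/-! ### Coefficients of the functions of a Besov ball -/

lemma le_ellNorm {ι : Type*} {p : ℝ≥0∞} (hp : 1 ≤ p) (u : ι → ℝ≥0∞) (i : ι) :
    u i ≤ ellNorm p u := by
  rw [ellNorm]
  split_ifs with h
  · exact le_iSup u i
  · have hp0 : 0 < p.toReal := ENNReal.toReal_pos (by positivity) h
    calc u i = (u i ^ p.toReal) ^ (1 / p.toReal) := by
          rw [← ENNReal.rpow_mul, mul_one_div, div_self hp0.ne', ENNReal.rpow_one]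
      _ ≤ _ := by
          gcongr
          exact ENNReal.le_tsum (f := fun i => u i ^ p.toReal) i

section Besov

variable {ψ f : ℝ → ℝ} {α R : ℝ} {p q : ℝ≥0∞}

/-- The bound on the coefficients of one level of a function of the Besov ball, uniformly
over all the levels, the father wavelets included. -/
lemma ellNorm_coeff_le (hq : 1 ≤ q) (hf : f ∈ besovBall ψ α p q R) (a : ℕ) :
    ellNorm p (fun k : ℤ => ‖coeff ψ f ((a : ℤ) - 1) k‖ₑ) ≤
      ENNReal.ofReal (R * scale a ^ (-(α + 1 / 2 - (p⁻¹).toReal))) := by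
  have hB := hf.2
  rw [besovNorm] at hB
  cases a with
  | zero =>
    rw [scale_zero, Real.one_rpow, mul_one]
    simpa using (le_add_of_nonneg_right zero_le).trans hB
  | succ a =>
    have h1 := (le_ellNorm hq (fun j : ℕ =>
      ENNReal.ofReal ((2 : ℝ) ^ ((j : ℝ) * (α + 1 / 2 - (p⁻¹).toReal))) *
        ellNorm p (fun k : ℤ => ‖coeff ψ f (j : ℤ) k‖ₑ)) a).trans
      ((le_add_of_nonneg_left zero_le).trans hB)
    set s := α + 1 / 2 - (p⁻¹).toReal
    have e1 : ((a + 1 : ℕ) : ℤ) - 1 = (a : ℤ) := by push_cast; ring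
    have e2 : scale (a + 1) ^ (-s) = ((2 : ℝ) ^ ((a : ℝ) * s))⁻¹ := by
      rw [scale_succ, ← Real.rpow_natCast, ← Real.rpow_mul (by norm_num),
        ← Real.rpow_neg (by norm_num)]
      congr 1; ring
    have h2 : (0 : ℝ) < 2 ^ ((a : ℝ) * s) := by positivity
    rw [e1, e2, ← div_eq_mul_inv, ENNReal.ofReal_div_of_pos h2,
      ENNReal.le_div_iff_mul_le (Or.inl (by simpa using h2)) (Or.inl ENNReal.ofReal_ne_top),
      mul_comm]
    exact h1

lemma tsum_coeff_rpow_le {B : ℝ} (hB : 0 ≤ B) (hp : 1 ≤ p) (hp' : p ≠ ∞) {u : ℤ → ℝ}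
    (h : ellNorm p (fun k : ℤ => ‖u k‖ₑ) ≤ ENNReal.ofReal B) :
    ∑' k, ENNReal.ofReal (|u k| ^ p.toReal) ≤ ENNReal.ofReal (B ^ p.toReal) := by
  have hp0 : 0 < p.toReal := ENNReal.toReal_pos (by positivity) hp'
  rw [ellNorm, if_neg hp', one_div, ENNReal.rpow_inv_le_iff hp0,
    ENNReal.ofReal_rpow_of_nonneg hB hp0.le] at h
  refine le_trans (le_of_eq (tsum_congr fun k => ?_)) h
  rw [Real.enorm_eq_ofReal_abs, ENNReal.ofReal_rpow_of_nonneg (abs_nonneg _) hp0.le]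

lemma abs_coeff_le_of_ellNorm_le {B : ℝ} (hB : 0 ≤ B) (hp : 1 ≤ p) {u : ℤ → ℝ}
    (h : ellNorm p (fun k : ℤ => ‖u k‖ₑ) ≤ ENNReal.ofReal B) (k : ℤ) : |u k| ≤ B := by
  have := (le_ellNorm hp (fun k : ℤ => ‖u k‖ₑ) k).trans h
  rwa [Real.enorm_eq_ofReal_abs, ENNReal.ofReal_le_ofReal_iff hB] at this

/-- For `p ≤ 2` the `ℓ²` norm is at most the `ℓᵖ` norm. -/
lemma tsum_sq_le_of_le_two {B : ℝ} (hB : 0 ≤ B) (hp : 1 ≤ p) (hp2 : p ≤ 2) {u : ℤ → ℝ}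
    (h : ellNorm p (fun k : ℤ => ‖u k‖ₑ) ≤ ENNReal.ofReal B) :
    ∑' k, ENNReal.ofReal (u k ^ 2) ≤ ENNReal.ofReal (B ^ 2) := by
  have hp' : p ≠ ∞ := ne_top_of_le_ne_top (by norm_num) hp2
  have hp0 : 0 < p.toReal := ENNReal.toReal_pos (by positivity) hp'
  have hp2' : p.toReal ≤ 2 := by
    have := ENNReal.toReal_mono (by norm_num) hp2
    simpa using this
  have hsum := tsum_coeff_rpow_le hB hp hp' h
  have habs := abs_coeff_le_of_ellNorm_le hB hp h
  have hpt : ∀ k, u k ^ 2 ≤ B ^ (2 - p.toReal) * |u k| ^ p.toReal := by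
    intro k
    rw [← sq_abs]
    rcases (abs_nonneg (u k)).eq_or_lt with h0 | h0
    · rw [← h0]; simp; positivity
    · calc |u k| ^ 2 = |u k| ^ (2 - p.toReal) * |u k| ^ p.toReal := by
            rw [← Real.rpow_add h0, ← Real.rpow_natCast]; congr 1; push_cast; ring
        _ ≤ _ := by
            gcongr
            exact habs k
  calc _ ≤ ∑' k, ENNReal.ofReal (B ^ (2 - p.toReal)) * ENNReal.ofReal (|u k| ^ p.toReal) := by
        refine ENNReal.tsum_le_tsum fun k => ?_
        rw [← ENNReal.ofReal_mul (by positivity)]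
        exact ENNReal.ofReal_le_ofReal (hpt k)
    _ ≤ ENNReal.ofReal (B ^ (2 - p.toReal)) * ENNReal.ofReal (B ^ p.toReal) := by
        rw [ENNReal.tsum_mul_left]; gcongr
    _ = _ := by
        rw [← ENNReal.ofReal_mul (by positivity)]
        congr 1
        rcases hB.eq_or_lt with h0 | h0
        · rw [← h0, Real.zero_rpow hp0.ne']; simp
        · rw [← Real.rpow_add h0, ← Real.rpow_natCast]; congr 1; push_cast; ring

/-- The level energies when `p > 2`: interpolation between the `ℓᵖ` bound of the Besov ball and the
`ℓ¹` bound `∑ |β_{jk}| ≤ D 2^{j/2}` valid for a probability density. -/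
lemma tsum_sq_le_of_two_lt {S D : ℝ} (hS : 0 < S) (hD : 0 ≤ D) (hR : 0 ≤ R) (hp2 : 2 < p)
    {u : ℤ → ℝ} (h1 : ∑' k, ENNReal.ofReal |u k| ≤ ENNReal.ofReal (D * √S))
    (h : ellNorm p (fun k : ℤ => ‖u k‖ₑ) ≤
      ENNReal.ofReal (R * S ^ (-(α + 1 / 2 - (p⁻¹).toReal)))) :
    ∑' k, ENNReal.ofReal (u k ^ 2) ≤
      ENNReal.ofReal ((D + R ^ p.toReal + R * D) * S ^ (-(α / (1 - (p⁻¹).toReal)))) := by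
  have hp : 1 ≤ p := le_trans (by norm_num) hp2.le
  have hB : 0 ≤ R * S ^ (-(α + 1 / 2 - (p⁻¹).toReal)) := by positivity
  rw [Real.sqrt_eq_rpow] at h1
  by_cases hp' : p = ∞
  · have habs := abs_coeff_le_of_ellNorm_le hB hp h
    subst hp'
    simp only [ENNReal.inv_top, ENNReal.toReal_zero, sub_zero, div_one, ENNReal.toReal_top,
      Real.rpow_zero] at habs ⊢
    set B := R * S ^ (-(α + 1 / 2)) with hBdef
    have hB0 : 0 ≤ B := by positivity
    calc _ ≤ ∑' k, ENNReal.ofReal B * ENNReal.ofReal |u k| := by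
          refine ENNReal.tsum_le_tsum fun k => ?_
          rw [← ENNReal.ofReal_mul hB0, ← sq_abs, sq]
          exact ENNReal.ofReal_le_ofReal (by gcongr; exact habs k)
      _ ≤ ENNReal.ofReal B * ENNReal.ofReal (D * S ^ (1 / 2 : ℝ)) := by
          rw [ENNReal.tsum_mul_left]; gcongr
      _ = ENNReal.ofReal (R * D * S ^ (-α)) := by
          rw [← ENNReal.ofReal_mul hB0, hBdef]
          congr 1
          have : S ^ (-α) = S ^ (-(α + 1 / 2)) * S ^ (1 / 2 : ℝ) := by
            rw [← Real.rpow_add hS]; congr 1; ring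
          rw [this]; ring
      _ ≤ _ := by
          refine ENNReal.ofReal_le_ofReal ?_
          gcongr
          linarith
  · have hp0 : 0 < p.toReal := ENNReal.toReal_pos (by positivity) hp'
    have hpr : 2 < p.toReal := by
      have := (ENNReal.toReal_lt_toReal (by norm_num) hp').2 hp2
      simpa using this
    have hsum := tsum_coeff_rpow_le hB hp hp' h
    rw [ENNReal.toReal_inv] at hsum ⊢
    set t := p.toReal
    set e := α / (1 - t⁻¹) with he
    have het : e * (t - 1) = α * t := by
      have : t - 1 ≠ 0 := by linarith
      rw [he]; field_simp
    set T := S ^ (-(e + 1 / 2)) with hT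
    have hT0 : 0 < T := by positivity
    have hpt : ∀ k, u k ^ 2 ≤ T * |u k| + T ^ (2 - t) * |u k| ^ t := by
      intro k
      have h0 := abs_nonneg (u k)
      rw [← sq_abs]
      rcases le_or_gt |u k| T with hle | hgt
      · have : 0 ≤ T ^ (2 - t) * |u k| ^ t := by positivity
        nlinarith
      · have hpos : 0 < |u k| := hT0.trans hgt
        have e1 : |u k| ^ 2 = |u k| ^ (2 - t) * |u k| ^ t := by
          rw [← Real.rpow_add hpos, ← Real.rpow_natCast]; congr 1; push_cast; ring
        have e2 : |u k| ^ (2 - t) ≤ T ^ (2 - t) :=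
          Real.rpow_le_rpow_of_nonpos hT0 hgt.le (by linarith)
        rw [e1]
        have : |u k| ^ (2 - t) * |u k| ^ t ≤ T ^ (2 - t) * |u k| ^ t := by gcongr
        have : 0 ≤ T * |u k| := by positivity
        linarith
    calc _ ≤ ∑' k, (ENNReal.ofReal T * ENNReal.ofReal |u k| +
          ENNReal.ofReal (T ^ (2 - t)) * ENNReal.ofReal (|u k| ^ t)) := by
          refine ENNReal.tsum_le_tsum fun k => ?_
          rw [← ENNReal.ofReal_mul hT0.le, ← ENNReal.ofReal_mul (by positivity),
            ← ENNReal.ofReal_add (by positivity) (by positivity)]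
          exact ENNReal.ofReal_le_ofReal (hpt k)
      _ ≤ ENNReal.ofReal T * ENNReal.ofReal (D * S ^ (1 / 2 : ℝ)) +
          ENNReal.ofReal (T ^ (2 - t)) *
            ENNReal.ofReal ((R * S ^ (-(α + 1 / 2 - t⁻¹))) ^ t) := by
          rw [ENNReal.tsum_add, ENNReal.tsum_mul_left, ENNReal.tsum_mul_left]; gcongr
      _ = ENNReal.ofReal ((D + R ^ t) * S ^ (-e)) := by
          rw [← ENNReal.ofReal_mul hT0.le, ← ENNReal.ofReal_mul (by positivity),
            ← ENNReal.ofReal_add (by positivity) (by positivity)]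
          congr 1
          have e1 : T * S ^ (1 / 2 : ℝ) = S ^ (-e) := by
            rw [hT, ← Real.rpow_add hS]; congr 1; ring
          have e2 : T ^ (2 - t) * (S ^ (-(α + 1 / 2 - t⁻¹))) ^ t = S ^ (-e) := by
            rw [hT, ← Real.rpow_mul hS.le, ← Real.rpow_mul hS.le, ← Real.rpow_add hS]
            congr 1
            have : t⁻¹ * t = 1 := inv_mul_cancel₀ hp0.ne'
            linear_combination this + het
          rw [Real.mul_rpow hR (by positivity), add_mul, ← e1]
          rw [e1]
          nth_rewrite 2 [← e2]
          rw [← e1]; ring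
      _ ≤ _ := by
          refine ENNReal.ofReal_le_ofReal (mul_le_mul_of_nonneg_right ?_ (by positivity))
          have : 0 ≤ R * D := by positivity
          linarith

end Besov

/-! ### Bounds for one level -/

section Level

variable {ψ f : ℝ → ℝ} {A M L : ℝ}

lemma abs_coeff_le (hdec : ∀ a, IsBump A M (generator box ψ a)) (hf : IsDensity f) (a : ℕ) (k : ℤ) :
    |coeff ψ f ((a : ℤ) - 1) k| ≤ M * √(scale a) * (law f).real (cell A a k) := by
  have := hf.isProbabilityMeasure
  rw [← hf.integral_wavelet]
  exact abs_integral_le_mul_measure (measurable_wavelet hdec a k) (abs_wavelet_le hdec a k)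
    (measurableSet_cell A a k) fun x hx => wavelet_eq_zero hdec a k hx

lemma integral_wavelet_sq_le (hdec : ∀ a, IsBump A M (generator box ψ a)) (hf : IsDensity f)
    (a : ℕ) (k : ℤ) : ∫ x, wavelet box ψ ((a : ℤ) - 1) k x ^ 2 ∂(law f) ≤
      M ^ 2 * scale a * (law f).real (cell A a k) := by
  have := hf.isProbabilityMeasure
  refine (integral_sq_le_mul_measure (measurable_wavelet hdec a k) (abs_wavelet_le hdec a k)
    (measurableSet_cell A a k) fun x hx => wavelet_eq_zero hdec a k hx).trans (le_of_eq ?_)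
  rw [mul_pow, Real.sq_sqrt (scale_pos a).le]

lemma coeff_sq_le (hdec : ∀ a, IsBump A M (generator box ψ a)) (hf : IsDensity f) (a : ℕ) (k : ℤ) :
    coeff ψ f ((a : ℤ) - 1) k ^ 2 ≤ M ^ 2 * scale a * (law f).real (cell A a k) ^ 2 := by
  rw [← sq_abs]
  calc _ ≤ (M * √(scale a) * (law f).real (cell A a k)) ^ 2 := by
        gcongr; exact abs_coeff_le hdec hf a k
    _ = _ := by rw [mul_pow, mul_pow, Real.sq_sqrt (scale_pos a).le]

lemma tsum_abs_coeff_le (hA : 0 ≤ A) (hM : 0 < M)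
    (hdec : ∀ a, IsBump A M (generator box ψ a)) (hf : IsDensity f) (a : ℕ) :
    ∑' k : ℤ, ENNReal.ofReal |coeff ψ f ((a : ℤ) - 1) k| ≤
      ENNReal.ofReal (M * (2 * A + 1) * √(scale a)) := by
  have := hf.isProbabilityMeasure
  calc _ ≤ ∑' k : ℤ, ENNReal.ofReal (M * √(scale a)) *
        ENNReal.ofReal ((law f).real (cell A a k)) := by
        refine ENNReal.tsum_le_tsum fun k => ?_
        rw [← ENNReal.ofReal_mul (by positivity)]
        exact ENNReal.ofReal_le_ofReal (abs_coeff_le hdec hf a k)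
    _ ≤ ENNReal.ofReal (M * √(scale a)) * ENNReal.ofReal (2 * A + 1) := by
        rw [ENNReal.tsum_mul_left]; gcongr; exact tsum_measure_cell_le hA (law f) a
    _ = _ := by rw [← ENNReal.ofReal_mul (by positivity)]; congr 1; ring

/-- The variance bound for one level. When a cell has probability less than `L`, it is the square
of the coefficient which is small enough. -/
lemma tsum_min_le_scale (hA : 0 ≤ A) (hdec : ∀ a, IsBump A M (generator box ψ a))
    (hf : IsDensity f) (hL : 0 ≤ L) (a : ℕ) :
    ∑' k : ℤ, ENNReal.ofReal (min (coeff ψ f ((a : ℤ) - 1) k ^ 2)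
      (L * ∫ x, wavelet box ψ ((a : ℤ) - 1) k x ^ 2 ∂(law f) + scale a * L ^ 2)) ≤
      ENNReal.ofReal ((1 + M ^ 2) * (2 * A + 1) * (scale a * L)) := by
  have := hf.isProbabilityMeasure
  have hS := scale_pos a
  calc _ ≤ ∑' k : ℤ, ENNReal.ofReal ((1 + M ^ 2) * (scale a * L)) *
        ENNReal.ofReal ((law f).real (cell A a k)) := by
        refine ENNReal.tsum_le_tsum fun k => ?_
        rw [← ENNReal.ofReal_mul (by positivity)]
        refine ENNReal.ofReal_le_ofReal ?_
        have hF : 0 ≤ (law f).real (cell A a k) := measureReal_nonneg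
        have h1 := coeff_sq_le hdec hf a k
        have h2 := integral_wavelet_sq_le hdec hf a k
        set F := (law f).real (cell A a k)
        have hSFL : 0 ≤ scale a * F * L := by positivity
        rcases le_or_gt L F with h | h
        · refine (min_le_right _ _).trans ?_
          calc _ ≤ L * (M ^ 2 * scale a * F) + scale a * (L * F) := by
                rw [sq L]; gcongr
            _ = _ := by ring
        · refine (min_le_left _ _).trans (h1.trans ?_)
          calc M ^ 2 * scale a * F ^ 2 ≤ M ^ 2 * scale a * (F * L) := by
                rw [sq F]; gcongr
            _ ≤ _ := by nlinarith
    _ ≤ ENNReal.ofReal ((1 + M ^ 2) * (scale a * L)) * ENNReal.ofReal (2 * A + 1) := by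
        rw [ENNReal.tsum_mul_left]; gcongr; exact tsum_measure_cell_le hA (law f) a
    _ = _ := by rw [← ENNReal.ofReal_mul (by positivity)]; congr 1; ring

lemma law_cell_le {R' : ℝ} (hR' : 0 ≤ R') (hA : 0 ≤ A)
    (hf : eLpNorm f ∞ volume ≤ ENNReal.ofReal R') (a : ℕ) (k : ℤ) :
    (law f).real (cell A a k) ≤ R' * (2 * A / scale a) := by
  have hS := scale_pos a
  rw [measureReal_def, law, withDensity_apply _ (measurableSet_cell A a k)]
  refine ENNReal.toReal_le_of_le_ofReal (by positivity) ?_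
  calc _ ≤ ∫⁻ _x in cell A a k, ENNReal.ofReal R' := by
        refine lintegral_mono_ae (ae_restrict_of_ae ?_)
        rw [eLpNorm_exponent_top] at hf
        filter_upwards [ae_le_eLpNormEssSup (f := f) (μ := volume)] with x hx
        refine le_trans ?_ (hx.trans hf)
        rw [Real.enorm_eq_ofReal_abs]
        exact ENNReal.ofReal_le_ofReal (le_abs_self _)
    _ = _ := by
        rw [setLIntegral_const, volume_cell, ← ENNReal.ofReal_mul hR']

/-- For a bounded density the deterministic counterpart of the squared threshold may be replaced by
`L`: on the levels finer than `1 / L` the coefficients themselves are bounded by `√L`. -/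
lemma min_le_mul_min_of_bounded {R' : ℝ} (hR' : 0 ≤ R') (hA : 0 ≤ A)
    (hdec : ∀ a, IsBump A M (generator box ψ a)) (hd : IsDensity f)
    (hf : eLpNorm f ∞ volume ≤ ENNReal.ofReal R') (hL : 0 < L) (a : ℕ) (k : ℤ) :
    min (coeff ψ f ((a : ℤ) - 1) k ^ 2)
      (L * ∫ x, wavelet box ψ ((a : ℤ) - 1) k x ^ 2 ∂(law f) + scale a * L ^ 2) ≤
      (1 + M ^ 2 * (R' * (2 * A)) + M ^ 2 * (R' * (2 * A)) ^ 2) *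
        min (coeff ψ f ((a : ℤ) - 1) k ^ 2) L := by
  have hS := scale_pos a
  have hF0 : 0 ≤ (law f).real (cell A a k) := measureReal_nonneg
  have hF := law_cell_le hR' hA hf a k
  have h1 := coeff_sq_le hdec hd a k
  have h2 := integral_wavelet_sq_le hdec hd a k
  set F := (law f).real (cell A a k)
  set β := coeff ψ f ((a : ℤ) - 1) k
  set V := R' * (2 * A) with hV
  have hV0 : 0 ≤ V := by positivity
  have hFV : scale a * F ≤ V := by
    calc scale a * F ≤ scale a * (R' * (2 * A / scale a)) := by gcongr
      _ = V := by rw [hV]; field_simp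
  have hMV : 0 ≤ M ^ 2 * V := by positivity
  have hMV2 : 0 ≤ M ^ 2 * V ^ 2 := by positivity
  rw [mul_min_of_nonneg _ _ (by positivity)]
  refine le_min ((min_le_left _ _).trans (le_mul_of_one_le_left (sq_nonneg _) (by linarith))) ?_
  rcases le_or_gt (scale a * L) 1 with h | h
  · refine (min_le_right _ _).trans ?_
    calc _ ≤ L * (M ^ 2 * (scale a * F)) + (scale a * L) * L := by
          rw [sq L, ← mul_assoc (scale a)]
          have : M ^ 2 * (scale a * F) = M ^ 2 * scale a * F := by ring
          rw [this]
          gcongr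
      _ ≤ L * (M ^ 2 * V) + 1 * L := by gcongr
      _ ≤ _ := by nlinarith
  · refine (min_le_left _ _).trans (h1.trans ?_)
    calc M ^ 2 * scale a * F ^ 2 = M ^ 2 * (scale a * F) ^ 2 * (scale a)⁻¹ := by field_simp
      _ ≤ M ^ 2 * V ^ 2 * L := by
          gcongr
          rw [inv_le_iff_one_le_mul₀ hS]; linarith
      _ ≤ _ := by nlinarith

end Level

/-! ### The rates of convergence -/

/-- The balance between the variance term `S L`, which grows with the scale `S`, and an
approximation term `L^δ S^{-e}`, which decreases: they are equal at the scale `L^{-τ}`, where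
`δ = 1 - τ (1 + e)`. -/
lemma rpow_mul_levelWeight {L : ℝ} (hL : 0 < L) (e τ : ℝ) (a : ℕ) :
    L ^ (1 - τ) * levelWeight e (L ^ (-τ)) a =
      min (scale a * L) (L ^ (1 - τ * (1 + e)) * scale a ^ (-e)) := by
  have hS := scale_pos a
  rw [levelWeight, mul_min_of_nonneg _ _ (by positivity)]
  congr 1
  · rw [Real.rpow_neg hL.le, div_inv_eq_mul, mul_comm, mul_assoc, ← Real.rpow_add hL]
    simp
  · rw [Real.div_rpow hS.le (by positivity), ← Real.rpow_mul hL.le, div_eq_mul_inv,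
      ← Real.rpow_neg hL.le, mul_comm (scale a ^ (-e)), ← mul_assoc, ← Real.rpow_add hL]
    congr 2; ring

section Rates

variable {ψ f : ℝ → ℝ} {A M c : ℝ} {n : ℕ}

/-- On the levels used by the estimator, the remainder terms add up to `O(log n / n)`, since the
threshold is accurate with probability `1 - O(n^{-c})` and the scales are at most
`n^c (log n)^{-c}`. -/
lemma levelRisk_le_of_le (hA : 0 ≤ A) (hc : 0 ≤ c) (hn : 2 ≤ n) (hd : IsDensity f) {a : ℕ}
    (ha : (a : ℤ) - 1 ≤ maxLevel c (-c) n) :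
    levelRisk ψ A c (maxLevel c (-c) n) n f a ≤
      (∑' k : ℤ, ENNReal.ofReal (min (coeff ψ f ((a : ℤ) - 1) k ^ 2)
        (Real.log n / n * ∫ x, wavelet box ψ ((a : ℤ) - 1) k x ^ 2 ∂(law f) +
          scale a * (Real.log n / n) ^ 2))) +
      ENNReal.ofReal ((2 * A + 1) * 2 ^ c *
        (Real.log n / n * levelWeight 1 ((Real.log n / n) ^ (-c)) a)) := by
  have := hd.isProbabilityMeasure
  have hn' : (2 : ℝ) ≤ n := by exact_mod_cast hn
  have hS := scale_pos a
  have hL := log_div_pos hn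
  have hlog2 : (1 / 2 : ℝ) ≤ Real.log n := by
    have h1 : Real.log 2 ≤ Real.log n := Real.log_le_log (by norm_num) hn'
    linarith [Real.log_two_gt_d9]
  have hcut := cutoff_eq hn c
  have hsc := scale_le_mul_levelWeight (scale_le_of_le_maxLevel hn hc ha)
  have hY0 : 0 < (Real.log n / n) ^ (-c) := by positivity
  have hw := levelWeight_nonneg (e := 1) hY0 a
  set Y := (Real.log n / n) ^ (-c)
  set L := Real.log n / n
  have hYn : Y * (n : ℝ) ^ (-c) ≤ 2 ^ c := by
    rw [← hcut, mul_right_comm, ← Real.rpow_add (by linarith)]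
    rw [add_neg_cancel, Real.rpow_zero, one_mul]
    calc Real.log n ^ (-c) ≤ (1 / 2 : ℝ) ^ (-c) :=
          Real.rpow_le_rpow_of_nonpos (by norm_num) hlog2 (by linarith)
      _ = 2 ^ c := by
          rw [one_div, Real.inv_rpow (by norm_num), Real.rpow_neg (by norm_num), inv_inv]
  rw [levelRisk, if_pos ha]
  have hF : ∀ k : ℤ, 0 ≤ (law f).real (cell A a k) := fun k => measureReal_nonneg
  have hW : ∀ k : ℤ, 0 ≤ ∫ x, wavelet box ψ ((a : ℤ) - 1) k x ^ 2 ∂(law f) :=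
    fun k => integral_nonneg fun _ => sq_nonneg _
  calc _ = (∑' k : ℤ, ENNReal.ofReal (min (coeff ψ f ((a : ℤ) - 1) k ^ 2)
        (L * ∫ x, wavelet box ψ ((a : ℤ) - 1) k x ^ 2 ∂(law f) + scale a * L ^ 2))) +
        ∑' k : ℤ, ENNReal.ofReal (scale a * L * (n : ℝ) ^ (-c)) *
          ENNReal.ofReal ((law f).real (cell A a k)) := by
        rw [← ENNReal.tsum_add]
        refine tsum_congr fun k => ?_
        have := hF k
        have := hW k
        rw [ENNReal.ofReal_add (by positivity) (by positivity),
          ← ENNReal.ofReal_mul (by positivity)]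
        congr 2; ring
    _ ≤ _ := by
        gcongr
        rw [ENNReal.tsum_mul_left]
        refine (mul_le_mul_right (tsum_measure_cell_le hA (law f) a) _).trans ?_
        rw [← ENNReal.ofReal_mul (by positivity)]
        refine ENNReal.ofReal_le_ofReal ?_
        calc scale a * L * (n : ℝ) ^ (-c) * (2 * A + 1)
            ≤ (Y * levelWeight 1 Y a) * L * (n : ℝ) ^ (-c) * (2 * A + 1) := by gcongr
          _ = (2 * A + 1) * (Y * (n : ℝ) ^ (-c)) * (L * levelWeight 1 Y a) := by ring
          _ ≤ _ := by gcongr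

variable {α R : ℝ} {p q : ℝ≥0∞}

/-- The rate for `p > 2`, without any bound on the density. The exponent `e` is that of the decay of
the level energies. -/
lemma exists_tsum_levelRisk_le_of_two_lt (hA : 0 ≤ A) (hM : 0 < M)
    (hdec : ∀ a, IsBump A M (generator box ψ a)) (hc : 1 ≤ c) (hα : 0 < α) (hR : 0 ≤ R)
    (hp : 2 < p) (hq : 1 ≤ q) :
    ∃ C : ℝ, 0 < C ∧ ∀ n : ℕ, 2 ≤ n → ∀ f ∈ besovBall ψ α p q R, IsDensity f →
      ∑' a, levelRisk ψ A c (maxLevel c (-c) n) n f a ≤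
        ENNReal.ofReal (C * (Real.log n / n) ^ (α / (α + 1 - (p⁻¹).toReal))) := by
  have hpinv : (p⁻¹).toReal < 1 := by
    have h1 : p⁻¹ < 1 := ENNReal.inv_lt_one.2 (lt_trans (by norm_num) hp)
    have := (ENNReal.toReal_lt_toReal (ne_top_of_lt h1) ENNReal.one_ne_top).2 h1
    simpa using this
  set π := (p⁻¹).toReal with hπ
  have hπ1 : 0 < 1 - π := by linarith
  set e := α / (1 - π) with he
  have he0 : 0 < e := by positivity
  set τ := 1 / (1 + e) with hτ
  have hτ0 : 0 ≤ τ := by positivity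
  have hrate : α / (α + 1 - π) = 1 - τ := by
    have h1 : α + 1 - π ≠ 0 := by linarith
    have h2 : 1 + e ≠ 0 := by positivity
    rw [hτ, he]
    have h3 : 1 + α / (1 - π) = (α + 1 - π) / (1 - π) := by field_simp; ring
    rw [h3]; field_simp; ring
  -- the approximation term is the energy of the level, without a power of `L`
  have hbal : 1 - τ * (1 + e) = 0 := by rw [hτ]; field_simp; ring
  obtain ⟨K, hK, hsum⟩ := exists_tsum_le_of_le_levelWeight he0 one_pos
  set D := M * (2 * A + 1)
  set C₁ := (1 + M ^ 2) * (2 * A + 1)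
  set C₂ := D + R ^ p.toReal + R * D
  have hD : 0 ≤ D := by positivity
  have hC₁ : 0 < C₁ := by positivity
  have hC₂ : 0 ≤ C₂ := by positivity
  set C₃ := (2 * A + 1) * 2 ^ c
  have hC₃ : 0 ≤ C₃ := by positivity
  refine ⟨(C₁ + 2 * C₂ + C₃) * K, by positivity, fun n hn f hf hd => ?_⟩
  have hL := log_div_pos hn
  have hL1 := log_div_le_one hn
  have hY := one_le_cutoff hn (by linarith : 0 ≤ c)
  have hT : 1 ≤ (Real.log n / n) ^ (-τ) := one_le_cutoff hn hτ0
  rw [hrate]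
  have henergy : ∀ a : ℕ, ∑' k : ℤ, ENNReal.ofReal (coeff ψ f ((a : ℤ) - 1) k ^ 2) ≤
      ENNReal.ofReal (C₂ * scale a ^ (-e)) := fun a =>
    tsum_sq_le_of_two_lt (scale_pos a) hD hR hp (tsum_abs_coeff_le hA hM hdec hd a)
      (ellNorm_coeff_le hq hf a)
  have hmainle := fun a => tsum_min_le_scale (L := Real.log n / n) hA hdec hd hL.le a
  have hlev := fun (a : ℕ) (ha : (a : ℤ) - 1 ≤ maxLevel c (-c) n) =>
    levelRisk_le_of_le (ψ := ψ) hA (by linarith : 0 ≤ c) hn hd ha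
  have hfine := fun (a : ℕ) (ha : ¬ (a : ℤ) - 1 ≤ maxLevel c (-c) n) =>
    le_scale_of_maxLevel_lt hn (by linarith : 0 ≤ c) ha
  have hYL : (Real.log n / n)⁻¹ ≤ (Real.log n / n) ^ (-c) := by
    rw [← Real.rpow_neg_one]
    exact Real.rpow_le_rpow_of_exponent_ge hL hL1 (by linarith)
  have hLrate : Real.log n / n ≤ (Real.log n / n) ^ (1 - τ) := by
    calc _ = (Real.log n / n) ^ (1 : ℝ) := (Real.rpow_one _).symm
      _ ≤ _ := Real.rpow_le_rpow_of_exponent_ge hL hL1 (by linarith)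
  set L := Real.log n / n
  set Y := L ^ (-c)
  set T := L ^ (-τ) with hTdef
  have hw := fun a => rpow_mul_levelWeight hL e τ a
  rw [hbal] at hw
  simp only [Real.rpow_zero, one_mul] at hw
  have hw1 : ∀ a, 0 ≤ levelWeight 1 Y a := levelWeight_nonneg (by linarith)
  have hwe : ∀ a, 0 ≤ levelWeight e T a := levelWeight_nonneg (by linarith)
  have hLr : 0 < L ^ (1 - τ) := by positivity
  have hgoal := hsum (fun a => levelRisk ψ A c (maxLevel c (-c) n) n f a) T Y
    ((C₁ + 2 * C₂ + C₃) * L ^ (1 - τ)) hT hY (by positivity) fun a => ?_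
  · refine hgoal.trans (le_of_eq ?_)
    congr 1; ring
  have hS := scale_pos a
  have h1 := hw1 a
  have h2 := hwe a
  by_cases ha : (a : ℤ) - 1 ≤ maxLevel c (-c) n
  · refine (hlev a ha).trans ?_
    have hmain : ∑' k : ℤ, ENNReal.ofReal (min (coeff ψ f ((a : ℤ) - 1) k ^ 2)
        (L * ∫ x, wavelet box ψ ((a : ℤ) - 1) k x ^ 2 ∂(law f) + scale a * L ^ 2)) ≤
        ENNReal.ofReal ((C₁ + C₂) * (L ^ (1 - τ) * levelWeight e T a)) := by
      rw [hw, mul_min_of_nonneg _ _ (by positivity), ENNReal.ofReal_min]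
      refine le_min ((hmainle a).trans (ENNReal.ofReal_le_ofReal ?_))
        ((ENNReal.tsum_le_tsum fun k => ENNReal.ofReal_le_ofReal (min_le_left _ _)).trans
          ((henergy a).trans (ENNReal.ofReal_le_ofReal ?_)))
      · exact mul_le_mul_of_nonneg_right (by linarith) (by positivity)
      · exact mul_le_mul_of_nonneg_right (by linarith) (by positivity)
    refine (add_le_add_left hmain _).trans ?_
    rw [← ENNReal.ofReal_add (by positivity) (by positivity)]
    refine ENNReal.ofReal_le_ofReal ?_
    calc (C₁ + C₂) * (L ^ (1 - τ) * levelWeight e T a) + C₃ * (L * levelWeight 1 Y a)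
        ≤ (C₁ + C₂) * (L ^ (1 - τ) * levelWeight e T a) +
          C₃ * (L ^ (1 - τ) * levelWeight 1 Y a) := by gcongr
      _ ≤ (C₁ + 2 * C₂ + C₃) * (L ^ (1 - τ) * levelWeight e T a) +
          (C₁ + 2 * C₂ + C₃) * (L ^ (1 - τ) * (levelWeight 1 Y a + levelWeight 1 Y a)) :=
          add_le_add (mul_le_mul_of_nonneg_right (by linarith) (by positivity))
            (mul_le_mul (by linarith) (mul_le_mul_of_nonneg_left (by linarith) (by positivity))
              (by positivity) (by positivity))
      _ = _ := by ring
  · rw [levelRisk, if_neg ha]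
    refine (henergy a).trans (ENNReal.ofReal_le_ofReal ?_)
    -- at these scales the variance term is bounded below
    have hSL : 1 / 2 ≤ scale a * L := by
      have := hfine a ha
      have h3 : L⁻¹ / 2 ≤ scale a := by linarith
      calc 1 / 2 = L⁻¹ / 2 * L := by field_simp
        _ ≤ _ := by gcongr
    have hS1 : scale a ^ (-e) ≤ 1 :=
      Real.rpow_le_one_of_one_le_of_nonpos (one_le_scale a) (by linarith)
    have h3 : scale a ^ (-e) ≤ 2 * (L ^ (1 - τ) * levelWeight e T a) := by
      rw [hw, mul_min_of_nonneg _ _ (by norm_num)]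
      refine le_min (by linarith) ?_
      have : 0 < scale a ^ (-e) := by positivity
      linarith
    calc C₂ * scale a ^ (-e) ≤ C₂ * (2 * (L ^ (1 - τ) * levelWeight e T a)) := by gcongr
      _ = 2 * C₂ * (L ^ (1 - τ) * levelWeight e T a) := by ring
      _ ≤ (C₁ + 2 * C₂ + C₃) * (L ^ (1 - τ) *
          (levelWeight e T a + levelWeight 1 Y a + levelWeight 1 Y a)) := by
          gcongr <;> linarith
      _ = _ := by ring

lemma min_sq_le_rpow {x L t : ℝ} (hL : 0 < L) (ht : 0 < t) (ht2 : t ≤ 2) :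
    min (x ^ 2) L ≤ L ^ (1 - t / 2) * |x| ^ t := by
  have h0 : 0 ≤ min (x ^ 2) L := le_min (sq_nonneg _) hL.le
  rcases h0.eq_or_lt with h | h
  · rw [← h]; positivity
  · calc min (x ^ 2) L = min (x ^ 2) L ^ (1 - t / 2) * min (x ^ 2) L ^ (t / 2) := by
          rw [← Real.rpow_add h]; simp
      _ ≤ L ^ (1 - t / 2) * (x ^ 2) ^ (t / 2) := by
          gcongr
          · linarith
          · exact min_le_right _ _
          · exact min_le_left _ _
      _ = _ := by
          rw [← sq_abs, ← Real.rpow_natCast, ← Real.rpow_mul (abs_nonneg x)]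
          congr 2; push_cast; ring

/-- The rate for bounded densities and `p ≤ 2`. The exponents `s` and `e = p s` are those of the
decay over the levels of the `ℓᵖ` norm of the coefficients and of its `p`-th power. The condition on `α`, `c` and `p` makes the bias due to the
levels which are not used negligible. -/
lemma exists_tsum_levelRisk_le_of_le_two (hA : 0 ≤ A)
    (hdec : ∀ a, IsBump A M (generator box ψ a)) (hc : 1 ≤ c) {R' : ℝ} (hR' : 0 ≤ R')
    (hα : 0 < α) (hαp : (p⁻¹).toReal - 1 / 2 < α)
    (hcα : (p⁻¹).toReal - 1 / 2 ≤ α * (1 - 1 / (c * (1 + 2 * α)))) (hR : 0 ≤ R)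
    (hp1 : 1 ≤ p) (hp : p ≤ 2) (hq : 1 ≤ q) :
    ∃ C : ℝ, 0 < C ∧ ∀ n : ℕ, 2 ≤ n → ∀ f ∈ besovBall ψ α p q R, IsDensity f →
      eLpNorm f ∞ volume ≤ ENNReal.ofReal R' →
      ∑' a, levelRisk ψ A c (maxLevel c (-c) n) n f a ≤
        ENNReal.ofReal (C * (Real.log n / n) ^ (2 * α / (2 * α + 1))) := by
  have hp' : p ≠ ∞ := ne_top_of_le_ne_top (by norm_num) hp
  have ht0 : 0 < p.toReal := ENNReal.toReal_pos (by positivity) hp'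
  have ht2 : p.toReal ≤ 2 := by
    have := ENNReal.toReal_mono (by norm_num) hp
    simpa using this
  have hell := fun (f : ℝ → ℝ) (hf : f ∈ besovBall ψ α p q R) (a : ℕ) =>
    ellNorm_coeff_le hq hf a
  rw [ENNReal.toReal_inv] at hαp hcα hell
  set t := p.toReal with ht
  set s := α + 1 / 2 - t⁻¹ with hs
  have hs0 : 0 < s := by linarith
  set e := t * (α + 1 / 2) - 1 with he
  have hts : t * s = e := by
    rw [hs, he, mul_sub, mul_inv_cancel₀ ht0.ne']
  have he0 : 0 < e := by rw [← hts]; positivity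
  set τ := 1 / (2 * α + 1) with hτ
  have hτ0 : 0 ≤ τ := by positivity
  have hrate : 2 * α / (2 * α + 1) = 1 - τ := by rw [hτ]; field_simp; ring
  have hbal : 1 - τ * (1 + e) = 1 - t / 2 := by rw [hτ, he]; field_simp; ring
  have hbias : 1 - τ ≤ c * (2 * s) := by
    have h1 : α / (c * (1 + 2 * α)) ≤ s := by
      have : α * (1 - 1 / (c * (1 + 2 * α))) = α - α / (c * (1 + 2 * α)) := by ring
      linarith
    have h2 : c * (2 * (α / (c * (1 + 2 * α)))) = 1 - τ := by
      rw [hτ]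
      have : 1 + 2 * α ≠ 0 := by positivity
      have : 2 * α + 1 ≠ 0 := by positivity
      have : c ≠ 0 := by positivity
      field_simp; ring
    rw [← h2]; gcongr
  obtain ⟨K, hK, hsum⟩ := exists_tsum_le_of_le_levelWeight he0 (by positivity : 0 < 2 * s)
  set C₀ := 1 + M ^ 2 * (R' * (2 * A)) + M ^ 2 * (R' * (2 * A)) ^ 2
  have hC₀ : 0 ≤ C₀ := by positivity
  set C₁ := (1 + M ^ 2) * (2 * A + 1)
  set C₂ := C₀ * R ^ t
  have hC₁ : 0 < C₁ := by positivity
  have hC₂ : 0 ≤ C₂ := by positivity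
  set C₃ := (2 * A + 1) * 2 ^ c
  have hC₃ : 0 ≤ C₃ := by positivity
  set C₄ := R ^ 2 * 2 ^ (1 + 2 * s)
  have hC₄ : 0 ≤ C₄ := by positivity
  refine ⟨(C₁ + C₂ + C₃ + C₄) * K, by positivity, fun n hn f hf hd hinf => ?_⟩
  have hL := log_div_pos hn
  have hL1 := log_div_le_one hn
  have hY := one_le_cutoff hn (by linarith : 0 ≤ c)
  have hT : 1 ≤ (Real.log n / n) ^ (-τ) := one_le_cutoff hn hτ0
  rw [hrate]
  have hB : ∀ a, 0 ≤ R * scale a ^ (-s) := fun a => by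
    have := scale_pos a
    positivity
  have henergy : ∀ a : ℕ, ∑' k : ℤ, ENNReal.ofReal (coeff ψ f ((a : ℤ) - 1) k ^ 2) ≤
      ENNReal.ofReal (R ^ 2 * scale a ^ (-(2 * s))) := by
    intro a
    refine (tsum_sq_le_of_le_two (hB a) hp1 hp (hell f hf a)).trans (le_of_eq ?_)
    congr 1
    rw [mul_pow, ← Real.rpow_natCast (scale a ^ (-s)), ← Real.rpow_mul (scale_pos a).le]
    congr 2; push_cast; ring
  have hpow : ∀ a : ℕ, ∑' k : ℤ, ENNReal.ofReal (|coeff ψ f ((a : ℤ) - 1) k| ^ t) ≤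
      ENNReal.ofReal (R ^ t * scale a ^ (-e)) := by
    intro a
    refine (tsum_coeff_rpow_le (hB a) hp1 hp' (hell f hf a)).trans (le_of_eq ?_)
    congr 1
    have := scale_pos a
    rw [Real.mul_rpow hR (by positivity), ← Real.rpow_mul this.le, ← hts]
    congr 2; ring
  have hmainle := fun a => tsum_min_le_scale (L := Real.log n / n) hA hdec hd hL.le a
  have hminle := fun a k => min_le_mul_min_of_bounded hR' hA hdec hd hinf hL a k
  have hlev := fun (a : ℕ) (ha : (a : ℤ) - 1 ≤ maxLevel c (-c) n) =>
    levelRisk_le_of_le (ψ := ψ) hA (by linarith : 0 ≤ c) hn hd ha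
  have hfine := fun (a : ℕ) (ha : ¬ (a : ℤ) - 1 ≤ maxLevel c (-c) n) =>
    scale_rpow_le_mul_levelWeight (by positivity : 0 < 2 * s) (by linarith)
      (le_scale_of_maxLevel_lt hn (by linarith : 0 ≤ c) ha)
  have hLrate : Real.log n / n ≤ (Real.log n / n) ^ (1 - τ) := by
    calc _ = (Real.log n / n) ^ (1 : ℝ) := (Real.rpow_one _).symm
      _ ≤ _ := Real.rpow_le_rpow_of_exponent_ge hL hL1 (by linarith)
  have hYrate : ((Real.log n / n) ^ (-c)) ^ (-(2 * s)) ≤ (Real.log n / n) ^ (1 - τ) := by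
    rw [← Real.rpow_mul hL.le]
    exact Real.rpow_le_rpow_of_exponent_ge hL hL1 (by linarith)
  set L := Real.log n / n
  set Y := L ^ (-c)
  set T := L ^ (-τ) with hTdef
  have hw := fun a => rpow_mul_levelWeight hL e τ a
  rw [hbal] at hw
  have hw1 : ∀ a, 0 ≤ levelWeight 1 Y a := levelWeight_nonneg (by linarith)
  have hwe : ∀ a, 0 ≤ levelWeight e T a := levelWeight_nonneg (by linarith)
  have hws : ∀ a, 0 ≤ levelWeight (2 * s) Y a := levelWeight_nonneg (by linarith)
  have hLr : 0 < L ^ (1 - τ) := by positivity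
  have hgoal := hsum (fun a => levelRisk ψ A c (maxLevel c (-c) n) n f a) T Y
    ((C₁ + C₂ + C₃ + C₄) * L ^ (1 - τ)) hT hY (by positivity) fun a => ?_
  · refine hgoal.trans (le_of_eq ?_)
    congr 1; ring
  have hS := scale_pos a
  have h1 := hw1 a
  have h2 := hwe a
  have h3 := hws a
  by_cases ha : (a : ℤ) - 1 ≤ maxLevel c (-c) n
  · refine (hlev a ha).trans ?_
    have hmain2 : ∑' k : ℤ, ENNReal.ofReal (min (coeff ψ f ((a : ℤ) - 1) k ^ 2)
        (L * ∫ x, wavelet box ψ ((a : ℤ) - 1) k x ^ 2 ∂(law f) + scale a * L ^ 2)) ≤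
        ENNReal.ofReal (C₂ * (L ^ (1 - t / 2) * scale a ^ (-e))) := by
      calc _ ≤ ∑' k : ℤ, ENNReal.ofReal (C₀ * L ^ (1 - t / 2)) *
            ENNReal.ofReal (|coeff ψ f ((a : ℤ) - 1) k| ^ t) := by
            refine ENNReal.tsum_le_tsum fun k => ?_
            rw [← ENNReal.ofReal_mul (by positivity)]
            refine ENNReal.ofReal_le_ofReal ((hminle a k).trans ?_)
            rw [mul_assoc]
            gcongr
            exact min_sq_le_rpow hL ht0 ht2
        _ ≤ ENNReal.ofReal (C₀ * L ^ (1 - t / 2)) * ENNReal.ofReal (R ^ t * scale a ^ (-e)) := by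
            rw [ENNReal.tsum_mul_left]
            gcongr
            exact hpow a
        _ = _ := by
            rw [← ENNReal.ofReal_mul (by positivity)]
            congr 1; ring
    have hmain : ∑' k : ℤ, ENNReal.ofReal (min (coeff ψ f ((a : ℤ) - 1) k ^ 2)
        (L * ∫ x, wavelet box ψ ((a : ℤ) - 1) k x ^ 2 ∂(law f) + scale a * L ^ 2)) ≤
        ENNReal.ofReal ((C₁ + C₂) * (L ^ (1 - τ) * levelWeight e T a)) := by
      rw [hw, mul_min_of_nonneg _ _ (by positivity), ENNReal.ofReal_min]
      refine le_min ((hmainle a).trans (ENNReal.ofReal_le_ofReal ?_))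
        (hmain2.trans (ENNReal.ofReal_le_ofReal ?_))
      · exact mul_le_mul_of_nonneg_right (by linarith) (by positivity)
      · exact mul_le_mul_of_nonneg_right (by linarith) (by positivity)
    refine (add_le_add_left hmain _).trans ?_
    rw [← ENNReal.ofReal_add (by positivity) (by positivity)]
    refine ENNReal.ofReal_le_ofReal ?_
    calc (C₁ + C₂) * (L ^ (1 - τ) * levelWeight e T a) + C₃ * (L * levelWeight 1 Y a)
        ≤ (C₁ + C₂) * (L ^ (1 - τ) * levelWeight e T a) +
          C₃ * (L ^ (1 - τ) * levelWeight 1 Y a) := by gcongr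
      _ ≤ (C₁ + C₂ + C₃ + C₄) * (L ^ (1 - τ) * levelWeight e T a) +
          (C₁ + C₂ + C₃ + C₄) * (L ^ (1 - τ) * (levelWeight 1 Y a + levelWeight (2 * s) Y a)) :=
          add_le_add (mul_le_mul_of_nonneg_right (by linarith) (by positivity))
            (mul_le_mul (by linarith) (mul_le_mul_of_nonneg_left (by linarith) (by positivity))
              (by positivity) (by positivity))
      _ = _ := by ring
  · rw [levelRisk, if_neg ha]
    refine (henergy a).trans (ENNReal.ofReal_le_ofReal ?_)
    calc R ^ 2 * scale a ^ (-(2 * s))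
        ≤ R ^ 2 * (2 ^ (1 + 2 * s) * (Y ^ (-(2 * s)) * levelWeight (2 * s) Y a)) := by
          gcongr
          exact hfine a ha
      _ ≤ R ^ 2 * (2 ^ (1 + 2 * s) * (L ^ (1 - τ) * levelWeight (2 * s) Y a)) := by gcongr
      _ = C₄ * (L ^ (1 - τ) * levelWeight (2 * s) Y a) := by ring
      _ ≤ (C₁ + C₂ + C₃ + C₄) * (L ^ (1 - τ) *
          (levelWeight e T a + levelWeight 1 Y a + levelWeight (2 * s) Y a)) := by
          gcongr <;> linarith
      _ = _ := by ring

end Rates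

end WaveletDensity

end

theorem theorem3 (r : ℝ) (hr : 0 < r) (ψ φt ψt : ℝ → ℝ)
    (hΦ : IsBiorthogonalWaveletBasis r ψ φt ψt)
    (R R' : ℝ) (hR : 0 < R) (hR' : 0 < R')
    (p q : ℝ≥0∞) (hp : 1 ≤ p) (hq : 1 ≤ q)
    (α : ℝ) (hα : max 0 ((p⁻¹).toReal - 1 / 2) < α) (hαr : α < r + 1)
    (c : ℝ) (hc : 1 ≤ c)
    (hcα : (p⁻¹).toReal - 1 / 2 ≤ α * (1 - 1 / (c * (1 + 2 * α))))
    (γ : ℝ) (hγ : c < γ) :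
    ∃ C : ℝ, 0 < C ∧ ∀ n : ℕ, 2 ≤ n →
      (p ≤ 2 →
        (⨆ f ∈ besovBall ψ α p q R ∩ densityL2Linf R',
            risk (n := n) (estimator ψ φt ψt c (-c) γ) f) ≤
          ENNReal.ofReal (C * (Real.log n / n) ^ (2 * α / (2 * α + 1)))) ∧
      (2 < p →
        (⨆ f ∈ besovBall ψ α p q R ∩ densityL2 R',
            risk (n := n) (estimator ψ φt ψt c (-c) γ) f) ≤
          ENNReal.ofReal (C * (Real.log n / n) ^ (α / (α + 1 - (p⁻¹).toReal)))) := by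
  obtain ⟨hα0, hαp⟩ := max_lt_iff.1 hα
  obtain ⟨A, M, Λ, hA, hM, -, hdec, -, -⟩ := hΦ.exists_bounds hr
  have hA0 : 0 ≤ A := by linarith
  obtain ⟨K, hK, hrisk⟩ := exists_risk_le hΦ hr hdec hc hγ (-c)
  rcases le_or_gt p 2 with hp2 | hp2
  · obtain ⟨C, hC, hlev⟩ := exists_tsum_levelRisk_le_of_le_two (q := q) hA0 hdec hc hR'.le hα0 hαp
      hcα hR.le hp hp2 hq
    refine ⟨K * C, by positivity, fun n hn => ⟨fun _ => ?_, fun h => absurd h (not_lt.2 hp2)⟩⟩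
    refine iSup₂_le fun f hf => ?_
    obtain ⟨hB, hd, -, hinf⟩ := hf
    refine (hrisk n hn f hd hB.1).trans ?_
    rw [mul_assoc, ENNReal.ofReal_mul hK.le]
    gcongr
    exact hlev n hn f hB hd hinf
  · obtain ⟨C, hC, hlev⟩ := exists_tsum_levelRisk_le_of_two_lt (q := q) hA0 hM hdec hc hα0 hR.le
      hp2 hq
    refine ⟨K * C, by positivity, fun n hn => ⟨fun h => absurd h (not_le.2 hp2), fun _ => ?_⟩⟩
    refine iSup₂_le fun f hf => ?_
    obtain ⟨hB, hd, -⟩ := hf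
    refine (hrisk n hn f hd hB.1).trans ?_
    rw [mul_assoc, ENNReal.ofReal_mul hK.le]
    gcongr
    exact hlev n hn f hB hd
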